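/- \textbf{Setting.} An influence Fisher market has $n\ge 1$ buyers, $m\ge 1$ divisible goods (one unit of each), a directed graph without loops on the buyers, budgets $b_i>0$, and utilities $u_i(x_i,x_{N_i})$, defined for nonnegative bundles, where $x_i\in\mathbb R_+^m$ is buyer $i$'s bundle and $x_{N_i}$ lists the bundles of her in-neighbours in the graph. Assume that each $u_i$ is nonnegative, continuous, jointly concave in $(x_i,x_{N_i})$, homogeneous of degree 1 in $x_i$ (that is, $u_i(\lambda x_i,x_{N_i})=\lambda u_i(x_i,x_{N_i})$ for $\lambda\ge 0$), unsaturated (for all $x_i,x_{N_i}$ some $x_i'\ge 0$ has $u_i(x_i',x_{N_i})>u_i(x_i,x_{N_i})$), and $C^2$ (up to the boundary of the nonnegative orthant) on the set where $u_i>0$. Let $X=\{x\in\mathbb R_+^{n\times m}:\sum_i x_{ij}\le 1\ \forall j\}$. A pair $(x,p)$ with $x\in X$, $p\in\mathbb R_+^m$ is an $\varepsilon$-competitive equilibrium ($\varepsilon$-CE) if, for every $i$, $p\cdot x_i\le b_i$ and $u_i(x_i,x_{N_i})\ge u_i(z,x_{N_i})-\varepsilon$ for all $z\in\mathbb R_+^m$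 with $p\cdot z\le b_i$, and $\left|\sum_j p_j(\sum_i x_{ij}-1)\right|\le\varepsilon$. A competitive equilibrium (CE) is a $0$-CE, and $x$ is an ($\varepsilon$-)CE allocation if $(x,p)$ is an ($\varepsilon$-)CE for some $p$. Let $F(x)=\bigl(-\nabla_{x_i}\,[\,b_i\log u_i(x_i,x_{N_i})\,]\bigr)_i$ be the operator of the buyer pseudo-game, on $X_+=\{x\in X: u_i(x_i,x_{N_i})>0\ \forall i\}$ (with one-sided derivatives at the boundary of the orthant), and let $\Pi_X$ be the Euclidean projection onto $X$. The extragradient method with step size $\eta$ is $$y^{t}=\Pi_X(x^t-\eta F(x^t)),\qquad x^{t+1}=\Pi_X(x^t-\eta F(y^t)).$$ \textbf{Theorem.} (1) In every such market, $F$ is monotone on $X_+$, and $X_+\neq\emptyset$. For every $x^0\in X_+$ there is $\eta_0>0$ such that for every $\eta\in(0,\eta_0]$: all $x^t$ and $y^t$ lie in $X_+$; the iterates $x^t$ converge to a CE allocation; and there is a constant $C$ (depending on the market, $x^0$ and $\eta$) such that for every $T\ge1$ the last iterate satisfies $\langle F(x^T),x^T-z\rangle\le C/T$ for all $z\in X$,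 and $x^T$ is a $(C/T)$-CE allocation. (2) $\varepsilon$-CE allocations can be computed in polynomial time: there are a single program for a real-number machine (exact real arithmetic and comparisons, rational constants, counting and indexing registers, and unit-cost oracle access to the values and own-bundle partial derivatives of the $u_i$) and constants $c,k\in\mathbb N$ such that, for every such market and every $\varepsilon>0$, the program, given $n,m,b,\varepsilon$, halts after at most $c\,S^k$ steps with an $\varepsilon$-CE allocation as its output, where $$S=n+m+\frac1\varepsilon+\sum_i\Bigl(b_i+\frac1{b_i}+u_i(\mathbf 1,\mathbf 1)\Bigr)$$ and $u_i(\mathbf 1,\mathbf 1)$ is buyer $i$'s utility when she and all her neighbours hold one unit of every good. -/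

import Mathlib

open Filter Topology

/-! ### Influence Fisher markets -/

/-- An allocation of `m` goods to `n` buyers: `x i j` is the amount of good `j` held by buyer `i`. -/
abbrev Alloc (n m : ℕ) : Type := Fin n → Fin m → ℝ

open Classical in
/-- The in-neighbours of `i`: the buyers `k` with an edge from `k` to `i`. -/
noncomputable def inNbrs {n : ℕ} (G : Digraph (Fin n)) (i : Fin n) : Finset (Fin n) :=
  Finset.univ.filter fun k => G.Adj k i

/-- A Fisher market with social influence, with one unit of each good. The utility of buyer `i`
takes her own bundle and the bundles of her in-neighbours; only its values at nonnegative bundles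
are ever relevant. -/
structure InfluenceFisherMarket (n m : ℕ) where
  graph : Digraph (Fin n)
  loopless : ∀ i, ¬ graph.Adj i i
  utility : (i : Fin n) → (Fin m → ℝ) × ({k // k ∈ inNbrs graph i} → Fin m → ℝ) → ℝ
  budget : Fin n → ℝ
  budget_nonneg : ∀ i, 0 ≤ budget i

namespace InfluenceFisherMarket

variable {n m : ℕ} (M : InfluenceFisherMarket n m)

/-- Utility of buyer `i` when she holds `z` and her neighbours hold what `x` gives them. -/
def util (i : Fin n) (z : Fin m → ℝ) (x : Alloc n m) : ℝ :=
  M.utility i (z, fun k => x k.1)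

/-- Cost of the bundle `z` at prices `p`. -/
def cost (p z : Fin m → ℝ) : ℝ := ∑ j, p j * z j

/-- Feasible allocations: nonnegative, and at most one unit of each good is handed out. -/
def feasible (n m : ℕ) : Set (Alloc n m) :=
  {x | (∀ i j, 0 ≤ x i j) ∧ ∀ j, ∑ i, x i j ≤ 1}

/-- `(x, p)` is a competitive equilibrium. -/
structure IsCE (x : Alloc n m) (p : Fin m → ℝ) : Prop where
  price_nonneg : ∀ j, 0 ≤ p j
  feasible : x ∈ feasible n m
  affordable : ∀ i, cost p (x i) ≤ M.budget i
  optimal : ∀ i, ∀ z : Fin m → ℝ, (∀ j, 0 ≤ z j) → cost p z ≤ M.budget i →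
    M.util i z x ≤ M.util i (x i) x
  walras : ∑ j, p j * (∑ i, x i j - 1) = 0

/-- `(x, p)` is an `ε`-competitive equilibrium: prices are nonnegative, feasibility and the budget
constraints hold exactly, every buyer is within `ε` of her optimal utility, and Walras' law holds
up to `ε`. -/
structure IsApproxCE (ε : ℝ) (x : Alloc n m) (p : Fin m → ℝ) : Prop where
  price_nonneg : ∀ j, 0 ≤ p j
  feasible : x ∈ feasible n m
  affordable : ∀ i, cost p (x i) ≤ M.budget i
  optimal : ∀ i, ∀ z : Fin m → ℝ, (∀ j, 0 ≤ z j) → cost p z ≤ M.budget i →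
    M.util i z x ≤ M.util i (x i) x + ε
  walras : |∑ j, p j * (∑ i, x i j - 1)| ≤ ε

/-- `x` is a competitive equilibrium allocation. -/
def IsCEAlloc (x : Alloc n m) : Prop := ∃ p, M.IsCE x p

/-- `x` is an `ε`-competitive equilibrium allocation. -/
def IsApproxCEAlloc (ε : ℝ) (x : Alloc n m) : Prop := ∃ p, M.IsApproxCE ε x p

/-- The assumptions on the market. The logarithms of the utilities are the payoffs of the buyer
pseudo-game, so utilities are nonnegative, and second derivatives are asked for only where the
utility is positive: a function that is homogeneous in `x_i` and differentiable at `x_i = 0` would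
be linear in `x_i`. `Set.Ici 0` is the set of nonnegative arguments. -/
structure Regular : Prop where
  budget_pos : ∀ i, 0 < M.budget i
  utility_nonneg : ∀ i, ∀ z ∈ Set.Ici (0 : (Fin m → ℝ) × ({k // k ∈ inNbrs M.graph i} → Fin m → ℝ)),
    0 ≤ M.utility i z
  no_saturation : ∀ i, ∀ z : Fin m → ℝ, 0 ≤ z →
    ∀ w : {k // k ∈ inNbrs M.graph i} → Fin m → ℝ, 0 ≤ w →
      ∃ z' : Fin m → ℝ, 0 ≤ z' ∧ M.utility i (z, w) < M.utility i (z', w)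
  continuous : ∀ i, ContinuousOn (M.utility i) (Set.Ici 0)
  homogeneous : ∀ i, ∀ c : ℝ, 0 ≤ c → ∀ z : Fin m → ℝ, 0 ≤ z →
    ∀ w : {k // k ∈ inNbrs M.graph i} → Fin m → ℝ, 0 ≤ w →
      M.utility i (c • z, w) = c * M.utility i (z, w)
  jointly_concave : ∀ i, ConcaveOn ℝ (Set.Ici 0) (M.utility i)
  contDiff : ∀ i, ContDiffOn ℝ 2 (M.utility i) (Set.Ici 0 ∩ {z | 0 < M.utility i z})

/-! ### The buyer pseudo-game, its variational inequality, and extragradient -/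

/-- Payoff of buyer `i` in the buyer pseudo-game when she plays `z` and the others play as in `x`. -/
noncomputable def payoff (i : Fin n) (z : Fin m → ℝ) (x : Alloc n m) : ℝ :=
  M.budget i * Real.log (M.util i z x)

/-- The operator of the variational inequality of the buyer pseudo-game: minus the partial
derivatives of the payoffs of the buyers in their own bundles (one-sided at the boundary of the
nonnegative orthant). -/
noncomputable def viOp (x : Alloc n m) : Alloc n m := fun i j =>
  -(fderivWithin ℝ (fun z => M.payoff i z x) (Set.Ici 0) (x i) (Pi.single j 1))

/-- Euclidean inner product of two matrices. -/
def dot (x y : Alloc n m) : ℝ := ∑ i, ∑ j, x i j * y i j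

/-- Euclidean projection onto `C`: a point of `C` at least distance from `z`
(it exists and is unique for nonempty closed convex `C`). -/
noncomputable def euclProj (C : Set (Alloc n m)) (z : Alloc n m) : Alloc n m :=
  Classical.epsilon fun p => p ∈ C ∧ ∀ y ∈ C, dot (p - z) (p - z) ≤ dot (y - z) (y - z)

/-- The extrapolation point of the extragradient method with step size `η` at `x`. -/
noncomputable def egHalf (η : ℝ) (x : Alloc n m) : Alloc n m :=
  euclProj (feasible n m) (x - η • M.viOp x)

/-- The extragradient iterates for the variational inequality of the buyer pseudo-game over the
set of feasible allocations, with constant step size `η` and starting point `x₀`. -/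
noncomputable def egIter (η : ℝ) (x₀ : Alloc n m) : ℕ → Alloc n m
  | 0 => x₀
  | t + 1 => euclProj (feasible n m)
      (egIter η x₀ t - η • M.viOp (M.egHalf η (egIter η x₀ t)))

/-- The feasible allocations at which all the payoffs of the buyer pseudo-game are defined. -/
def feasiblePos : Set (Alloc n m) :=
  {x | x ∈ feasible n m ∧ ∀ i, 0 < M.util i (x i) x}

end InfluenceFisherMarket

/-! ### A real-number machine with a step count

Programs are while-programs over natural-number registers, used only for counting and indexing, and
two-dimensional arrays of real numbers, with exact real arithmetic, rational constants, comparisons,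
and a first-order oracle for the utilities. -/

/-- A memory state: natural-number registers, and real arrays (name, row, column). -/
structure Store where
  nat : ℕ → ℕ
  real : ℕ → ℕ → ℕ → ℝ

/-- Real expressions; `cell a v w` is the entry of array `a` whose row and column are the contents
of registers `v` and `w`. -/
inductive RExp : Type
  | const (q : ℚ)
  | cell (a v w : ℕ)
  | add (e f : RExp)
  | sub (e f : RExp)
  | mul (e f : RExp)
  | div (e f : RExp)

namespace RExp

noncomputable def eval (s : Store) : RExp → ℝ
  | const q => (q : ℝ)
  | cell a v w => s.real a (s.nat v) (s.nat w)
  | add e f => eval s e + eval s f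
  | sub e f => eval s e - eval s f
  | mul e f => eval s e * eval s f
  | div e f => eval s e / eval s f

/-- The number of nodes of an expression. -/
def size : RExp → ℕ
  | const _ => 1
  | cell _ _ _ => 1
  | add e f => size e + size f + 1
  | sub e f => size e + size f + 1
  | mul e f => size e + size f + 1
  | div e f => size e + size f + 1

end RExp

/-- Tests: comparison of two registers, or of two real expressions. -/
inductive Test : Type
  | natLt (v w : ℕ)
  | realLt (e f : RExp)

namespace Test

def holds (s : Store) : Test → Prop
  | natLt v w => s.nat v < s.nat w
  | realLt e f => e.eval s < f.eval s

def size : Test → ℕ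
  | natLt _ _ => 1
  | realLt e f => e.size + f.size + 1

end Test

/-- Programs. `askValue a v w i x` stores in cell `(a, v, w)` the utility of the buyer whose number
is in register `i` at the allocation held in array `x`; `askPartial a v w i j x` stores the partial
derivative of that utility in the buyer's own amount of the good whose number is in register `j`. -/
inductive Prog : Type
  | natZero (v : ℕ)
  | natSucc (v : ℕ)
  | natCopy (v w : ℕ)
  | assign (a v w : ℕ) (e : RExp)
  | askValue (a v w i x : ℕ)
  | askPartial (a v w i j x : ℕ)
  | seq (P Q : Prog)
  | ite (b : Test) (P Q : Prog)
  | loop (b : Test) (P : Prog)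

/-- A first-order oracle: values and partial derivatives at the contents of an array. -/
structure FirstOrderOracle where
  value : ℕ → (ℕ → ℕ → ℝ) → ℝ
  partialDeriv : ℕ → ℕ → (ℕ → ℕ → ℝ) → ℝ

namespace Store

def setNat (s : Store) (v k : ℕ) : Store where
  nat := Function.update s.nat v k
  real := s.real

/-- Overwrite the cell of array `a` at the row and column held in registers `v` and `w`. -/
noncomputable def setReal (s : Store) (a v w : ℕ) (r : ℝ) : Store where
  nat := s.nat
  real := fun a' i j => if a' = a ∧ i = s.nat v ∧ j = s.nat w then r else s.real a' i j

end Store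

/-- `Exec O P s s' t`: with oracle `O`, the program `P` started in state `s` halts in state `s'`
after `t` steps. Every register operation and every oracle call costs one step, and evaluating an
expression or a test costs its size. -/
inductive Exec (O : FirstOrderOracle) : Prog → Store → Store → ℕ → Prop
  | natZero (s : Store) (v : ℕ) : Exec O (.natZero v) s (s.setNat v 0) 1
  | natSucc (s : Store) (v : ℕ) : Exec O (.natSucc v) s (s.setNat v (s.nat v + 1)) 1
  | natCopy (s : Store) (v w : ℕ) : Exec O (.natCopy v w) s (s.setNat v (s.nat w)) 1
  | assign (s : Store) (a v w : ℕ) (e : RExp) :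
      Exec O (.assign a v w e) s (s.setReal a v w (e.eval s)) (e.size + 1)
  | askValue (s : Store) (a v w i x : ℕ) :
      Exec O (.askValue a v w i x) s (s.setReal a v w (O.value (s.nat i) (s.real x))) 1
  | askPartial (s : Store) (a v w i j x : ℕ) :
      Exec O (.askPartial a v w i j x) s
        (s.setReal a v w (O.partialDeriv (s.nat i) (s.nat j) (s.real x))) 1
  | seq {P Q : Prog} {s s' s'' : Store} {t t' : ℕ} :
      Exec O P s s' t → Exec O Q s' s'' t' → Exec O (.seq P Q) s s'' (t + t')
  | ite_true {b : Test} {P Q : Prog} {s s' : Store} {t : ℕ} :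
      b.holds s → Exec O P s s' t → Exec O (.ite b P Q) s s' (b.size + t)
  | ite_false {b : Test} {P Q : Prog} {s s' : Store} {t : ℕ} :
      ¬ b.holds s → Exec O Q s s' t → Exec O (.ite b P Q) s s' (b.size + t)
  | loop_stop {b : Test} {P : Prog} {s : Store} :
      ¬ b.holds s → Exec O (.loop b P) s s b.size
  | loop_step {b : Test} {P : Prog} {s s' s'' : Store} {t t' : ℕ} :
      b.holds s → Exec O P s s' t → Exec O (.loop b P) s' s'' t' →
        Exec O (.loop b P) s s'' (b.size + t + t')

namespace InfluenceFisherMarket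

variable {n m : ℕ} (M : InfluenceFisherMarket n m)

/-- The upper left `n × m` block of an array. -/
def readAlloc (n m : ℕ) (A : ℕ → ℕ → ℝ) : Alloc n m := fun i j => A i j

/-- The first-order oracle of a market. -/
noncomputable def oracle : FirstOrderOracle where
  value i A := if h : i < n then
      M.util ⟨i, h⟩ (readAlloc n m A ⟨i, h⟩) (readAlloc n m A)
    else 0
  partialDeriv i j A := if h : i < n ∧ j < m then
      fderivWithin ℝ (fun z => M.util ⟨i, h.1⟩ z (readAlloc n m A)) (Set.Ici 0)
        (readAlloc n m A ⟨i, h.1⟩) (Pi.single ⟨j, h.2⟩ 1)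
    else 0

/-- The input: `n` and `m` in registers `0` and `1`, the budgets in column `0` of array `0`, and the
accuracy `ε` in cell `(0, 0)` of array `1`; everything else is zero. -/
noncomputable def input (ε : ℝ) : Store where
  nat v := if v = 0 then n else if v = 1 then m else 0
  real a i j :=
    if a = 0 ∧ j = 0 then (if h : i < n then M.budget ⟨i, h⟩ else 0)
    else if a = 1 ∧ i = 0 ∧ j = 0 then ε
    else 0

/-- The output: the `n × m` block of array `2`. -/
def output (n m : ℕ) (s : Store) : Alloc n m := readAlloc n m (s.real 2)

/-- The size of the problem of computing an `ε`-equilibrium: the numbers of buyers and goods, `1/ε`,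
the budgets and their inverses, and the utilities when everyone holds one unit of every good. -/
noncomputable def problemSize (ε : ℝ) : ℝ :=
  n + m + 1 / ε + ∑ i, (M.budget i + 1 / M.budget i + M.util i 1 1)

end InfluenceFisherMarket

/-! There is in fact no influence. A nonnegative function that is jointly concave on the whole
orthant and homogeneous in the own bundle cannot depend on the neighbours' bundles: decompose (z, w
+ s w') as s (z/s, w') + (1 - s) (0, w/(1 - s)) and let s → 0 (`Regular.utility_le`). The market is
an ordinary Fisher market, and F is the gradient of the convex Eisenberg–Gale potential f(x) = -∑
b_i log u_i(x_i). Two facts about a concave homogeneous v are used throughout: Euler's identity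
∇v(z)·z = v(z) and the inequality v(y) ≤ ∇v(z)·y.

Part (1). On feasible allocations whose utilities are all at least some δ > 0, compactness bounds
the second derivatives, so F is cocoercive there (`IsCCH.exists_cocoercive`). An extragradient step
is then an inexact proximal step. Its residual ξ, a subgradient of f plus the indicator of X at the
new point, dominates the error of the step, so f decreases by at least (η/2)‖ξ‖². Hence the iterates
never leave a sublevel set of f, on which utilities are bounded below, and the local constants
remain valid. The decrease of f gives f-differences of order 1/t. Since ‖ξ‖ is also nonincreasing,
summing the decrease over the second half of a run gives ‖ξ‖ = O(1/T), and ‖ξ‖ times the diameter of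
X bounds the gap. Fejér monotonicity turns a convergent subsequence into convergence of the whole
sequence. A point of gap γ becomes an O(γ)-equilibrium when each good is priced at its largest
marginal payoff, scaled down to fit the budgets (`isApproxCEAlloc_of_gap`).

Part (2). The constants of part (1) depend on second derivatives, which the problem size does not
control, so another algorithm is run: one multiplicative weights learner per good, with buyers as
experts and marginal payoffs b_i ∂_j log u_i as gains. Mixing with a uniform share τ keeps every
gain below S/τ by Euler's identity alone. Comparison with an equilibrium x*, which exists by part
(1), makes ∑ b_i (u_i(x*)/u_i(y) - 1) small at the mean y of the iterates. This forces both the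
utilities and the spending at y to be nearly those of an equilibrium
(`IsCE.isApproxCEAlloc_of_ratio`). A Hoare-style calculus with step counts, `Runs`, carries this
over to the machine. -/

/-! ### Concave homogeneous utilities and the gradients of their logarithms. -/

/-- Continuous, concave, homogeneous utilities of one bundle (superadditivity stands for
concavity), of class `C²` where they are positive. -/
structure IsCCH {m : ℕ} (v : (Fin m → ℝ) → ℝ) : Prop where
  nonneg : ∀ z, 0 ≤ z → 0 ≤ v z
  continuousOn : ContinuousOn v (Set.Ici 0)
  smul : ∀ c : ℝ, 0 ≤ c → ∀ z, 0 ≤ z → v (c • z) = c * v z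
  add_le : ∀ z, 0 ≤ z → ∀ z', 0 ≤ z' → v z + v z' ≤ v (z + z')
  exists_pos : ∃ z, 0 ≤ z ∧ 0 < v z
  contDiffOn : ContDiffOn ℝ 2 v (Set.Ici 0 ∩ {z | 0 < v z})

/-- The gradient of `log v`, one-sided at the boundary of the orthant. -/
noncomputable def logGrad {m : ℕ} (v : (Fin m → ℝ) → ℝ) (z : Fin m → ℝ) (j : Fin m) : ℝ :=
  fderivWithin ℝ v (Set.Ici 0) z (Pi.single j 1) / v z

theorem isOpen_setOf_forall_pos {m : ℕ} : IsOpen {z : Fin m → ℝ | ∀ j, 0 < z j} := by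
  simp only [Set.ofPred_forall]
  exact isOpen_iInter_of_finite fun j => isOpen_lt continuous_const (continuous_apply j)

theorem nonempty_interior_orthant {m : ℕ} : (interior (Set.Ici (0 : Fin m → ℝ))).Nonempty :=
  ⟨1, mem_interior.2 ⟨{z | ∀ j, 0 < z j}, fun _ hz j => (hz j).le, isOpen_setOf_forall_pos,
    fun _ => one_pos⟩⟩

theorem uniqueDiffOn_orthant {m : ℕ} : UniqueDiffOn ℝ (Set.Ici (0 : Fin m → ℝ)) :=
  uniqueDiffOn_convex (convex_Ici 0) nonempty_interior_orthant

namespace IsCCH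

variable {m : ℕ} {v : (Fin m → ℝ) → ℝ} (hv : IsCCH v)

include hv

theorem mono {z z' : Fin m → ℝ} (hz : 0 ≤ z) (h : z ≤ z') : v z ≤ v z' := by
  have h1 := hv.add_le z hz (z' - z) (sub_nonneg.2 h)
  have h2 := hv.nonneg (z' - z) (sub_nonneg.2 h)
  rw [add_sub_cancel] at h1
  linarith

theorem map_zero : v 0 = 0 := by
  have := hv.smul 0 le_rfl 0 le_rfl
  simpa using this

/-- A multiple of an interior point dominates a point of positive utility, so monotonicity and
homogeneity transfer positivity. -/
theorem pos_of_pos {z : Fin m → ℝ} (hz : ∀ j, 0 < z j) : 0 < v z := by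
  obtain ⟨y, hy, hvy⟩ := hv.exists_pos
  have hz0 : 0 ≤ z := fun j => (hz j).le
  obtain ⟨c, hc⟩ : ∃ c : ℝ, ∀ j, y j / z j ≤ c := by
    obtain ⟨c, hc⟩ := (Set.finite_range fun j => y j / z j).bddAbove
    exact ⟨c, fun j => hc ⟨j, rfl⟩⟩
  have h1 : y ≤ max c 0 • z := fun j => by
    have := (div_le_iff₀ (hz j)).1 ((hc j).trans (le_max_left c 0))
    simpa using this
  have h2 := hv.mono hy h1
  rw [hv.smul _ (le_max_right _ _) z hz0] at h2
  by_contra h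
  have := hv.nonneg z hz0
  have h0 : v z = 0 := le_antisymm (not_lt.1 h) this
  rw [h0] at h2
  linarith

/-- Since the domain of `log v` is relatively open in the orthant, derivatives within it and within
the orthant coincide. -/
theorem exists_isOpen : ∃ U : Set (Fin m → ℝ), IsOpen U ∧
    Set.Ici 0 ∩ {z | 0 < v z} = Set.Ici 0 ∩ U := by
  obtain ⟨U, hU, h⟩ := continuousOn_iff'.1 hv.continuousOn (Set.Ioi 0) isOpen_Ioi
  refine ⟨U, hU, ?_⟩
  rw [Set.inter_comm _ U, ← h, Set.inter_comm]
  rfl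

theorem differentiableWithinAt {z : Fin m → ℝ} (hz : 0 ≤ z) (hp : 0 < v z) :
    DifferentiableWithinAt ℝ v (Set.Ici 0) z := by
  obtain ⟨U, hU, h⟩ := hv.exists_isOpen
  have hz' : z ∈ Set.Ici 0 ∩ {z | 0 < v z} := ⟨hz, hp⟩
  have h1 := (hv.contDiffOn.differentiableOn (by norm_num)) z hz'
  rw [h] at h1 hz'
  exact (differentiableWithinAt_inter (hU.mem_nhds hz'.2)).1 h1

theorem hasDerivWithinAt_ray {z y : Fin m → ℝ} (hz : 0 ≤ z) (hp : 0 < v z) (hy : 0 ≤ y) :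
    HasDerivWithinAt (fun s : ℝ => v (z + s • y)) (fderivWithin ℝ v (Set.Ici 0) z y)
      (Set.Ici 0) 0 := by
  have h1 : HasDerivWithinAt (fun s : ℝ => z + s • y) y (Set.Ici 0) 0 := by
    have := ((hasDerivAt_id (0 : ℝ)).smul_const y).const_add z
    simpa using this.hasDerivWithinAt
  have h2 := (hv.differentiableWithinAt hz hp).hasFDerivWithinAt
  have h3 : HasFDerivWithinAt v (fderivWithin ℝ v (Set.Ici 0) z) (Set.Ici 0)
      ((fun s : ℝ => z + s • y) 0) := by simpa using h2
  exact h3.comp_hasDerivWithinAt (0 : ℝ) h1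
    (fun s hs => add_nonneg hz (smul_nonneg hs hy))

/-- By superadditivity and homogeneity, every difference quotient (v(z + s y) - v(z))/s with s > 0
is already at least v(y). -/
theorem le_fderivWithin {z y : Fin m → ℝ} (hz : 0 ≤ z) (hp : 0 < v z) (hy : 0 ≤ y) :
    v y ≤ fderivWithin ℝ v (Set.Ici 0) z y := by
  have h := hasDerivWithinAt_iff_tendsto_slope.1 (hv.hasDerivWithinAt_ray hz hp hy)
  have h' : Tendsto (slope (fun s : ℝ => v (z + s • y)) 0) (𝓝[>] 0)
      (𝓝 (fderivWithin ℝ v (Set.Ici 0) z y)) := by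
    refine h.mono_left (nhdsWithin_mono _ fun s (hs : 0 < s) => ⟨hs.le, hs.ne'⟩)
  refine ge_of_tendsto h' ?_
  filter_upwards [self_mem_nhdsWithin] with s hs
  have hs' : (0 : ℝ) < s := hs
  have := hv.add_le z hz (s • y) (smul_nonneg hs'.le hy)
  rw [hv.smul s hs'.le y hy] at this
  simp only [slope_def_field, sub_zero, zero_smul, add_zero]
  rw [le_div_iff₀ hs']
  linarith

/-- Euler's identity: v is linear on the ray z + s z = (1 + s) z, and the one-sided derivative is
unique. -/
theorem fderivWithin_self {z : Fin m → ℝ} (hz : 0 ≤ z) (hp : 0 < v z) :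
    fderivWithin ℝ v (Set.Ici 0) z z = v z := by
  have h1 := hv.hasDerivWithinAt_ray hz hp hz
  have h2 : HasDerivWithinAt (fun s : ℝ => v (z + s • z)) (v z) (Set.Ici 0) 0 := by
    have h3 : HasDerivWithinAt (fun s : ℝ => (1 + s) * v z) (v z) (Set.Ici 0) 0 := by
      have := (((hasDerivAt_id (0 : ℝ)).const_add 1).mul_const (v z))
      simpa using this.hasDerivWithinAt
    refine h3.congr (fun s hs => ?_) (by simp)
    rw [← hv.smul (1 + s) (by have : (0 : ℝ) ≤ s := hs; linarith) z hz, add_smul, one_smul]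
  exact (uniqueDiffOn_Ici (0 : ℝ) 0 Set.self_mem_Ici).eq_deriv _ h1 h2

omit hv in
theorem sum_logGrad_mul (z y : Fin m → ℝ) :
    ∑ j, logGrad v z j * y j = fderivWithin ℝ v (Set.Ici 0) z y / v z := by
  conv_rhs => rw [pi_eq_sum_univ' y]
  simp only [map_sum, Finset.sum_div, logGrad]
  refine Finset.sum_congr rfl fun j _ => ?_
  rw [map_smul, smul_eq_mul]
  ring

theorem div_le_sum_logGrad {z y : Fin m → ℝ} (hz : 0 ≤ z) (hp : 0 < v z) (hy : 0 ≤ y) :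
    v y / v z ≤ ∑ j, logGrad v z j * y j := by
  rw [sum_logGrad_mul]
  exact div_le_div_of_nonneg_right (hv.le_fderivWithin hz hp hy) hp.le

theorem sum_logGrad_self {z : Fin m → ℝ} (hz : 0 ≤ z) (hp : 0 < v z) :
    ∑ j, logGrad v z j * z j = 1 := by
  rw [sum_logGrad_mul, hv.fderivWithin_self hz hp, div_self hp.ne']

theorem logGrad_nonneg {z : Fin m → ℝ} (hz : 0 ≤ z) (hp : 0 < v z) (j : Fin m) :
    0 ≤ logGrad v z j := by
  have h : (0 : Fin m → ℝ) ≤ Pi.single j 1 := Pi.single_nonneg.2 zero_le_one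
  exact div_nonneg ((hv.nonneg _ h).trans (hv.le_fderivWithin hz hp h)) hp.le

theorem logGrad_mul_le_one {z : Fin m → ℝ} (hz : 0 ≤ z) (hp : 0 < v z) (j : Fin m) :
    logGrad v z j * z j ≤ 1 := by
  rw [← hv.sum_logGrad_self hz hp]
  exact Finset.single_le_sum (f := fun j => logGrad v z j * z j)
    (fun j _ => mul_nonneg (hv.logGrad_nonneg hz hp j) (hz j)) (Finset.mem_univ j)

/-- Apply log r ≤ r - 1 to r = v(y)/v(z). The term 1 is `sum_logGrad_self`, and r is bounded by
`div_le_sum_logGrad`. -/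
theorem log_sub_log_le {z y : Fin m → ℝ} (hz : 0 ≤ z) (hp : 0 < v z) (hy : 0 ≤ y)
    (hpy : 0 < v y) :
    Real.log (v y) - Real.log (v z) ≤ ∑ j, logGrad v z j * (y j - z j) := by
  have h1 := hv.div_le_sum_logGrad hz hp hy
  have h2 := hv.sum_logGrad_self hz hp
  have h3 := Real.log_le_sub_one_of_pos (div_pos hpy hp)
  rw [Real.log_div hpy.ne' hp.ne'] at h3
  simp only [mul_sub, Finset.sum_sub_distrib]
  linarith

theorem logGrad_antitone {z y : Fin m → ℝ} (hz : 0 ≤ z) (hp : 0 < v z) (hy : 0 ≤ y)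
    (hpy : 0 < v y) :
    ∑ j, (logGrad v z j - logGrad v y j) * (z j - y j) ≤ 0 := by
  have h1 := hv.log_sub_log_le hz hp hy hpy
  have h2 := hv.log_sub_log_le hy hpy hz hp
  have h3 : ∑ j, (logGrad v z j - logGrad v y j) * (z j - y j) =
      -(∑ j, logGrad v z j * (y j - z j)) - ∑ j, logGrad v y j * (z j - y j) := by
    rw [← Finset.sum_neg_distrib, ← Finset.sum_sub_distrib]
    exact Finset.sum_congr rfl fun j _ => by ring
  linarith

theorem fderivWithin_log {z : Fin m → ℝ} (hz : 0 ≤ z) (hp : 0 < v z) :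
    fderivWithin ℝ (fun z => Real.log (v z)) (Set.Ici 0) z =
      (v z)⁻¹ • fderivWithin ℝ v (Set.Ici 0) z := by
  exact ((hv.differentiableWithinAt hz hp).hasFDerivWithinAt.log hp.ne').fderivWithin
    (uniqueDiffOn_orthant z hz)

end IsCCH

/-! ### Second derivatives of the logarithm and cocoercivity. -/

namespace IsCCH

variable {m : ℕ} {v : (Fin m → ℝ) → ℝ} (hv : IsCCH v)

include hv

theorem fderivWithin_log_apply {z : Fin m → ℝ} (hz : 0 ≤ z) (hp : 0 < v z) (y : Fin m → ℝ) :
    fderivWithin ℝ (fun z => Real.log (v z)) (Set.Ici 0) z y = ∑ j, logGrad v z j * y j := by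
  rw [hv.fderivWithin_log hz hp, sum_logGrad_mul]
  simp [div_eq_inv_mul]

theorem contDiffOn_fderivWithin_log :
    ContDiffOn ℝ 1 (fderivWithin ℝ (fun z => Real.log (v z)) (Set.Ici 0))
      (Set.Ici 0 ∩ {z | 0 < v z}) := by
  obtain ⟨U, hU, h⟩ := hv.exists_isOpen
  have h1 : ContDiffOn ℝ 2 (fun z => Real.log (v z)) (Set.Ici 0 ∩ {z | 0 < v z}) :=
    hv.contDiffOn.log fun z hz => ne_of_gt hz.2
  rw [h] at h1 ⊢
  have h2 : ContDiffOn ℝ 1 (fderivWithin ℝ (fun z => Real.log (v z)) (Set.Ici 0 ∩ U))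
      (Set.Ici 0 ∩ U) :=
    h1.fderivWithin (uniqueDiffOn_orthant.inter hU) (by norm_num)
  exact h2.congr fun z hz => (fderivWithin_inter (hU.mem_nhds hz.2)).symm

theorem continuousOn_logGrad (j : Fin m) :
    ContinuousOn (fun z => logGrad v z j) (Set.Ici 0 ∩ {z | 0 < v z}) := by
  have h := hv.contDiffOn_fderivWithin_log.continuousOn.clm_apply
    (continuousOn_const (c := (Pi.single j 1 : Fin m → ℝ)))
  refine h.congr fun z hz => ?_
  simp only [hv.fderivWithin_log_apply hz.1 hz.2]
  simp [Pi.single_apply]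

theorem isCompact_superlevel (b : Fin m → ℝ) {δ : ℝ} :
    IsCompact {z : Fin m → ℝ | 0 ≤ z ∧ z ≤ b ∧ δ ≤ v z} := by
  have h1 : IsCompact (Set.Icc (0 : Fin m → ℝ) b) := isCompact_Icc
  have h2 := (hv.continuousOn.mono (fun z (hz : z ∈ Set.Icc 0 b) => hz.1)
    ).preimage_isClosed_of_isClosed isClosed_Icc (isClosed_Ici (a := δ))
  refine (h1.inter_right (t := {z : Fin m → ℝ | 0 ≤ z ∧ z ≤ b ∧ δ ≤ v z}) ?_).of_isClosed_subset
    ?_ (fun z hz => ⟨⟨hz.1, hz.2.1⟩, hz⟩)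
  all_goals
    convert h2 using 1
    ext z
    simp [Set.mem_Icc, and_assoc]

/-- The second derivative is symmetric at interior points, and negative semidefinite because the
gradient is antitone along lines. The bound `L` holds uniformly up to the boundary: the second
derivative within the domain is continuous on the compact set where v ≥ δ and 0 ≤ z ≤ b. -/
theorem exists_hessian {δ : ℝ} (hδ : 0 < δ) (b : Fin m → ℝ) :
    ∃ (H : (Fin m → ℝ) → (Fin m → ℝ) →L[ℝ] (Fin m → ℝ) →L[ℝ] ℝ) (L : ℝ), 0 < L ∧
      ∀ z : Fin m → ℝ, (∀ j, 0 < z j) →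
        HasFDerivAt (fderivWithin ℝ (fun z => Real.log (v z)) (Set.Ici 0)) (H z) z ∧
        (∀ x y, H z x y = H z y x) ∧ (∀ x, H z x x ≤ 0) ∧
        (z ≤ b → δ ≤ v z → ∀ x, -(H z x x) ≤ L * ∑ j, x j ^ 2) := by
  obtain ⟨U, hU, h⟩ := hv.exists_isOpen
  have hC := hv.contDiffOn_fderivWithin_log
  set P := fderivWithin ℝ (fun z => Real.log (v z)) (Set.Ici 0) with hP
  set S := Set.Ici 0 ∩ {z | 0 < v z} with hS
  have hu : UniqueDiffOn ℝ S := by rw [h]; exact uniqueDiffOn_orthant.inter hU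
  have hH : ContinuousOn (fderivWithin ℝ P S) S :=
    hC.continuousOn_fderivWithin hu (by norm_num)
  have hsub : {z : Fin m → ℝ | 0 ≤ z ∧ z ≤ b ∧ δ ≤ v z} ⊆ S :=
    fun z hz => ⟨hz.1, hδ.trans_le hz.2.2⟩
  obtain ⟨L, hL⟩ := (hv.isCompact_superlevel b (δ := δ)).exists_bound_of_continuousOn
    (E := (Fin m → ℝ) →L[ℝ] (Fin m → ℝ) →L[ℝ] ℝ) (hH.mono hsub)
  refine ⟨fderivWithin ℝ P S, max L 1, lt_max_of_lt_right one_pos, fun z hz => ?_⟩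
  have hz0 : 0 ≤ z := fun j => (hz j).le
  have hzS : z ∈ S := ⟨hz0, hv.pos_of_pos hz⟩
  have hnhds : S ∈ 𝓝 z := by
    rw [h] at hzS ⊢
    exact inter_mem (mem_of_superset (isOpen_setOf_forall_pos.mem_nhds hz)
      fun y hy j => (hy j).le) (hU.mem_nhds hzS.2)
  have hd : HasFDerivAt P (fderivWithin ℝ P S z) z :=
    ((hC.differentiableOn (by norm_num)) z hzS).hasFDerivWithinAt.hasFDerivAt hnhds
  refine ⟨hd, ?_, fun x => ?_, fun hb hδz x => ?_⟩
  · have h1 : ContDiffAt ℝ 2 (fun z => Real.log (v z)) z :=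
      (hv.contDiffOn.contDiffAt hnhds).log hzS.2.ne'
    have h2 := h1.isSymmSndFDerivAt (by simp)
    have h3 : fderivWithin ℝ P S z = fderiv ℝ (fderiv ℝ (fun z => Real.log (v z))) z := by
      rw [← hd.fderiv]
      refine EventuallyEq.fderiv_eq ?_
      filter_upwards [isOpen_setOf_forall_pos.mem_nhds hz] with y hy
      exact fderivWithin_of_mem_nhds (mem_of_superset (isOpen_setOf_forall_pos.mem_nhds hy)
        fun y hy j => (hy j).le)
    intro x y
    rw [h3]
    exact h2.eq x y
  · have h1 : HasDerivAt (fun s : ℝ => z + s • x) x 0 := by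
      have := ((hasDerivAt_id (0 : ℝ)).smul_const x).const_add z
      simpa using this
    have h2 : HasDerivAt (fun s : ℝ => P (z + s • x)) (fderivWithin ℝ P S z x) 0 := by
      have h0 : HasFDerivAt P (fderivWithin ℝ P S z) ((fun s : ℝ => z + s • x) 0) := by
        simpa using hd
      exact h0.comp_hasDerivAt (0 : ℝ) h1
    have h3 : HasDerivAt (fun s : ℝ => P (z + s • x) x) (fderivWithin ℝ P S z x x) 0 := by
      have := h2.clm_apply (hasDerivAt_const (0 : ℝ) x)
      simpa using this
    have h4 := hasDerivAt_iff_tendsto_slope.1 h3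
    have h5 : Tendsto (slope (fun s : ℝ => P (z + s • x) x) 0) (𝓝[>] 0)
        (𝓝 (fderivWithin ℝ P S z x x)) :=
      h4.mono_left (nhdsWithin_mono _ fun s (hs : 0 < s) => hs.ne')
    refine le_of_tendsto h5 ?_
    have h6 : ∀ᶠ s : ℝ in 𝓝 0, z + s • x ∈ S := by
      have : Tendsto (fun s : ℝ => z + s • x) (𝓝 0) (𝓝 z) := by
        simpa using h1.continuousAt.tendsto
      exact this hnhds
    filter_upwards [self_mem_nhdsWithin, nhdsWithin_le_nhds h6] with s hs hsS
    have hs' : (0 : ℝ) < s := hs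
    have h7 := hv.logGrad_antitone hsS.1 hsS.2 hz0 hzS.2
    simp only [slope_def_field, sub_zero, zero_smul, add_zero]
    refine div_nonpos_of_nonpos_of_nonneg ?_ hs'.le
    rw [hP, hv.fderivWithin_log_apply hsS.1 hsS.2, hv.fderivWithin_log_apply hz0 hzS.2,
      ← Finset.sum_sub_distrib]
    have h8 : ∑ j, (logGrad v (z + s • x) j - logGrad v z j) * ((z + s • x) j - z j) =
        s * ∑ j, (logGrad v (z + s • x) j * x j - logGrad v z j * x j) := by
      rw [Finset.mul_sum]
      refine Finset.sum_congr rfl fun j _ => ?_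
      simp only [Pi.add_apply, Pi.smul_apply, smul_eq_mul]
      ring
    rw [h8] at h7
    by_contra hcon
    exact absurd (mul_pos hs' (not_le.1 hcon)) (not_lt.2 h7)
  · have h1 := hL z ⟨hz0, hb, hδz⟩
    have h2 : ‖x‖ ^ 2 ≤ ∑ j, x j ^ 2 := by
      have h0 : 0 ≤ ∑ j, x j ^ 2 := Finset.sum_nonneg fun j _ => sq_nonneg _
      have : ‖x‖ ≤ √(∑ j, x j ^ 2) := by
        refine (pi_norm_le_iff_of_nonneg (Real.sqrt_nonneg _)).2 fun j => ?_
        refine Real.le_sqrt_of_sq_le ?_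
        rw [Real.norm_eq_abs, sq_abs]
        exact Finset.single_le_sum (f := fun j => x j ^ 2) (fun j _ => sq_nonneg _)
          (Finset.mem_univ j)
      calc ‖x‖ ^ 2 ≤ (√(∑ j, x j ^ 2)) ^ 2 := by gcongr
        _ = _ := Real.sq_sqrt h0
    calc -(fderivWithin ℝ P S z x x) ≤ ‖fderivWithin ℝ P S z x x‖ := neg_le_abs _
      _ ≤ ‖fderivWithin ℝ P S z‖ * ‖x‖ * ‖x‖ := ContinuousLinearMap.le_opNorm₂ _ _ _
      _ = ‖fderivWithin ℝ P S z‖ * ‖x‖ ^ 2 := by ring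
      _ ≤ max L 1 * ∑ j, x j ^ 2 := by
        gcongr
        exact h1.trans (le_max_left _ _)

theorem concave_superlevel {z y : Fin m → ℝ} (hz : 0 ≤ z) (hy : 0 ≤ y) {δ s : ℝ} (h1 : δ ≤ v z)
    (h2 : δ ≤ v y) (hs0 : 0 ≤ s) (hs1 : s ≤ 1) : δ ≤ v (z + s • (y - z)) := by
  have h3 : z + s • (y - z) = (1 - s) • z + s • y := by
    rw [smul_sub, sub_smul, one_smul]; abel
  have h4 := hv.add_le ((1 - s) • z) (smul_nonneg (by linarith) hz) (s • y) (smul_nonneg hs0 hy)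
  rw [h3]
  rw [hv.smul _ (by linarith) z hz, hv.smul _ hs0 y hy] at h4
  nlinarith

/-- The gradient of `-log v` is cocoercive on bounded superlevel sets of `v`. -/
theorem exists_cocoercive {δ : ℝ} (hδ : 0 < δ) :
    ∃ L : ℝ, 0 < L ∧ ∀ z y : Fin m → ℝ, 0 ≤ z → z ≤ 1 → δ ≤ v z → 0 ≤ y → y ≤ 1 → δ ≤ v y →
      ∑ j, (logGrad v z j - logGrad v y j) ^ 2 ≤
        L * -∑ j, (logGrad v z j - logGrad v y j) * (z j - y j) := by
  obtain ⟨H, L, hL, hH⟩ := hv.exists_hessian hδ 2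
  refine ⟨L, hL, ?_⟩
  have interior : ∀ z y : Fin m → ℝ, (∀ j, 0 < z j) → z ≤ 2 → δ ≤ v z → (∀ j, 0 < y j) → y ≤ 2 →
      δ ≤ v y → ∑ j, (logGrad v z j - logGrad v y j) ^ 2 ≤
        L * -∑ j, (logGrad v z j - logGrad v y j) * (z j - y j) := by
    intro z y hz hz2 hvz hy hy2 hvy
    have hz0 : 0 ≤ z := fun j => (hz j).le
    have hy0 : 0 ≤ y := fun j => (hy j).le
    set P := fderivWithin ℝ (fun z => Real.log (v z)) (Set.Ici 0) with hP
    set w : Fin m → ℝ := fun j => logGrad v z j - logGrad v y j with hw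
    set d := y - z with hd
    -- The Baillon–Haddad argument without a minimization. With H the Hessian of log v, the
    -- derivative of k is -H(Ld - w, Ld - w) + (L|w|² + H(w, w)), and both summands are nonnegative.
    -- Then k(0) ≤ k(1) reads L|w|² ≤ L² w·d.
    set k : ℝ → ℝ := fun s => L ^ 2 * -(P (z + s • d) d) + 2 * L * P (z + s • d) w +
      L * (∑ j, w j ^ 2) * s with hk
    have hseg : ∀ s : ℝ, 0 ≤ s → s ≤ 1 → (∀ j, 0 < (z + s • d) j) ∧ z + s • d ≤ 2 := by
      intro s hs0 hs1
      constructor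
      · intro j
        have : (z + s • d) j = (1 - s) * z j + s * y j := by
          simp [hd]; ring
        rw [this]
        rcases hs0.eq_or_lt with rfl | hs
        · simpa using hz j
        · have := mul_pos hs (hy j)
          have := mul_nonneg (sub_nonneg.2 hs1) (hz j).le
          linarith
      · intro j
        have h1 := hz2 j
        have h2 := hy2 j
        have : (z + s • d) j = (1 - s) * z j + s * y j := by
          simp [hd]; ring
        rw [this]
        nlinarith
    have hderiv : ∀ s : ℝ, 0 ≤ s → s ≤ 1 → HasDerivAt k (L ^ 2 * -(H (z + s • d) d d) +
        2 * L * H (z + s • d) d w + L * (∑ j, w j ^ 2)) s := by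
      intro s hs0 hs1
      have h1 : HasDerivAt (fun s : ℝ => z + s • d) d s := by
        have := ((hasDerivAt_id s).smul_const d).const_add z
        simpa using this
      have h2 := (hH _ (hseg s hs0 hs1).1).1.comp_hasDerivAt s h1
      have h3 : ∀ x, HasDerivAt (fun s : ℝ => P (z + s • d) x) (H (z + s • d) d x) s := by
        intro x
        have := h2.clm_apply (hasDerivAt_const s x)
        simpa using this
      have h4 := (((h3 d).neg.const_mul (L ^ 2)).add ((h3 w).const_mul (2 * L))).add
        ((hasDerivAt_id s).const_mul (L * (∑ j, w j ^ 2)))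
      exact h4.congr_deriv (by ring)
    have hmono : MonotoneOn k (Set.Icc 0 1) := by
      refine monotoneOn_of_deriv_nonneg (convex_Icc 0 1)
        (fun s hs => (hderiv s hs.1 hs.2).continuousAt.continuousWithinAt)
        (fun s hs => ?_) (fun s hs => ?_)
      · rw [interior_Icc] at hs
        exact (hderiv s hs.1.le hs.2.le).differentiableAt.differentiableWithinAt
      · rw [interior_Icc] at hs
        rw [(hderiv s hs.1.le hs.2.le).deriv]
        obtain ⟨h1, h2⟩ := hseg s hs.1.le hs.2.le
        obtain ⟨-, hsymm, hneg, hbd⟩ := hH _ h1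
        have h3 := hbd h2 (hv.concave_superlevel hz0 hy0 hvz hvy hs.1.le hs.2.le) w
        have h4 := hneg (L • d - w)
        simp only [map_sub, map_smul, sub_apply, smul_apply, smul_eq_mul] at h4
        rw [hsymm w d] at h4
        nlinarith
    have h01 := hmono (Set.left_mem_Icc.2 zero_le_one) (Set.right_mem_Icc.2 zero_le_one) zero_le_one
    have hzd : z + (1 : ℝ) • d = y := by simp [hd]
    have hPd : ∀ x, P z x - P y x = ∑ j, w j * x j := by
      intro x
      rw [hP, hv.fderivWithin_log_apply hz0 (hδ.trans_le hvz),
        hv.fderivWithin_log_apply hy0 (hδ.trans_le hvy), ← Finset.sum_sub_distrib]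
      exact Finset.sum_congr rfl fun j _ => by simp only [hw]; ring
    have h5 := hPd d
    have h6 := hPd w
    simp only [hk, hzd, zero_smul, add_zero, mul_zero, mul_one] at h01
    have h7 : ∑ j, w j * w j = ∑ j, w j ^ 2 := Finset.sum_congr rfl fun j _ => by ring
    have h8 : ∑ j, w j * (z j - y j) = -∑ j, w j * d j := by
      rw [← Finset.sum_neg_distrib]
      exact Finset.sum_congr rfl fun j _ => by simp only [hd, Pi.sub_apply]; ring
    rw [h8, neg_neg]
    rw [h7] at h6
    have h9 : L * ∑ j, w j ^ 2 ≤ L * (L * ∑ j, w j * d j) := by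
      rw [← h5, ← h6] at *
      nlinarith
    exact le_of_mul_le_mul_left h9 hL
  intro z y hz hz1 hvz hy hy1 hvy
  -- Boundary points are reached by adding τ to every coordinate and letting τ → 0. This raises v
  -- and, for τ < 1, stays in the box of side 2, which is why the Hessian was bounded on that larger
  -- box.
  have hpert : ∀ x : Fin m → ℝ, 0 ≤ x → x ≤ 1 → δ ≤ v x →
      (∀ τ : ℝ, 0 < τ → τ < 1 → (∀ j, 0 < (x + τ • (1 : Fin m → ℝ)) j) ∧
        x + τ • (1 : Fin m → ℝ) ≤ 2 ∧ δ ≤ v (x + τ • (1 : Fin m → ℝ))) ∧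
      ∀ j, Tendsto (fun τ : ℝ => logGrad v (x + τ • (1 : Fin m → ℝ)) j) (𝓝[>] 0)
        (𝓝 (logGrad v x j)) := by
    intro x hx hx1 hvx
    have h1 : ∀ τ : ℝ, 0 < τ → δ ≤ v (x + τ • (1 : Fin m → ℝ)) := fun τ hτ =>
      hvx.trans (hv.mono hx (le_add_of_nonneg_right (smul_nonneg hτ.le zero_le_one)))
    refine ⟨fun τ hτ hτ1 => ⟨fun j => ?_, fun j => ?_, h1 τ hτ⟩, fun j => ?_⟩
    · have := hx j
      simp only [Pi.zero_apply] at this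
      simp only [Pi.add_apply, Pi.smul_apply, Pi.one_apply, smul_eq_mul, mul_one]
      linarith
    · have := hx1 j
      simp only [Pi.one_apply] at this
      simp only [Pi.add_apply, Pi.smul_apply, smul_eq_mul, mul_one, Pi.ofNat_apply]
      linarith
    · have h2 := hv.continuousOn_logGrad j x ⟨hx, hδ.trans_le hvx⟩
      refine Tendsto.comp (g := fun z => logGrad v z j) h2
        (tendsto_nhdsWithin_iff.2 ⟨?_, ?_⟩)
      · have : Continuous fun τ : ℝ => x + τ • (1 : Fin m → ℝ) := by fun_prop
        have := this.tendsto 0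
        simp only [zero_smul, add_zero] at this
        exact this.mono_left nhdsWithin_le_nhds
      · filter_upwards [self_mem_nhdsWithin] with τ hτ
        exact ⟨add_nonneg hx (smul_nonneg (le_of_lt hτ) zero_le_one), hδ.trans_le (h1 τ hτ)⟩
  obtain ⟨hz3, hz4⟩ := hpert z hz hz1 hvz
  obtain ⟨hy3, hy4⟩ := hpert y hy hy1 hvy
  refine le_of_tendsto_of_tendsto
    (tendsto_finsetSum _ fun j _ => ((hz4 j).sub (hy4 j)).pow 2)
    ((tendsto_finsetSum _ fun j _ => ((hz4 j).sub (hy4 j)).mul_const (z j - y j)).neg.const_mul L)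
    ?_
  filter_upwards [self_mem_nhdsWithin, nhdsWithin_le_nhds (gt_mem_nhds one_pos)] with τ hτ hτ1
  have := interior _ _ (hz3 τ hτ hτ1).1 (hz3 τ hτ hτ1).2.1 (hz3 τ hτ hτ1).2.2
    (hy3 τ hτ hτ1).1 (hy3 τ hτ hτ1).2.1 (hy3 τ hτ hτ1).2.2
  simpa using this

end IsCCH

/-! ### The extragradient method for the gradient of a convex function. -/

/-- Discrete form of a' ≤ -κa². With M = 2/κ + a 0, the summand a 0 serves the first step. Since κM
≥ 2, exceeding M/(s+1) after being at most M/s would give 2s ≤ κMs < s + 1, impossible for s ≥ 1.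
The horizon `N` is finite because the differences it is used for are nonnegative only up to a fixed
index. -/
theorem le_div_of_sq_le_sub {a : ℕ → ℝ} {κ : ℝ} (hκ : 0 < κ) {N : ℕ} (h0 : ∀ t ≤ N, 0 ≤ a t)
    (h : ∀ t < N, κ * a (t + 1) ^ 2 ≤ a t - a (t + 1)) (t : ℕ) (ht : t < N) :
    a (t + 1) ≤ (2 / κ + a 0) / (t + 1) := by
  have ha0 := h0 0 (Nat.zero_le N)
  have hM : 0 < 2 / κ + a 0 := by positivity
  have hMκ : 2 ≤ κ * (2 / κ + a 0) := by
    have : κ * (2 / κ) = 2 := by field_simp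
    nlinarith [mul_nonneg hκ.le ha0]
  induction t with
  | zero =>
    have := h 0 ht
    have h1 : 0 ≤ κ * a (0 + 1) ^ 2 := by positivity
    have h2 : 0 < 2 / κ := by positivity
    simp only [Nat.cast_zero, zero_add, div_one] at *
    linarith
  | succ t ih =>
    have ih := ih (by omega)
    have h1 := h (t + 1) ht
    set M := 2 / κ + a 0
    by_contra hcon
    rw [not_le] at hcon
    push_cast at hcon
    have hs : (0 : ℝ) < (t : ℝ) + 1 := by positivity
    set s : ℝ := (t : ℝ) + 1
    have h2 : (M / (s + 1)) ^ 2 ≤ a (t + 1 + 1) ^ 2 := by gcongr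
    have h3 : κ * (M / (s + 1)) ^ 2 < M / s - M / (s + 1) := by
      have := mul_le_mul_of_nonneg_left h2 hκ.le
      linarith
    have h4 : M / s - M / (s + 1) = M / (s * (s + 1)) := by field_simp; ring
    have h5 : κ * (M / (s + 1)) ^ 2 = κ * M * M / (s + 1) ^ 2 := by
      rw [div_pow]; ring
    have hs1 : 1 ≤ s := by simp [s]
    rw [h4, h5, div_lt_div_iff₀ (by positivity) (by positivity)] at h3
    have h6 : 2 * M * (s * (s + 1)) ≤ κ * M * M * (s * (s + 1)) := by gcongr
    nlinarith [mul_pos hM (show 0 < s + 1 by linarith)]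

section Extragradient

variable {E : Type*} [NormedAddCommGroup E] [InnerProductSpace ℝ E]

local notation "⟪" a ", " b "⟫" => inner ℝ a b

/-- One step from `x` to `x'` of the extragradient method over `X` with step size `η`, with
extrapolation point `y` and operator values `g` at `x`, `h` at `y` and `g'` at `x'`; the operator is
`L`-Lipschitz and cocoercive along the step. -/
structure ExtragradientStep (X : Set E) (η L : ℝ) (x y x' g h g' : E) : Prop where
  eta_pos : 0 < η
  lip_pos : 0 < L
  eta_mul_le : η * L ≤ 1 / 4
  mem : x ∈ X
  mem_half : y ∈ X
  mem_next : x' ∈ X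
  proj_half : ∀ z ∈ X, ⟪x - η • g - y, z - y⟫ ≤ 0
  proj : ∀ z ∈ X, ⟪x - η • h - x', z - x'⟫ ≤ 0
  cocoercive : ‖g - g'‖ ^ 2 ≤ L * ⟪g - g', x - x'⟫
  lipschitz : ‖h - g'‖ ≤ L * ‖y - x'‖
  lipschitz_half : ‖g - h‖ ≤ L * ‖x - y‖

/-- A subgradient at `x'` of the objective plus the indicator of `X`, where `x'` is reached from `x`
with operator values `h` at the extrapolation point and `g'` at `x'`. -/
noncomputable def stepResidual (η : ℝ) (x x' h g' : E) : E :=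
  η⁻¹ • (x - x') - (h - g')

namespace ExtragradientStep

variable {X : Set E} {η L : ℝ} {x y x' g h g' : E}

variable (r : ExtragradientStep X η L x y x' g h g')

include r

theorem sub_eq :
    x - x' = η • (stepResidual η x x' h g' + (h - g')) := by
  rw [stepResidual, sub_add_cancel, smul_smul, mul_inv_cancel₀ r.eta_pos.ne', one_smul]

/-- The residual minus g' is (x - ηh - x')/η, which the projection inequality places in the normal
cone of X at x'. -/
theorem inner_normal_nonpos {z : E} (hz : z ∈ X) :
    ⟪stepResidual η x x' h g' - g', z - x'⟫ ≤ 0 := by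
  have h1 : x - η • h - x' = η • (stepResidual η x x' h g' - g') := by
    rw [sub_right_comm, r.sub_eq]
    simp only [smul_add, smul_sub]
    abel
  have h2 := r.proj z hz
  rw [h1, inner_smul_left] at h2
  exact nonpos_of_mul_nonpos_right h2 (by simpa using r.eta_pos)

/-- Nonexpansiveness of the projection: y and x' project points that differ by η(g - h). -/
theorem norm_half_sub_le : ‖y - x'‖ ≤ η * ‖g - h‖ := by
  have h1 := r.proj_half _ (r.mem_next)
  have h2 := r.proj _ (r.mem_half)
  have h3 : ‖y - x'‖ ^ 2 ≤ η * ⟪h - g, y - x'⟫ := by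
    rw [← real_inner_self_eq_norm_sq]
    simp only [inner_sub_left, inner_sub_right, inner_smul_left, RCLike.conj_to_real,
      real_inner_comm (y) (x')] at *
    nlinarith
  have h4 := real_inner_le_norm (h - g) (y - x')
  rw [norm_sub_rev (h)] at h4
  have h5 : ‖y - x'‖ ^ 2 ≤ (η * ‖g - h‖) * ‖y - x'‖ := by
    have := mul_le_mul_of_nonneg_left h4 r.eta_pos.le
    linarith
  rcases (norm_nonneg (y - x')).eq_or_lt with h6 | h6
  · rw [← h6]
    exact mul_nonneg r.eta_pos.le (norm_nonneg _)
  · rw [sq] at h5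
    exact le_of_mul_le_mul_right h5 h6

/-- The error satisfies ‖h - g'‖ ≤ ηL‖g - h‖ ≤ (1/4)(‖g - g'‖ + ‖h - g'‖); solve for it. -/
theorem norm_error_le : ‖h - g'‖ ≤ 1 / 3 * ‖g - g'‖ := by
  have h1 := r.lipschitz
  have h2 := mul_le_mul_of_nonneg_left (r.norm_half_sub_le) r.lip_pos.le
  have h3 : ‖g - h‖ ≤ ‖g - g'‖ + ‖h - g'‖ := by
    rw [norm_sub_rev (h)]
    exact norm_sub_le_norm_sub_add_norm_sub _ _ _
  have h4 := mul_le_mul_of_nonneg_right r.eta_mul_le (norm_nonneg (g - h))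
  nlinarith

theorem norm_sub_le : ‖g - g'‖ ≤ L * ‖x - x'‖ := by
  have h1 := r.cocoercive
  have h2 := mul_le_mul_of_nonneg_left (real_inner_le_norm (g - g') (x - x'))
    r.lip_pos.le
  rcases (norm_nonneg (g - g')).eq_or_lt with h6 | h6
  · rw [← h6]
    exact mul_nonneg r.lip_pos.le (norm_nonneg _)
  · refine le_of_mul_le_mul_left ?_ h6
    linarith

theorem norm_error_le_residual :
    ‖h - g'‖ ≤ 1 / 2 * ‖stepResidual η x x' h g'‖ := by
  have h1 := r.norm_error_le
  have h2 := r.norm_sub_le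
  rw [r.sub_eq, norm_smul, Real.norm_of_nonneg r.eta_pos.le] at h2
  have h3 := norm_add_le (stepResidual η x x' h g') (h - g')
  have h4 := mul_le_mul_of_nonneg_right r.eta_mul_le
    (norm_nonneg (stepResidual η x x' h g' + (h - g')))
  have h5 := norm_nonneg (stepResidual η x x' h g')
  nlinarith

theorem inner_le_norm_residual {D : ℝ} (hD : ∀ a ∈ X, ∀ b ∈ X, ‖a - b‖ ≤ D) {z : E}
    (hz : z ∈ X) : ⟪g', x' - z⟫ ≤ D * ‖stepResidual η x x' h g'‖ := by
  have h1 := r.inner_normal_nonpos hz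
  have h2 := real_inner_le_norm (stepResidual η x x' h g') (x' - z)
  have h3 := mul_le_mul_of_nonneg_left (hD _ (r.mem_next) z hz)
    (norm_nonneg (stepResidual η x x' h g'))
  rw [← neg_sub (x') z, inner_neg_right, inner_sub_left] at h1
  linarith

/-- With ξ the residual and e = h - g', convexity and the normal cone give f - f' ≥ ⟨ξ, x - x'⟩ =
η(‖ξ‖² + ⟨ξ, e⟩), and ‖e‖ ≤ ‖ξ‖/2. -/
theorem descent {f f' : ℝ} (hf : ⟪g', x - x'⟫ ≤ f - f') :
    η / 2 * ‖stepResidual η x x' h g'‖ ^ 2 ≤ f - f' := by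
  have h1 := r.inner_normal_nonpos (r.mem)
  have h2 := hf
  have h3 := r.norm_error_le_residual
  have h4 := abs_le.1 (abs_real_inner_le_norm (stepResidual η x x' h g') (h - g'))
  rw [inner_sub_left] at h1
  have h5 : ⟪stepResidual η x x' h g', x - x'⟫ =
      η * (‖stepResidual η x x' h g'‖ ^ 2 + ⟪stepResidual η x x' h g', h - g'⟫) := by
    conv_lhs => rw [r.sub_eq]
    rw [inner_smul_right, inner_add_right, real_inner_self_eq_norm_sq]
  have h6 : ‖stepResidual η x x' h g'‖ * ‖h - g'‖ ≤ 1 / 2 * ‖stepResidual η x x' h g'‖ ^ 2 := by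
    have := mul_le_mul_of_nonneg_left h3 (norm_nonneg (stepResidual η x x' h g'))
    linarith
  have h7 := mul_le_mul_of_nonneg_left
    (show 1 / 2 * ‖stepResidual η x x' h g'‖ ^ 2 ≤
      ‖stepResidual η x x' h g'‖ ^ 2 + ⟪stepResidual η x x' h g', h - g'⟫ by linarith) r.eta_pos.le
  linarith

/-- Korpelevich's estimate: in the expansion of ‖x - z‖², both projection inequalities and `hmon`
have the right sign, and ηL ≤ 1/4 lets ‖x - y‖² + ‖x' - y‖² absorb the remaining cross term. -/
theorem fejer {z : E} (hz : z ∈ X) (hmon : 0 ≤ ⟪h, y - z⟫) :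
    ‖x' - z‖ ≤ ‖x - z‖ := by
  have h1 := r.proj z hz
  have h2 := r.proj_half _ (r.mem_next)
  have h3 := r.lipschitz_half
  have h4 := real_inner_le_norm (g - h) (x' - y)
  have h5 : η * ⟪g - h, x' - y⟫ ≤ 1 / 4 * (‖x - y‖ * ‖x' - y‖) := by
    calc η * ⟪g - h, x' - y⟫
        ≤ η * ((L * ‖x - y‖) * ‖x' - y‖) := by
          refine mul_le_mul_of_nonneg_left (h4.trans ?_) r.eta_pos.le
          gcongr
      _ = η * L * (‖x - y‖ * ‖x' - y‖) := by ring
      _ ≤ _ := by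
          gcongr
          exact r.eta_mul_le
  have h6 := mul_nonneg r.eta_pos.le hmon
  refine le_of_sq_le_sq ?_ (norm_nonneg _)
  have h7 : ‖x - z‖ ^ 2 = ‖x' - z‖ ^ 2 + ‖x - y‖ ^ 2 + ‖x' - y‖ ^ 2
      - 2 * ⟪x - η • h - x', z - x'⟫
      - 2 * ⟪x - η • g - y, x' - y⟫
      - 2 * (η * ⟪g - h, x' - y⟫) + 2 * (η * ⟪h, y - z⟫) := by
    simp only [← real_inner_self_eq_norm_sq, inner_sub_left, inner_sub_right, inner_smul_left,
      RCLike.conj_to_real, real_inner_comm z (x), real_inner_comm (x') (x),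
      real_inner_comm (y) (x), real_inner_comm z (x'),
      real_inner_comm (y) (x')]
    ring
  nlinarith [sq_nonneg (‖x - y‖ - ‖x' - y‖), norm_nonneg (x - y)]

end ExtragradientStep

namespace ExtragradientRun

variable {X : Set E} {η L : ℝ} {x y g h : ℕ → E}
  (r : ∀ t, ExtragradientStep X η L (x t) (y t) (x (t + 1)) (g t) (h t) (g (t + 1)))

local notation "ρ[" η ", " x ", " g ", " h "] " t:max =>
  stepResidual η (x t) (x (t + 1)) (h t) (g (t + 1))

include r

/-- Monotonicity of the normal cone at consecutive iterates gives ⟨d, Δ⟩ ≤ ⟨ξ - ξ', Δ⟩ with Δ = η(ξ'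
+ e). Put I = ⟨ξ - ξ', ξ' + e⟩. Cocoercivity yields ‖d‖² ≤ I/4, hence ‖e‖² ≤ I/36, while
polarization gives ‖ξ‖² - ‖ξ'‖² ≥ 2I - ‖e‖² ≥ 0. -/
theorem norm_residual_succ_le (t : ℕ) :
    ‖ρ[η, x, g, h] (t + 1)‖ ≤ ‖ρ[η, x, g, h] t‖ := by
  have h1 := (r t).inner_normal_nonpos ((r (t + 1 + 1)).mem)
  have h2 := (r (t + 1)).inner_normal_nonpos ((r (t + 1)).mem)
  have h3 := (r (t + 1)).cocoercive
  have h4 := (r (t + 1)).norm_error_le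
  have h5 := (r (t + 1)).sub_eq
  set ξ := ρ[η, x, g, h] t
  set ξ' := ρ[η, x, g, h] (t + 1)
  set e := h (t + 1) - g (t + 1 + 1)
  set d := g (t + 1) - g (t + 1 + 1)
  have h6 : ⟪d, x (t + 1) - x (t + 1 + 1)⟫ ≤ ⟪ξ - ξ', x (t + 1) - x (t + 1 + 1)⟫ := by
    have h7 : ξ - ξ' = d + (ξ - g (t + 1)) - (ξ' - g (t + 1 + 1)) := by simp only [d]; abel
    have h8 : x (t + 1 + 1) - x (t + 1) = -(x (t + 1) - x (t + 1 + 1)) := by abel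
    rw [h8, inner_neg_right] at h1
    rw [h7, inner_sub_left (d + _), inner_add_left d]
    linarith
  have h9 : ‖d‖ ^ 2 ≤ L * (η * ⟪ξ - ξ', ξ' + e⟫) := by
    rw [h5, inner_smul_right, inner_smul_right] at h6
    rw [h5, inner_smul_right] at h3
    exact h3.trans (mul_le_mul_of_nonneg_left h6 (r 0).lip_pos.le)
  have h10 : 2 * ⟪ξ - ξ', ξ' + e⟫ = ‖ξ‖ ^ 2 - ‖ξ - ξ' - e‖ ^ 2 - ‖ξ'‖ ^ 2 + ‖e‖ ^ 2 := by
    simp only [← real_inner_self_eq_norm_sq, inner_sub_left, inner_sub_right, inner_add_right,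
      real_inner_comm ξ ξ', real_inner_comm e ξ', real_inner_comm e ξ]
    ring
  have h11 : 0 ≤ ⟪ξ - ξ', ξ' + e⟫ := by
    have : 0 ≤ (L * η) * ⟪ξ - ξ', ξ' + e⟫ := by
      rw [mul_assoc]; exact (sq_nonneg _).trans h9
    exact nonneg_of_mul_nonneg_right this (mul_pos (r 0).lip_pos (r 0).eta_pos)
  have h12 : ‖d‖ ^ 2 ≤ 1 / 4 * ⟪ξ - ξ', ξ' + e⟫ := by
    have := mul_le_mul_of_nonneg_right (r 0).eta_mul_le h11
    linarith
  have h13 : ‖e‖ ^ 2 ≤ (1 / 3 * ‖d‖) ^ 2 := by gcongr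
  refine le_of_sq_le_sq ?_ (norm_nonneg _)
  nlinarith [sq_nonneg ‖ξ - ξ' - e‖]

theorem norm_residual_antitone : Antitone fun t => ‖ρ[η, x, g, h] t‖ :=
  antitone_nat_of_succ_le (norm_residual_succ_le r)

/-- Values are compared with the later iterate of index 2k, so no minimizer is needed. Differences
of f are at most D times the residual, and the descent turns this into the quadratic recursion with
κ = η/(2D²); thus f_k - f_{2k} ≤ M/k. Since residuals decrease, k(η/2)‖ξ_{2k}‖² ≤ f_k - f_{2k}. -/
theorem exists_norm_residual_le {f : ℕ → ℝ} (hf : ∀ s t, ⟪g s, x t - x s⟫ ≤ f t - f s)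
    {D : ℝ} (hD0 : 0 < D) (hD : ∀ a ∈ X, ∀ b ∈ X, ‖a - b‖ ≤ D) :
    ∃ C : ℝ, ∀ k : ℕ, k * ‖ρ[η, x, g, h] (2 * k)‖ ≤ C := by
  have hη := (r 0).eta_pos
  have hdesc := fun t => (r t).descent (hf (t + 1) t)
  have hanti : Antitone f := antitone_nat_of_succ_le fun t => by
    have := hdesc t
    have h0 : 0 ≤ η / 2 * ‖ρ[η, x, g, h] t‖ ^ 2 := by positivity
    linarith
  set κ := η / 2 / D ^ 2 with hκ
  have hκ0 : 0 < κ := by positivity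
  set M := 2 / κ + D * ‖g 0‖ with hM
  have hM0 : 0 ≤ M := by positivity
  refine ⟨√(2 * M / η), fun k => ?_⟩
  rcases Nat.eq_zero_or_pos k with rfl | hk
  · simp
  refine Real.le_sqrt_of_sq_le ?_
  have h1 := le_div_of_sq_le_sub (a := fun t => f t - f (2 * k)) hκ0 (N := 2 * k)
    (fun t ht => sub_nonneg.2 (hanti ht)) (fun t ht => ?_) (k - 1) (by omega)
  · obtain ⟨k', rfl⟩ : ∃ k', k = k' + 1 := ⟨k - 1, by omega⟩
    simp only [Nat.add_sub_cancel] at h1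
    have h2 : f 0 - f (2 * (k' + 1)) ≤ D * ‖g 0‖ := by
      have h3 := hf 0 (2 * (k' + 1))
      have h4 := abs_le.1 (abs_real_inner_le_norm (g 0) (x (2 * (k' + 1)) - x 0))
      have h5 := mul_le_mul_of_nonneg_left (hD _ ((r (2 * (k' + 1))).mem) _ ((r 0).mem))
        (norm_nonneg (g 0))
      linarith
    have hk' : (0 : ℝ) < (k' : ℝ) + 1 := by positivity
    have h6 : f (k' + 1) - f (2 * (k' + 1)) ≤ M / (k' + 1) := by
      refine h1.trans (div_le_div_of_nonneg_right ?_ hk'.le)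
      linarith
    have h7 : ∀ l ≤ k' + 1, l * (η / 2 * ‖ρ[η, x, g, h] (2 * (k' + 1))‖ ^ 2) ≤
        f (k' + 1) - f (k' + 1 + l) := by
      intro l hl
      induction l with
      | zero => simp
      | succ l ih =>
        have ih := ih (by omega)
        have h8 := hdesc (k' + 1 + l)
        have h9 : ‖ρ[η, x, g, h] (2 * (k' + 1))‖ ≤ ‖ρ[η, x, g, h] (k' + 1 + l)‖ :=
          norm_residual_antitone r (by omega)
        have h10 : η / 2 * ‖ρ[η, x, g, h] (2 * (k' + 1))‖ ^ 2 ≤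
          η / 2 * ‖ρ[η, x, g, h] (k' + 1 + l)‖ ^ 2 := by gcongr
        push_cast
        rw [← add_assoc]
        linarith
    have h8 := h7 (k' + 1) le_rfl
    rw [← two_mul] at h8
    push_cast at h8 ⊢
    have h9 := h8.trans h6
    rw [le_div_iff₀ hk'] at h9
    rw [le_div_iff₀ hη, mul_pow]
    linarith
  · have h2 := hf (t + 1) (2 * k)
    have h3 := (r t).inner_le_norm_residual hD ((r (2 * k)).mem)
    have h4 : f (t + 1) - f (2 * k) ≤ D * ‖ρ[η, x, g, h] t‖ := by
      rw [← neg_sub (x (t + 1)), inner_neg_right] at h2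
      linarith
    have h5 : 0 ≤ f (t + 1) - f (2 * k) := sub_nonneg.2 (hanti (by omega))
    have h6 : (f (t + 1) - f (2 * k)) ^ 2 ≤ (D * ‖ρ[η, x, g, h] t‖) ^ 2 := by gcongr
    have h7 := hdesc t
    calc κ * (f (t + 1) - f (2 * k)) ^ 2 ≤ κ * (D * ‖ρ[η, x, g, h] t‖) ^ 2 := by gcongr
      _ = η / 2 * ‖ρ[η, x, g, h] t‖ ^ 2 := by rw [hκ]; field_simp
      _ ≤ _ := by linarith

/-- The last iterate of the extragradient method for the gradient of a convex function has gap
`O(1/T)`. -/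
theorem exists_gap_le {f : ℕ → ℝ} (hf : ∀ s t, ⟪g s, x t - x s⟫ ≤ f t - f s)
    {D : ℝ} (hD0 : 0 < D) (hD : ∀ a ∈ X, ∀ b ∈ X, ‖a - b‖ ≤ D) :
    ∃ C : ℝ, 0 ≤ C ∧ ∀ T : ℕ, 1 ≤ T → ∀ z ∈ X, ⟪g T, x T - z⟫ ≤ C / T := by
  obtain ⟨C, hC⟩ := exists_norm_residual_le r hf hD0 hD
  set R := ‖ρ[η, x, g, h] 0‖
  have hC0 : 0 ≤ C := by simpa using hC 0
  refine ⟨D * (4 * C + 2 * R), by positivity, fun T hT z hz => ?_⟩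
  obtain ⟨t, rfl⟩ : ∃ t, T = t + 1 := ⟨T - 1, by omega⟩
  refine ((r t).inner_le_norm_residual hD hz).trans ?_
  rw [mul_div_assoc]
  refine mul_le_mul_of_nonneg_left ?_ hD0.le
  have hT' : (0 : ℝ) < ((t + 1 : ℕ) : ℝ) := by positivity
  rw [le_div_iff₀ hT']
  have h1 : ‖ρ[η, x, g, h] t‖ ≤ ‖ρ[η, x, g, h] (2 * (t / 2))‖ :=
    norm_residual_antitone r (by omega)
  have h2 : ‖ρ[η, x, g, h] t‖ ≤ R := norm_residual_antitone r (Nat.zero_le t)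
  have h3 := hC (t / 2)
  -- The rate is known at even indices only. Rounding t down to 2⌊t/2⌋ costs the additive 2, which
  -- is paid by the initial residual `R`.
  have h4 : ((t + 1 : ℕ) : ℝ) ≤ 4 * ((t / 2 : ℕ) : ℝ) + 2 := by
    have : t + 1 ≤ 4 * (t / 2) + 2 := by omega
    exact_mod_cast this
  have h5 := mul_le_mul_of_nonneg_left h4 (norm_nonneg (ρ[η, x, g, h] t))
  have h6 := mul_le_mul_of_nonneg_left h1 (Nat.cast_nonneg (α := ℝ) (t / 2))
  linarith

end ExtragradientRun

end Extragradient

/-! ### Absence of influence, and equilibria from small gaps. -/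

namespace InfluenceFisherMarket

variable {n m : ℕ} (M : InfluenceFisherMarket n m)

/-- The utility of buyer `i` as a function of her own bundle. -/
def own (i : Fin n) (z : Fin m → ℝ) : ℝ := M.utility i (z, 0)

variable {M}

/-- A nonnegative utility that is jointly concave, and homogeneous in the own bundle, does not
depend on the bundles of the neighbours. -/
theorem Regular.utility_le (hM : M.Regular) (i : Fin n) {z : Fin m → ℝ} (hz : 0 ≤ z)
    {w w' : {k // k ∈ inNbrs M.graph i} → Fin m → ℝ} (hw : 0 ≤ w) (hw' : 0 ≤ w') :
    M.utility i (z, w') ≤ M.utility i (z, w) := by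
  -- The target is s (z/s, w') + (1 - s) (0, w/(1 - s)). Homogeneity cancels the weight s of the
  -- first point, and nonnegativity discards the second.
  have key : ∀ s : ℝ, 0 < s → s < 1 → M.utility i (z, w') ≤ M.utility i (z, w + s • w') := by
    intro s hs hs1
    have h1s : 0 < 1 - s := by linarith
    have h1 := (hM.jointly_concave i).2
      (show (s⁻¹ • z, w') ∈ Set.Ici 0 from ⟨smul_nonneg (inv_nonneg.2 hs.le) hz, hw'⟩)
      (show ((0 : Fin m → ℝ), (1 - s)⁻¹ • w) ∈ Set.Ici 0 from
        ⟨le_rfl, smul_nonneg (inv_nonneg.2 h1s.le) hw⟩) hs.le h1s.le (by ring)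
    rw [hM.homogeneous i s⁻¹ (inv_nonneg.2 hs.le) z hz w' hw'] at h1
    have h2 := hM.utility_nonneg i ((0 : Fin m → ℝ), (1 - s)⁻¹ • w)
      ⟨le_rfl, smul_nonneg (inv_nonneg.2 h1s.le) hw⟩
    have h3 : s • ((s⁻¹ • z, w') : (Fin m → ℝ) × ({k // k ∈ inNbrs M.graph i} → Fin m → ℝ)) +
        (1 - s) • ((0 : Fin m → ℝ), (1 - s)⁻¹ • w) = (z, w + s • w') := by
      simp [smul_smul, hs.ne', h1s.ne', add_comm]
    rw [h3] at h1
    simp only [smul_eq_mul] at h1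
    rw [← mul_assoc, mul_inv_cancel₀ hs.ne', one_mul] at h1
    have := mul_nonneg h1s.le h2
    linarith
  have hcont : Tendsto (fun s : ℝ => M.utility i (z, w + s • w')) (𝓝[>] 0)
      (𝓝 (M.utility i (z, w))) := by
    refine Tendsto.comp (g := M.utility i) (hM.continuous i (z, w) ⟨hz, hw⟩)
      (tendsto_nhdsWithin_iff.2 ⟨?_, ?_⟩)
    · have : Continuous fun s : ℝ => (z, w + s • w') := by fun_prop
      have := this.tendsto 0
      simp only [zero_smul, add_zero] at this
      exact this.mono_left nhdsWithin_le_nhds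
    · filter_upwards [self_mem_nhdsWithin] with s hs
      exact ⟨hz, add_nonneg hw (smul_nonneg (le_of_lt hs) hw')⟩
  refine ge_of_tendsto hcont ?_
  filter_upwards [self_mem_nhdsWithin, nhdsWithin_le_nhds (gt_mem_nhds one_pos)] with s hs hs1
  exact key s hs hs1

theorem Regular.util_eq (hM : M.Regular) (i : Fin n) {z : Fin m → ℝ} (hz : 0 ≤ z)
    {x : Alloc n m} (hx : ∀ i j, 0 ≤ x i j) : M.util i z x = M.own i z :=
  le_antisymm (hM.utility_le i hz le_rfl fun k => hx k.1)
    (hM.utility_le i hz (fun k => hx k.1) le_rfl)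

theorem Regular.isCCH (hM : M.Regular) (i : Fin n) : IsCCH (M.own i) where
  nonneg z hz := hM.utility_nonneg i (z, 0) ⟨hz, le_rfl⟩
  continuousOn := (hM.continuous i).comp (by fun_prop) fun z hz => ⟨hz, le_rfl⟩
  smul c hc z hz := hM.homogeneous i c hc z hz 0 le_rfl
  add_le z hz z' hz' := by
    -- Superadditivity is midpoint concavity at 2z and 2z', rescaled.
    have h1 := (hM.jointly_concave i).2
      (show ((2 : ℝ) • z, 0) ∈ Set.Ici 0 from ⟨smul_nonneg zero_le_two hz, le_rfl⟩)
      (show ((2 : ℝ) • z', 0) ∈ Set.Ici 0 from ⟨smul_nonneg zero_le_two hz', le_rfl⟩)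
      (show (0 : ℝ) ≤ 1 / 2 by norm_num) (show (0 : ℝ) ≤ 1 / 2 by norm_num) (by norm_num)
    rw [hM.homogeneous i 2 zero_le_two z hz 0 le_rfl,
      hM.homogeneous i 2 zero_le_two z' hz' 0 le_rfl] at h1
    have h3 : (1 / 2 : ℝ) • (((2 : ℝ) • z, 0) :
        (Fin m → ℝ) × ({k // k ∈ inNbrs M.graph i} → Fin m → ℝ)) +
        (1 / 2 : ℝ) • ((2 : ℝ) • z', 0) = (z + z', 0) := by
      simp [smul_smul]
    rw [h3] at h1
    simp only [smul_eq_mul] at h1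
    simp only [own]
    linarith
  exists_pos := by
    obtain ⟨z, hz, h⟩ := hM.no_saturation i 0 le_rfl 0 le_rfl
    exact ⟨z, hz, (hM.utility_nonneg i (0, 0) ⟨le_rfl, le_rfl⟩).trans_lt h⟩
  contDiffOn := (hM.contDiff i).comp (by fun_prop) fun z hz => ⟨⟨hz.1, le_rfl⟩, hz.2⟩

theorem Regular.mem_feasiblePos (hM : M.Regular) {x : Alloc n m} :
    x ∈ M.feasiblePos ↔ x ∈ feasible n m ∧ ∀ i, 0 < M.own i (x i) := by
  refine and_congr_right fun hx => forall_congr' fun i => ?_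
  rw [hM.util_eq i (hx.1 i) hx.1]

theorem Regular.viOp_apply (hM : M.Regular) {x : Alloc n m} (hx : ∀ i j, 0 ≤ x i j)
    (i : Fin n) (hp : 0 < M.own i (x i)) (j : Fin m) :
    M.viOp x i j = -(M.budget i * logGrad (M.own i) (x i) j) := by
  have h1 : fderivWithin ℝ (fun z => M.payoff i z x) (Set.Ici 0) (x i) =
      fderivWithin ℝ (fun z => M.budget i * Real.log (M.own i z)) (Set.Ici 0) (x i) :=
    fderivWithin_congr (fun z hz => by rw [payoff, hM.util_eq i hz hx])
      (by rw [payoff, hM.util_eq i (hx i) hx])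
  rw [viOp, h1, fderivWithin_const_mul (uniqueDiffOn_orthant _ (hx i))
      (((hM.isCCH i).differentiableWithinAt (hx i) hp).log hp.ne'), smul_apply,
    (hM.isCCH i).fderivWithin_log_apply (hx i) hp]
  simp [Pi.single_apply]

theorem dot_viOp (hM : M.Regular) {x : Alloc n m} (hx : ∀ i j, 0 ≤ x i j)
    (hp : ∀ i, 0 < M.own i (x i)) (z : Alloc n m) :
    dot (M.viOp x) z = -∑ i, M.budget i * ∑ j, logGrad (M.own i) (x i) j * z i j := by
  simp only [dot, hM.viOp_apply hx _ (hp _), Finset.mul_sum, ← Finset.sum_neg_distrib]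
  exact Finset.sum_congr rfl fun i _ => Finset.sum_congr rfl fun j _ => by ring

theorem dot_viOp_self (hM : M.Regular) {x : Alloc n m} (hx : ∀ i j, 0 ≤ x i j)
    (hp : ∀ i, 0 < M.own i (x i)) : dot (M.viOp x) x = -∑ i, M.budget i := by
  rw [dot_viOp hM hx hp]
  congr 1
  exact Finset.sum_congr rfl fun i _ => by
    rw [(hM.isCCH i).sum_logGrad_self (hx i) (hp i), mul_one]

theorem dot_sub_right (x y z : Alloc n m) : dot x (y - z) = dot x y - dot x z := by
  simp [dot, mul_sub]

theorem dot_sub_left (x y z : Alloc n m) : dot (x - y) z = dot x z - dot y z := by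
  simp [dot, sub_mul]

theorem viOp_monotone (hM : M.Regular) {x y : Alloc n m} (hx : x ∈ M.feasiblePos)
    (hy : y ∈ M.feasiblePos) : 0 ≤ dot (M.viOp x - M.viOp y) (x - y) := by
  rw [hM.mem_feasiblePos] at hx hy
  rw [dot_sub_left, dot_viOp hM hx.1.1 hx.2, dot_viOp hM hy.1.1 hy.2, neg_sub_neg,
    ← Finset.sum_sub_distrib]
  refine Finset.sum_nonneg fun i _ => ?_
  have h := (hM.isCCH i).logGrad_antitone (hx.1.1 i) (hx.2 i) (hy.1.1 i) (hy.2 i)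
  rw [← mul_sub, ← Finset.sum_sub_distrib]
  refine mul_nonneg (hM.budget_pos i).le ?_
  rw [← neg_nonneg, ← Finset.sum_neg_distrib] at h
  refine h.trans_eq (Finset.sum_congr rfl fun j _ => ?_)
  simp only [Pi.sub_apply]
  ring

theorem exists_mem_feasiblePos (hM : M.Regular) (hn : 0 < n) : ∃ x, x ∈ M.feasiblePos := by
  have hn' : (0 : ℝ) < n := by exact_mod_cast hn
  refine ⟨fun _ _ => (n : ℝ)⁻¹, hM.mem_feasiblePos.2 ⟨⟨fun _ _ => by positivity, fun j => ?_⟩,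
    fun i => (hM.isCCH i).pos_of_pos fun j => by positivity⟩⟩
  simp [hn'.ne']

theorem le_one_of_mem_feasible {x : Alloc n m} (hx : x ∈ feasible n m) (i : Fin n) : x i ≤ 1 :=
  fun j => (Finset.single_le_sum (f := fun i => x i j) (fun i _ => hx.1 i j)
    (Finset.mem_univ i)).trans (hx.2 j)

/-- A point of small gap in the variational inequality is an approximate equilibrium allocation:
the price of a good is the largest marginal payoff of a buyer, scaled to meet the budgets. -/
theorem isApproxCEAlloc_of_gap (hM : M.Regular) (hn : 0 < n) {x : Alloc n m}
    (hx : x ∈ M.feasiblePos) {γ : ℝ} (hγ : 0 ≤ γ)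
    (hgap : ∀ z ∈ feasible n m, dot (M.viOp x) (x - z) ≤ γ) :
    M.IsApproxCEAlloc ((1 + (∑ i, 1 / M.budget i) * ∑ i, M.own i 1) * γ) x := by
  obtain ⟨hxf, hp⟩ := hM.mem_feasiblePos.1 hx
  have hb := hM.budget_pos
  set q : Fin n → Fin m → ℝ := fun i j => M.budget i * logGrad (M.own i) (x i) j with hq
  have hq0 : ∀ i j, 0 ≤ q i j := fun i j =>
    mul_nonneg (hb i).le ((hM.isCCH i).logGrad_nonneg (hxf.1 i) (hp i) j)
  have : Nonempty (Fin n) := ⟨⟨0, hn⟩⟩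
  have hmax : ∀ j, ∃ k, ∀ i, q i j ≤ q k j := fun j => Finite.exists_max fun i => q i j
  choose σ hσ using hmax
  set p : Fin m → ℝ := fun j => q (σ j) j with hpdef
  set A := ∑ i, 1 / M.budget i with hA
  have hA0 : 0 ≤ A := Finset.sum_nonneg fun i _ => by have := hb i; positivity
  have hown1 : ∀ i, 0 ≤ M.own i 1 := fun i => (hM.isCCH i).nonneg 1 zero_le_one
  have hU0 : 0 ≤ ∑ i, M.own i 1 := Finset.sum_nonneg fun i _ => hown1 i
  have hsum : ∑ j, p j - ∑ i, M.budget i ≤ γ := by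
    -- Testing the gap on the allocation that gives each good to a buyer of largest marginal payoff
    -- bounds the total price by the total budget plus γ.
    set z : Alloc n m := fun i j => if i = σ j then 1 else 0 with hz
    have hzf : z ∈ feasible n m :=
      ⟨fun i j => by simp only [hz]; split_ifs <;> simp, fun j => by simp [hz]⟩
    have h1 := hgap z hzf
    rw [dot_sub_right, dot_viOp_self hM hxf.1 hp, dot_viOp hM hxf.1 hp] at h1
    have h2 : ∑ i, M.budget i * ∑ j, logGrad (M.own i) (x i) j * z i j = ∑ j, p j := by
      simp only [Finset.mul_sum]
      rw [Finset.sum_comm]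
      refine Finset.sum_congr rfl fun j _ => ?_
      simp [hz, hpdef, hq]
    rw [h2] at h1
    linarith
  -- By Euler's identity each buyer spends exactly her budget at her own marginal payoffs, hence at
  -- least that much at the maximal ones. With the bound on total price, nobody overspends by more
  -- than γ.
  have hcost : ∀ i, M.budget i ≤ cost p (x i) := by
    intro i
    have h1 := (hM.isCCH i).sum_logGrad_self (hxf.1 i) (hp i)
    calc M.budget i = M.budget i * ∑ j, logGrad (M.own i) (x i) j * x i j := by rw [h1, mul_one]
      _ = ∑ j, q i j * x i j := by
        rw [Finset.mul_sum]; exact Finset.sum_congr rfl fun j _ => by simp only [hq]; ring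
      _ ≤ cost p (x i) := Finset.sum_le_sum fun j _ =>
        mul_le_mul_of_nonneg_right (hσ j i) (hxf.1 i j)
  have hp0 : ∀ j, 0 ≤ p j := fun j => hq0 _ _
  have htotal : ∑ i, cost p (x i) = ∑ j, p j * ∑ i, x i j := by
    simp only [cost, Finset.mul_sum]
    exact Finset.sum_comm
  have hle : ∑ i, cost p (x i) ≤ ∑ j, p j := by
    rw [htotal]
    exact Finset.sum_le_sum fun j _ => mul_le_of_le_one_right (hp0 j) (hxf.2 j)
  have hexc : ∀ i, cost p (x i) ≤ M.budget i + γ := by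
    intro i
    have h1 : cost p (x i) - M.budget i ≤ ∑ i, (cost p (x i) - M.budget i) :=
      Finset.single_le_sum (f := fun i => cost p (x i) - M.budget i)
        (fun i _ => sub_nonneg.2 (hcost i)) (Finset.mem_univ i)
    rw [Finset.sum_sub_distrib] at h1
    linarith
  have hopt : ∀ i, ∀ z : Fin m → ℝ, 0 ≤ z →
      M.budget i * M.own i z ≤ cost p z * M.own i (x i) := by
    intro i z hz
    have h1 := (hM.isCCH i).div_le_sum_logGrad (hxf.1 i) (hp i) hz
    have h2 : M.budget i * ∑ j, logGrad (M.own i) (x i) j * z j ≤ cost p z := by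
      rw [Finset.mul_sum]
      refine Finset.sum_le_sum fun j _ => ?_
      rw [← mul_assoc]
      exact mul_le_mul_of_nonneg_right (hσ j i) (hz j)
    have h3 := (mul_le_mul_of_nonneg_left h1 (hb i).le).trans h2
    rw [← mul_div_assoc, div_le_iff₀ (hp i)] at h3
    exact h3
  -- As A ≥ 1/b_i, dividing prices by Q makes b_i + γ affordable for everyone, and raises attainable
  -- utility to at most Q times the current one.
  set Q := 1 + γ * A with hQ
  have hQ1 : 1 ≤ Q := by have := mul_nonneg hγ hA0; linarith
  have hQ0 : 0 < Q := by linarith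
  have hbQ : ∀ i, M.budget i + γ ≤ M.budget i * Q := by
    intro i
    have h1 : 1 / M.budget i ≤ A := Finset.single_le_sum (f := fun i => 1 / M.budget i)
      (fun i _ => by have := hb i; positivity) (Finset.mem_univ i)
    rw [div_le_iff₀ (hb i)] at h1
    have := mul_le_mul_of_nonneg_left h1 hγ
    rw [hQ]
    linarith
  have hscale : ∀ z, cost (fun j => p j / Q) z = cost p z / Q := by
    intro z
    simp only [cost, Finset.sum_div]
    exact Finset.sum_congr rfl fun j _ => by ring
  refine ⟨fun j => p j / Q, fun j => div_nonneg (hp0 j) hQ0.le, hxf, fun i => ?_,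
    fun i z hz hcz => ?_, ?_⟩
  · rw [hscale, div_le_iff₀ hQ0]
    exact (hexc i).trans (hbQ i)
  · rw [hscale, div_le_iff₀ hQ0] at hcz
    rw [hM.util_eq i hz hxf.1, hM.util_eq i (hxf.1 i) hxf.1]
    have h1 := hopt i z hz
    have h2 : M.budget i * M.own i z ≤ M.budget i * (Q * M.own i (x i)) := by
      rw [← mul_assoc]
      exact h1.trans (mul_le_mul_of_nonneg_right hcz (hp i).le)
    have h3 := le_of_mul_le_mul_left h2 (hb i)
    have h4 : M.own i (x i) ≤ ∑ i, M.own i 1 :=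
      ((hM.isCCH i).mono (hxf.1 i) (le_one_of_mem_feasible hxf i)).trans
        (Finset.single_le_sum (f := fun i => M.own i 1) (fun i _ => hown1 i) (Finset.mem_univ i))
    have h5 := mul_le_mul_of_nonneg_left h4 (mul_nonneg hγ hA0)
    rw [hQ] at h3
    nlinarith
  · have h1 : ∑ j, p j / Q * (∑ i, x i j - 1) = -((∑ j, p j - ∑ i, cost p (x i)) / Q) := by
      rw [htotal, ← Finset.sum_sub_distrib, Finset.sum_div, ← Finset.sum_neg_distrib]
      exact Finset.sum_congr rfl fun j _ => by ring
    have h2 : 0 ≤ ∑ j, p j - ∑ i, cost p (x i) := sub_nonneg.2 hle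
    have h3 : ∑ i, M.budget i ≤ ∑ i, cost p (x i) := Finset.sum_le_sum fun i _ => hcost i
    rw [h1, abs_neg, abs_of_nonneg (div_nonneg h2 hQ0.le), div_le_iff₀ hQ0]
    have h4 : γ ≤ (1 + A * ∑ i, M.own i 1) * γ := by
      nlinarith [mul_nonneg (mul_nonneg hA0 hU0) hγ]
    have h5 : (1 + A * ∑ i, M.own i 1) * γ ≤ (1 + A * ∑ i, M.own i 1) * γ * Q :=
      le_mul_of_one_le_right (hγ.trans h4) hQ1
    linarith

theorem isCEAlloc_of_isApproxCEAlloc_zero {x : Alloc n m} (h : M.IsApproxCEAlloc 0 x) :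
    M.IsCEAlloc x := by
  obtain ⟨p, hp⟩ := h
  exact ⟨p, hp.price_nonneg, hp.feasible, hp.affordable,
    fun i z hz hc => by simpa using hp.optimal i z hz hc,
    abs_eq_zero.1 (le_antisymm hp.walras (abs_nonneg _))⟩

end InfluenceFisherMarket

/-! ### Invariant superlevel sets and convergence of extragradient. -/

namespace InfluenceFisherMarket

variable {n m : ℕ} {M : InfluenceFisherMarket n m}

/-- Allocations as vectors of a Euclidean space. -/
noncomputable def toEuclidean : Alloc n m →ₗ[ℝ] EuclideanSpace ℝ (Fin n × Fin m) where
  toFun x := WithLp.toLp 2 fun q => x q.1 q.2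
  map_add' _ _ := rfl
  map_smul' _ _ := rfl

theorem toEuclidean_apply (x : Alloc n m) (q : Fin n × Fin m) :
    toEuclidean x q = x q.1 q.2 := rfl

theorem inner_toEuclidean (x y : Alloc n m) :
    inner ℝ (toEuclidean x) (toEuclidean y) = dot x y := by
  simp only [PiLp.inner_apply, dot, Fintype.sum_prod_type, toEuclidean_apply]
  exact Finset.sum_congr rfl fun i _ => Finset.sum_congr rfl fun j _ => by simp [mul_comm]

theorem norm_toEuclidean_sq (x : Alloc n m) : ‖toEuclidean x‖ ^ 2 = dot x x := by
  rw [← real_inner_self_eq_norm_sq, inner_toEuclidean]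

theorem continuous_toEuclidean :
    Continuous (toEuclidean : Alloc n m → EuclideanSpace ℝ (Fin n × Fin m)) :=
  LinearMap.continuous_of_finiteDimensional _

theorem abs_le_norm_toEuclidean (x : Alloc n m) (i : Fin n) (j : Fin m) :
    |x i j| ≤ ‖toEuclidean x‖ := by
  simpa [toEuclidean_apply] using PiLp.norm_apply_le (toEuclidean x) (i, j)

theorem dist_le_norm_toEuclidean (x y : Alloc n m) : dist x y ≤ ‖toEuclidean (x - y)‖ :=
  (dist_pi_le_iff (norm_nonneg _)).2 fun i => (dist_pi_le_iff (norm_nonneg _)).2 fun j => by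
    simpa [Real.dist_eq] using abs_le_norm_toEuclidean (x - y) i j

theorem convex_feasible : Convex ℝ (feasible n m) := by
  intro x hx y hy a b ha hb hab
  refine ⟨fun i j => add_nonneg (mul_nonneg ha (hx.1 i j)) (mul_nonneg hb (hy.1 i j)),
    fun j => ?_⟩
  simp only [Pi.add_apply, Pi.smul_apply, smul_eq_mul, Finset.sum_add_distrib, ← Finset.mul_sum]
  have h1 := mul_le_mul_of_nonneg_left (hx.2 j) ha
  have h2 := mul_le_mul_of_nonneg_left (hy.2 j) hb
  linarith

theorem isCompact_feasible : IsCompact (feasible n m) := by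
  have h : IsClosed (feasible n m) := by
    have h1 : feasible n m = (⋂ i, ⋂ j, {x : Alloc n m | 0 ≤ x i j}) ∩
        ⋂ j, {x : Alloc n m | ∑ i, x i j ≤ 1} := by
      ext x
      simp [feasible]
    rw [h1]
    refine IsClosed.inter (isClosed_iInter fun i => isClosed_iInter fun j => ?_)
      (isClosed_iInter fun j => ?_)
    · exact isClosed_le continuous_const (by fun_prop)
    · exact isClosed_le (by fun_prop) continuous_const
  exact (isCompact_Icc (a := (0 : Alloc n m)) (b := 1)).of_isClosed_subset h
    fun x hx => ⟨fun i j => hx.1 i j, fun i => le_one_of_mem_feasible hx i⟩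

theorem euclProj_spec (z : Alloc n m) : euclProj (feasible n m) z ∈ feasible n m ∧
    ∀ y ∈ feasible n m, inner ℝ (toEuclidean z - toEuclidean (euclProj (feasible n m) z))
      (toEuclidean y - toEuclidean (euclProj (feasible n m) z)) ≤ 0 := by
  have hne : (feasible n m).Nonempty := ⟨0, by simp [feasible]⟩
  have hcont : Continuous fun y : Alloc n m => dot (y - z) (y - z) := by
    unfold dot
    fun_prop
  obtain ⟨p₀, hp₀, hmin₀⟩ := isCompact_feasible.exists_isMinOn hne hcont.continuousOn
  have hspec : euclProj (feasible n m) z ∈ feasible n m ∧ ∀ y ∈ feasible n m,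
      dot (euclProj (feasible n m) z - z) (euclProj (feasible n m) z - z) ≤
        dot (y - z) (y - z) :=
    Classical.epsilon_spec (p := fun p => p ∈ feasible n m ∧
      ∀ y ∈ feasible n m, dot (p - z) (p - z) ≤ dot (y - z) (y - z))
      ⟨p₀, hp₀, fun y hy => hmin₀ hy⟩
  set p := euclProj (feasible n m) z
  refine ⟨hspec.1, fun y hy => ?_⟩
  -- Compare the minimizer with nearby points on the segment to y, divide by s, and let s → 0.
  have h1 : ∀ s : ℝ, 0 < s → s ≤ 1 →
      2 * inner ℝ (toEuclidean z - toEuclidean p) (toEuclidean y - toEuclidean p) ≤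
        s * ‖toEuclidean y - toEuclidean p‖ ^ 2 := by
    intro s hs hs1
    have h2 := hspec.2 (p + s • (y - p)) (convex_feasible.add_smul_sub_mem hspec.1 hy ⟨hs.le, hs1⟩)
    rw [← norm_toEuclidean_sq, ← norm_toEuclidean_sq] at h2
    have h3 : toEuclidean (p + s • (y - p) - z) =
        s • (toEuclidean y - toEuclidean p) - (toEuclidean z - toEuclidean p) := by
      simp only [map_sub, map_add, map_smul]
      abel
    have h4 : toEuclidean (p - z) = -(toEuclidean z - toEuclidean p) := by
      simp only [map_sub]
      abel
    rw [h3, h4, norm_neg, norm_sub_sq_real (s • _), norm_smul, inner_smul_left, mul_pow,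
      Real.norm_of_nonneg hs.le, RCLike.conj_to_real, real_inner_comm] at h2
    have h5 : s * (2 * inner ℝ (toEuclidean z - toEuclidean p) (toEuclidean y - toEuclidean p)) ≤
        s * (s * ‖toEuclidean y - toEuclidean p‖ ^ 2) := by linarith
    exact le_of_mul_le_mul_left h5 hs
  have h2 : Tendsto (fun s : ℝ => s * ‖toEuclidean y - toEuclidean p‖ ^ 2) (𝓝[>] 0) (𝓝 0) := by
    have : Continuous fun s : ℝ => s * ‖toEuclidean y - toEuclidean p‖ ^ 2 := by fun_prop
    have := this.tendsto 0
    rw [zero_mul] at this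
    exact this.mono_left nhdsWithin_le_nhds
  have h3 := ge_of_tendsto h2 (b := 2 * inner ℝ (toEuclidean z - toEuclidean p)
    (toEuclidean y - toEuclidean p)) (by
      filter_upwards [self_mem_nhdsWithin, nhdsWithin_le_nhds (gt_mem_nhds one_pos)] with s hs hs1
      exact h1 s hs (le_of_lt hs1))
  linarith

theorem norm_euclProj_sub_le {x : Alloc n m} (hx : x ∈ feasible n m) (g : Alloc n m) {η : ℝ}
    (hη : 0 ≤ η) :
    ‖toEuclidean (euclProj (feasible n m) (x - η • g) - x)‖ ≤ η * ‖toEuclidean g‖ := by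
  have h1 := (euclProj_spec (x - η • g)).2 x hx
  set p := euclProj (feasible n m) (x - η • g)
  rw [map_sub, norm_sub_rev]
  rw [map_sub, map_smul] at h1
  set d := toEuclidean x - toEuclidean p with hd
  have h2 : toEuclidean x - η • toEuclidean g - toEuclidean p = d - η • toEuclidean g := by
    rw [hd]; abel
  rw [h2, inner_sub_left, real_inner_self_eq_norm_sq, inner_smul_left, RCLike.conj_to_real] at h1
  have h3 := mul_le_mul_of_nonneg_left (real_inner_le_norm (toEuclidean g) d) hη
  rcases (norm_nonneg d).eq_or_lt with h | h
  · rw [← h]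
    positivity
  · refine le_of_mul_le_mul_right ?_ h
    linarith

variable (M) in
/-- The Eisenberg–Gale potential. -/
noncomputable def potential (x : Alloc n m) : ℝ := -∑ i, M.budget i * Real.log (M.own i (x i))

variable (M) in
/-- Feasible allocations at which every utility is at least `δ`. -/
def superlevel (δ : ℝ) : Set (Alloc n m) := {x | x ∈ feasible n m ∧ ∀ i, δ ≤ M.own i (x i)}

theorem continuousOn_own (hM : M.Regular) (i : Fin n) :
    ContinuousOn (fun x : Alloc n m => M.own i (x i)) (feasible n m) :=
  (hM.isCCH i).continuousOn.comp (by fun_prop) fun _ hx => hx.1 i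

theorem isCompact_superlevel (hM : M.Regular) (δ : ℝ) : IsCompact (M.superlevel δ) := by
  have h : M.superlevel δ = feasible n m ∩
      ⋂ i, (feasible n m ∩ (fun x : Alloc n m => M.own i (x i)) ⁻¹' Set.Ici δ) := by
    ext x
    simp only [superlevel, Set.mem_ofPred_eq, Set.mem_inter_iff, Set.mem_iInter, Set.mem_preimage,
      Set.mem_Ici]
    exact ⟨fun h => ⟨h.1, fun i => ⟨h.1, h.2 i⟩⟩, fun h => ⟨h.1, fun i => (h.2 i).2⟩⟩
  rw [h]
  exact isCompact_feasible.inter_right (isClosed_iInter fun i =>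
    (continuousOn_own hM i).preimage_isClosed_of_isClosed isCompact_feasible.isClosed isClosed_Ici)

theorem continuousOn_viOp (hM : M.Regular) {δ : ℝ} (hδ : 0 < δ) :
    ContinuousOn M.viOp (M.superlevel δ) := by
  refine continuousOn_pi.2 fun i => continuousOn_pi.2 fun j => ?_
  have h : ContinuousOn (fun x : Alloc n m => -(M.budget i * logGrad (M.own i) (x i) j))
      (M.superlevel δ) :=
    ((((hM.isCCH i).continuousOn_logGrad j).comp (by fun_prop)
      fun x hx => ⟨hx.1.1 i, hδ.trans_le (hx.2 i)⟩).const_mul _).neg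
  exact h.congr fun x hx => hM.viOp_apply hx.1.1 i (hδ.trans_le (hx.2 i)) j

theorem dot_viOp_le_potential_sub (hM : M.Regular) {x y : Alloc n m} (hx : x ∈ M.feasiblePos)
    (hy : y ∈ M.feasiblePos) :
    dot (M.viOp x) (y - x) ≤ M.potential y - M.potential x := by
  rw [hM.mem_feasiblePos] at hx hy
  rw [dot_viOp hM hx.1.1 hx.2, potential, potential, neg_sub_neg, ← Finset.sum_sub_distrib,
    ← Finset.sum_neg_distrib]
  refine Finset.sum_le_sum fun i _ => ?_
  have h := (hM.isCCH i).log_sub_log_le (hx.1.1 i) (hx.2 i) (hy.1.1 i) (hy.2 i)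
  have := mul_le_mul_of_nonneg_left h (hM.budget_pos i).le
  simp only [Pi.sub_apply]
  linarith

theorem superlevel_subset_feasiblePos (hM : M.Regular) {δ : ℝ} (hδ : 0 < δ) :
    M.superlevel δ ⊆ M.feasiblePos := fun _ hx =>
  hM.mem_feasiblePos.2 ⟨hx.1, fun i => hδ.trans_le (hx.2 i)⟩

/-- Every b_k log u_k is bounded above on feasible allocations, because u_k is at most its value at
one unit of each good. A bound on the potential therefore keeps each single logarithm bounded below.
-/
theorem exists_superlevel_of_potential_le (hM : M.Regular) (a : ℝ) :
    ∃ δ : ℝ, 0 < δ ∧ ∀ x ∈ M.feasiblePos, M.potential x ≤ a → x ∈ M.superlevel δ := by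
  set B := ∑ k, M.budget k * |Real.log (M.own k 1)| with hB
  have hB0 : ∀ k, 0 ≤ M.budget k * |Real.log (M.own k 1)| := fun k =>
    mul_nonneg (hM.budget_pos k).le (abs_nonneg _)
  obtain ⟨c, hc⟩ := (Set.finite_range fun i => (a + B) / M.budget i).bddAbove
  refine ⟨Real.exp (-c), Real.exp_pos _, fun x hx hxa => ⟨hx.1, fun i => ?_⟩⟩
  obtain ⟨hxf, hxp⟩ := hM.mem_feasiblePos.1 hx
  have hb := hM.budget_pos i
  have h1 : ∀ k, M.budget k * Real.log (M.own k (x k)) ≤ M.budget k * |Real.log (M.own k 1)| :=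
    fun k => mul_le_mul_of_nonneg_left ((Real.log_le_log (hxp k)
      ((hM.isCCH k).mono (hxf.1 k) (le_one_of_mem_feasible hxf k))).trans (le_abs_self _))
      (hM.budget_pos k).le
  have h2 : ∑ k ∈ Finset.univ.erase i, M.budget k * Real.log (M.own k (x k)) ≤ B :=
    (Finset.sum_le_sum fun k _ => h1 k).trans
      (Finset.sum_le_sum_of_subset_of_nonneg (Finset.erase_subset _ _) fun k _ _ => hB0 k)
  have h3 := Finset.add_sum_erase Finset.univ
    (fun k => M.budget k * Real.log (M.own k (x k))) (Finset.mem_univ i)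
  rw [potential] at hxa
  have h4 : -(M.budget i * Real.log (M.own i (x i))) ≤ a + B := by
    linarith
  have h5 : -Real.log (M.own i (x i)) ≤ (a + B) / M.budget i := by
    rw [le_div_iff₀ hb]
    linarith
  have h6 := h5.trans (hc ⟨i, rfl⟩)
  rw [← Real.le_log_iff_exp_le (hxp i)]
  linarith

theorem exists_viOp_cocoercive (hM : M.Regular) {δ : ℝ} (hδ : 0 < δ) :
    ∃ L : ℝ, 0 < L ∧ ∀ x ∈ M.superlevel δ, ∀ y ∈ M.superlevel δ,
      ‖toEuclidean (M.viOp x) - toEuclidean (M.viOp y)‖ ^ 2 ≤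
        L * inner ℝ (toEuclidean (M.viOp x) - toEuclidean (M.viOp y))
          (toEuclidean x - toEuclidean y) := by
  choose L hL0 hL using fun i => (hM.isCCH i).exists_cocoercive hδ
  obtain ⟨c, hc⟩ := (Set.finite_range fun i => M.budget i * L i).bddAbove
  refine ⟨max c 1, lt_max_of_lt_right one_pos, fun x hx y hy => ?_⟩
  rw [← map_sub, ← map_sub, norm_toEuclidean_sq, inner_toEuclidean, dot, dot, Finset.mul_sum]
  refine Finset.sum_le_sum fun i _ => ?_
  have hb := hM.budget_pos i
  have h1 := hL i (x i) (y i) (hx.1.1 i) (le_one_of_mem_feasible hx.1 i) (hx.2 i)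
    (hy.1.1 i) (le_one_of_mem_feasible hy.1 i) (hy.2 i)
  have h0 := (hM.isCCH i).logGrad_antitone (hx.1.1 i) (hδ.trans_le (hx.2 i)) (hy.1.1 i)
    (hδ.trans_le (hy.2 i))
  have hd : ∀ j, (M.viOp x - M.viOp y) i j =
      -M.budget i * (logGrad (M.own i) (x i) j - logGrad (M.own i) (y i) j) := by
    intro j
    rw [Pi.sub_apply, Pi.sub_apply, hM.viOp_apply hx.1.1 i (hδ.trans_le (hx.2 i)),
      hM.viOp_apply hy.1.1 i (hδ.trans_le (hy.2 i))]
    ring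
  set S := ∑ j, (logGrad (M.own i) (x i) j - logGrad (M.own i) (y i) j) * (x i j - y i j)
  have e1 : ∑ j, (M.viOp x - M.viOp y) i j * (M.viOp x - M.viOp y) i j =
      M.budget i ^ 2 * ∑ j, (logGrad (M.own i) (x i) j - logGrad (M.own i) (y i) j) ^ 2 := by
    rw [Finset.mul_sum]
    exact Finset.sum_congr rfl fun j _ => by rw [hd]; ring
  have e2 : ∑ j, (M.viOp x - M.viOp y) i j * (x - y) i j = M.budget i * -S := by
    rw [← Finset.sum_neg_distrib, Finset.mul_sum]
    exact Finset.sum_congr rfl fun j _ => by rw [hd]; simp only [Pi.sub_apply]; ring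
  rw [e1, e2]
  have hS : 0 ≤ M.budget i * -S := mul_nonneg hb.le (by linarith)
  calc _ ≤ M.budget i ^ 2 * (L i * -S) := by gcongr
    _ = M.budget i * L i * (M.budget i * -S) := by ring
    _ ≤ _ := mul_le_mul_of_nonneg_right ((hc ⟨i, rfl⟩).trans (le_max_left _ _)) hS

theorem exists_uniform_own (hM : M.Regular) {δ : ℝ} (hδ : 0 < δ) :
    ∃ ρ : ℝ, 0 < ρ ∧ ∀ x ∈ M.superlevel (2 * δ), ∀ y ∈ feasible n m,
      ‖toEuclidean (y - x)‖ ≤ ρ → y ∈ M.superlevel δ := by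
  have h : ∀ i, ∃ ρ : ℝ, 0 < ρ ∧ ∀ x ∈ feasible n m, ∀ y ∈ feasible n m, dist x y < ρ →
      dist (M.own i (x i)) (M.own i (y i)) < δ := fun i =>
    Metric.uniformContinuousOn_iff.1
      (isCompact_feasible.uniformContinuousOn_of_continuous (continuousOn_own hM i)) δ hδ
  choose ρ hρ0 hρ using h
  obtain ⟨r, hr0, hr⟩ : ∃ r : ℝ, 0 < r ∧ ∀ i, r < ρ i := by
    obtain ⟨c, hc⟩ := (Set.finite_range fun i => (ρ i)⁻¹).bddAbove
    refine ⟨(max c 0 + 1)⁻¹, by positivity, fun i => ?_⟩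
    have h1 : (ρ i)⁻¹ ≤ c := hc ⟨i, rfl⟩
    have h2 := le_max_left c 0
    exact inv_lt_of_inv_lt₀ (hρ0 i) (by linarith)
  refine ⟨r, hr0, fun x hx y hy hxy => ⟨hy, fun i => ?_⟩⟩
  have h1 := hρ i x hx.1 y hy (by
    rw [dist_comm]
    exact ((dist_le_norm_toEuclidean y x).trans hxy).trans_lt (hr i))
  rw [Real.dist_eq] at h1
  have := (abs_lt.1 h1).2
  have := hx.2 i
  linarith

theorem exists_norm_viOp_le (hM : M.Regular) {δ : ℝ} (hδ : 0 < δ) :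
    ∃ G : ℝ, 0 < G ∧ ∀ x ∈ M.superlevel δ, ‖toEuclidean (M.viOp x)‖ ≤ G := by
  obtain ⟨G, hG⟩ := (isCompact_superlevel hM δ).exists_bound_of_continuousOn
    (continuous_toEuclidean.comp_continuousOn (continuousOn_viOp hM hδ))
  exact ⟨max G 1, lt_max_of_lt_right one_pos, fun x hx => (hG x hx).trans (le_max_left _ _)⟩

theorem norm_le_of_cocoercive {E : Type*} [NormedAddCommGroup E] [InnerProductSpace ℝ E] {L : ℝ}
    (hL : 0 ≤ L) {w d : E} (h : ‖w‖ ^ 2 ≤ L * inner ℝ w d) : ‖w‖ ≤ L * ‖d‖ := by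
  have h2 := mul_le_mul_of_nonneg_left (real_inner_le_norm w d) hL
  rcases (norm_nonneg w).eq_or_lt with h6 | h6
  · rw [← h6]
    exact mul_nonneg hL (norm_nonneg _)
  · refine le_of_mul_le_mul_left ?_ h6
    linarith

/-- For small step sizes the extragradient iterates stay in a set on which the operator is
cocoercive. -/
theorem exists_extragradientStep (hM : M.Regular) {x₀ : Alloc n m} (hx₀ : x₀ ∈ M.feasiblePos) :
    ∃ δ η₀ L : ℝ, 0 < δ ∧ 0 < η₀ ∧ ∀ η : ℝ, 0 < η → η ≤ η₀ → ∀ t,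
      M.egIter η x₀ t ∈ M.superlevel δ ∧ M.egHalf η (M.egIter η x₀ t) ∈ M.superlevel δ ∧
      ExtragradientStep (toEuclidean '' feasible n m) η L (toEuclidean (M.egIter η x₀ t))
        (toEuclidean (M.egHalf η (M.egIter η x₀ t))) (toEuclidean (M.egIter η x₀ (t + 1)))
        (toEuclidean (M.viOp (M.egIter η x₀ t)))
        (toEuclidean (M.viOp (M.egHalf η (M.egIter η x₀ t))))
        (toEuclidean (M.viOp (M.egIter η x₀ (t + 1)))) := by
  obtain ⟨δ', hδ', hδ⟩ := exists_superlevel_of_potential_le hM (M.potential x₀)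
  obtain ⟨δ, rfl⟩ : ∃ δ, δ' = 2 * δ := ⟨δ' / 2, by ring⟩
  have hδ0 : 0 < δ := by linarith
  obtain ⟨L, hL0, hL⟩ := exists_viOp_cocoercive hM hδ0
  obtain ⟨ρ, hρ0, hρ⟩ := exists_uniform_own hM hδ0
  obtain ⟨G, hG0, hG⟩ := exists_norm_viOp_le hM hδ0
  -- The first bound keeps both projections within ρ of the current point; the second is the
  -- condition ηL ≤ 1/4.
  refine ⟨δ, min (ρ / G) (1 / (4 * L)), L, hδ0, by positivity, fun η hη hηle => ?_⟩
  have hηG : η * G ≤ ρ := (le_div_iff₀ hG0).1 (hηle.trans (min_le_left _ _))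
  have hηL : η * L ≤ 1 / 4 := by
    have := hηle.trans (min_le_right _ _)
    rw [le_div_iff₀ (by positivity)] at this
    linarith
  have hsub : M.superlevel (2 * δ) ⊆ M.superlevel δ := fun x hx =>
    ⟨hx.1, fun i => by have := hx.2 i; linarith⟩
  have hpos := superlevel_subset_feasiblePos hM hδ0
  have hstep : ∀ x ∈ M.superlevel (2 * δ), ∀ x',
      x' = euclProj (feasible n m) (x - η • M.viOp (M.egHalf η x)) →
      M.egHalf η x ∈ M.superlevel δ ∧ x' ∈ M.superlevel δ ∧
      ExtragradientStep (toEuclidean '' feasible n m) η L (toEuclidean x)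
        (toEuclidean (M.egHalf η x)) (toEuclidean x') (toEuclidean (M.viOp x))
        (toEuclidean (M.viOp (M.egHalf η x))) (toEuclidean (M.viOp x')) := by
    intro x hx x' hx'
    have hnear : ∀ g, ‖toEuclidean g‖ ≤ G →
        euclProj (feasible n m) (x - η • g) ∈ M.superlevel δ := fun g hg =>
      hρ x hx _ (euclProj_spec _).1 ((norm_euclProj_sub_le hx.1 g hη.le).trans
        ((mul_le_mul_of_nonneg_left hg hη.le).trans hηG))
    have hy : M.egHalf η x ∈ M.superlevel δ := hnear _ (hG x (hsub hx))
    have hx'' : x' ∈ M.superlevel δ := hx' ▸ hnear _ (hG _ hy)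
    have hlip : ∀ a ∈ M.superlevel δ, ∀ b ∈ M.superlevel δ,
        ‖toEuclidean (M.viOp a) - toEuclidean (M.viOp b)‖ ≤
          L * ‖toEuclidean a - toEuclidean b‖ := fun a ha b hb =>
      norm_le_of_cocoercive hL0.le (hL a ha b hb)
    refine ⟨hy, hx'', ⟨hη, hL0, hηL, ⟨x, hx.1, rfl⟩, ⟨_, hy.1, rfl⟩, ⟨_, hx''.1, rfl⟩, ?_, ?_,
      hL _ (hsub hx) _ hx'', hlip _ hy _ hx'', hlip _ (hsub hx) _ hy⟩⟩
    · rintro _ ⟨z, hz, rfl⟩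
      have := (euclProj_spec (x - η • M.viOp x)).2 z hz
      rwa [map_sub, map_smul] at this
    · rintro _ ⟨z, hz, rfl⟩
      have := (euclProj_spec (x - η • M.viOp (M.egHalf η x))).2 z hz
      rwa [map_sub, map_smul, ← hx'] at this
  -- A step from level 2δ lands a priori only in level δ. The constants are valid there, so the
  -- potential decreases, and its initial value as a bound returns the iterate to level 2δ.
  have hinv : ∀ t, M.egIter η x₀ t ∈ M.superlevel (2 * δ) ∧
      M.potential (M.egIter η x₀ t) ≤ M.potential x₀ := by
    intro t
    induction t with
    | zero => exact ⟨hδ x₀ hx₀ le_rfl, le_rfl⟩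
    | succ t ih =>
      obtain ⟨h1, h2, h3⟩ := hstep _ ih.1 (M.egIter η x₀ (t + 1)) rfl
      have h4 := h3.descent (f := M.potential (M.egIter η x₀ t))
        (f' := M.potential (M.egIter η x₀ (t + 1))) (by
          rw [← map_sub, inner_toEuclidean]
          exact dot_viOp_le_potential_sub hM (hpos h2) (hpos (hsub ih.1)))
      have h5 : M.potential (M.egIter η x₀ (t + 1)) ≤ M.potential (M.egIter η x₀ t) := by
        have h6 : 0 ≤ η / 2 * ‖stepResidual η (toEuclidean (M.egIter η x₀ t))
          (toEuclidean (M.egIter η x₀ (t + 1)))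
          (toEuclidean (M.viOp (M.egHalf η (M.egIter η x₀ t))))
          (toEuclidean (M.viOp (M.egIter η x₀ (t + 1))))‖ ^ 2 := by positivity
        linarith
      exact ⟨hδ _ (hpos h2) (h5.trans ih.2), h5.trans ih.2⟩
  intro t
  obtain ⟨h1, -, h3⟩ := hstep _ (hinv t).1 (M.egIter η x₀ (t + 1)) rfl
  exact ⟨hsub (hinv t).1, h1, h3⟩

/-- A sequence whose gap tends to zero accumulates at a solution of the variational inequality. -/
theorem exists_subseq_tendsto_of_gap (hM : M.Regular) {δ : ℝ} (hδ : 0 < δ) {x : ℕ → Alloc n m}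
    (hx : ∀ t, x t ∈ M.superlevel δ) {C : ℝ}
    (hgap : ∀ T : ℕ, 1 ≤ T → ∀ y ∈ feasible n m, dot (M.viOp (x T)) (x T - y) ≤ C / T) :
    ∃ xs ∈ M.superlevel δ, (∀ z ∈ feasible n m, dot (M.viOp xs) (xs - z) ≤ 0) ∧
      ∃ φ : ℕ → ℕ, StrictMono φ ∧ Tendsto (fun k => x (φ k)) atTop (𝓝 xs) := by
  obtain ⟨xs, hxs, φ, hφ, hlim⟩ := (isCompact_superlevel hM δ).tendsto_subseq hx
  refine ⟨xs, hxs, fun z hz => ?_, φ, hφ, hlim⟩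
  have hF : Tendsto (fun k => M.viOp (x (φ k))) atTop (𝓝 (M.viOp xs)) :=
    Tendsto.comp (g := M.viOp) (continuousOn_viOp hM hδ xs hxs)
      (tendsto_nhdsWithin_iff.2 ⟨hlim, Eventually.of_forall fun k => hx (φ k)⟩)
  have hcoord : ∀ {u : ℕ → Alloc n m} {a : Alloc n m}, Tendsto u atTop (𝓝 a) → ∀ i j,
      Tendsto (fun k => u k i j) atTop (𝓝 (a i j)) := fun h i j =>
    tendsto_pi_nhds.1 (tendsto_pi_nhds.1 h i) j
  have h1 : Tendsto (fun k => dot (M.viOp (x (φ k))) (x (φ k) - z)) atTop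
      (𝓝 (dot (M.viOp xs) (xs - z))) :=
    tendsto_finsetSum _ fun i _ => tendsto_finsetSum _ fun j _ =>
      (hcoord hF i j).mul ((hcoord hlim i j).sub_const (z i j))
  have h2 : Tendsto (fun k => C / (φ k : ℕ)) atTop (𝓝 0) :=
    (tendsto_const_div_atTop_nhds_zero_nat C).comp hφ.tendsto_atTop
  refine le_of_tendsto_of_tendsto h1 h2 ?_
  filter_upwards [hφ.tendsto_atTop.eventually_ge_atTop 1] with k hk
  exact hgap _ hk z hz

/-- Convergence and last-iterate rate of the extragradient method. -/
theorem extragradient_convergence (hM : M.Regular) (hn : 0 < n) {x₀ : Alloc n m}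
    (hx₀ : x₀ ∈ M.feasiblePos) : ∃ η₀ : ℝ, 0 < η₀ ∧ ∀ η : ℝ, 0 < η → η ≤ η₀ →
      (∀ T : ℕ, M.egIter η x₀ T ∈ M.feasiblePos ∧
        M.egHalf η (M.egIter η x₀ T) ∈ M.feasiblePos) ∧
      (∃ x, M.IsCEAlloc x ∧ Tendsto (fun T => M.egIter η x₀ T) atTop (𝓝 x)) ∧
      ∃ C : ℝ, ∀ T : ℕ, 1 ≤ T →
        (∀ y ∈ feasible n m,
          dot (M.viOp (M.egIter η x₀ T)) (M.egIter η x₀ T - y) ≤ C / T) ∧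
        M.IsApproxCEAlloc (C / T) (M.egIter η x₀ T) := by
  obtain ⟨δ, η₀, L, hδ, hη₀, hrun⟩ := exists_extragradientStep hM hx₀
  refine ⟨η₀, hη₀, fun η hη hηle => ?_⟩
  have hpos := superlevel_subset_feasiblePos hM hδ
  have hx := fun t => (hrun η hη hηle t).1
  have hy := fun t => (hrun η hη hηle t).2.1
  have r := fun t => (hrun η hη hηle t).2.2
  set x := M.egIter η x₀ with hxdef
  obtain ⟨D, hD⟩ := (isCompact_feasible.image
    (continuous_toEuclidean (n := n) (m := m))).isBounded.exists_norm_le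
  obtain ⟨C, hC0, hC⟩ := ExtragradientRun.exists_gap_le r (f := fun t => M.potential (x t))
    (fun s t => by
      rw [← map_sub, inner_toEuclidean]
      exact dot_viOp_le_potential_sub hM (hpos (hx s)) (hpos (hx t)))
    (D := 2 * |D| + 1) (by positivity) (fun a ha b hb => by
      have h1 := norm_sub_le a b
      have h2 := hD a ha
      have h3 := hD b hb
      have h4 := le_abs_self D
      linarith)
  have hgap : ∀ T : ℕ, 1 ≤ T → ∀ y ∈ feasible n m, dot (M.viOp (x T)) (x T - y) ≤ C / T := by
    intro T hT y hy
    have := hC T hT _ ⟨y, hy, rfl⟩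
    rwa [← map_sub, inner_toEuclidean] at this
  refine ⟨fun T => ⟨hpos (hx T), hpos (hy T)⟩, ?_, ?_⟩
  · obtain ⟨xs, hxs, hgap0, φ, hφ, hlim⟩ := exists_subseq_tendsto_of_gap hM hδ hx hgap
    refine ⟨xs, ?_, ?_⟩
    · refine isCEAlloc_of_isApproxCEAlloc_zero ?_
      simpa using isApproxCEAlloc_of_gap hM hn (hpos hxs) le_rfl hgap0
    -- Distances to the limit of the subsequence decrease, since monotonicity makes ⟨F(y), y - xs⟩ ≥
    -- 0 at the solution xs. They tend to zero along the subsequence, hence altogether.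
    · have hanti : Antitone fun t => ‖toEuclidean (x t) - toEuclidean xs‖ := by
        refine antitone_nat_of_succ_le fun t => (r t).fejer ⟨xs, hxs.1, rfl⟩ ?_
        rw [← map_sub, inner_toEuclidean]
        have h1 := viOp_monotone hM (hpos (hy t)) (hpos hxs)
        have h2 := hgap0 _ (hy t).1
        rw [dot_sub_left] at h1
        have h3 : dot (M.viOp xs) (xs - M.egHalf η (x t)) =
            -dot (M.viOp xs) (M.egHalf η (x t) - xs) := by
          simp only [dot_sub_right]; ring
        linarith
      have hsub : Tendsto (fun k => ‖toEuclidean (x (φ k)) - toEuclidean xs‖) atTop (𝓝 0) := by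
        have h1 := ((continuous_toEuclidean.tendsto xs).comp hlim).sub_const (toEuclidean xs)
        simpa using h1.norm
      have hall : Tendsto (fun t => ‖toEuclidean (x t) - toEuclidean xs‖) atTop (𝓝 0) := by
        rw [Metric.tendsto_atTop] at hsub ⊢
        intro e he
        obtain ⟨k, hk⟩ := hsub e he
        refine ⟨φ k, fun t ht => ?_⟩
        have h1 := hk k le_rfl
        rw [Real.dist_0_eq_abs, abs_of_nonneg (norm_nonneg _)] at h1 ⊢
        exact (hanti ht).trans_lt h1
      refine tendsto_iff_dist_tendsto_zero.2 (squeeze_zero (fun t => dist_nonneg) (fun t => ?_) hall)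
      rw [← map_sub]
      exact dist_le_norm_toEuclidean _ _
  · set K := 1 + (∑ i, 1 / M.budget i) * ∑ i, M.own i 1 with hK
    have hK1 : 1 ≤ K := by
      have h1 : 0 ≤ ∑ i, 1 / M.budget i := Finset.sum_nonneg fun i _ => by
        have := hM.budget_pos i; positivity
      have h2 : 0 ≤ ∑ i, M.own i 1 := Finset.sum_nonneg fun i _ =>
        (hM.isCCH i).nonneg 1 zero_le_one
      have := mul_nonneg h1 h2
      linarith
    refine ⟨K * C, fun T hT => ⟨fun y hy => (hgap T hT y hy).trans ?_, ?_⟩⟩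
    · gcongr
      exact le_mul_of_one_le_left hC0 hK1
    · rw [mul_div_assoc]
      exact isApproxCEAlloc_of_gap hM hn (hpos (hx T)) (by positivity) (hgap T hT)

end InfluenceFisherMarket

/-! ### Multiplicative weights and nearly optimal utilities. -/

theorem sub_sq_le_log_one_add {s : ℝ} (hs : 0 ≤ s) : s - s ^ 2 ≤ Real.log (1 + s) := by
  have h1 := Real.one_sub_inv_le_log_of_pos (show 0 < 1 + s by linarith)
  have h2 : 1 - (1 + s)⁻¹ = s / (1 + s) := by field_simp; ring
  have h3 : s - s ^ 2 ≤ s / (1 + s) := by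
    rw [le_div_iff₀ (by linarith)]
    nlinarith [pow_nonneg hs 3]
  linarith

/-- The regret bound of the multiplicative weights method with linear updates. -/
theorem multiplicative_weights_regret {n : ℕ} {w g : ℕ → Fin n → ℝ} {η G : ℝ} (hη : 0 < η)
    (hg0 : ∀ t i, 0 ≤ g t i) (hgG : ∀ t i, g t i ≤ G) (hw0 : ∀ i, w 0 i = 1)
    (hw : ∀ t i, w (t + 1) i = w t i * (1 + η * g t i)) (k : Fin n) (K : ℕ) :
    ∑ t ∈ Finset.range K, g t k ≤ n / η + η * K * G ^ 2 +
      ∑ t ∈ Finset.range K, ∑ i, w t i / (∑ l, w t l) * g t i := by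
  have hpos : ∀ t i, 0 < w t i := by
    intro t
    induction t with
    | zero => intro i; rw [hw0]; exact one_pos
    | succ t ih =>
      intro i
      rw [hw]
      have := mul_nonneg hη.le (hg0 t i)
      exact mul_pos (ih i) (by linarith)
  have hW : ∀ t, 0 < ∑ l, w t l := fun t => Finset.sum_pos (fun l _ => hpos t l) ⟨k, Finset.mem_univ k⟩
  -- The logarithm of the total weight is bounded below by that of expert k alone, via log(1 + s) ≥
  -- s - s², and above through log(1 + s) ≤ s.
  have hlow : ∀ K : ℕ, η * ∑ t ∈ Finset.range K, g t k - K * (η ^ 2 * G ^ 2) ≤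
      Real.log (w K k) := by
    intro K
    induction K with
    | zero => simp [hw0]
    | succ K ih =>
      have h0 := mul_nonneg hη.le (hg0 K k)
      have h1 := sub_sq_le_log_one_add h0
      have h2 : (η * g K k) ^ 2 ≤ η ^ 2 * G ^ 2 := by
        rw [← mul_pow]
        have := hgG K k
        gcongr
      rw [hw, Real.log_mul (hpos K k).ne' (by linarith), Finset.sum_range_succ]
      push_cast
      linarith
  have hup : ∀ K : ℕ, Real.log (∑ l, w K l) ≤
      Real.log n + η * ∑ t ∈ Finset.range K, ∑ i, w t i / (∑ l, w t l) * g t i := by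
    intro K
    induction K with
    | zero => simp [hw0]
    | succ K ih =>
      set P := ∑ i, w K i / (∑ l, w K l) * g K i with hP
      have hP0 : 0 ≤ P := Finset.sum_nonneg fun i _ =>
        mul_nonneg (div_nonneg (hpos K i).le (hW K).le) (hg0 K i)
      have h1 : ∑ l, w (K + 1) l = (∑ l, w K l) * (1 + η * P) := by
        have h2 : (∑ l, w K l) * P = ∑ l, w K l * g K l := by
          rw [hP, Finset.mul_sum]
          refine Finset.sum_congr rfl fun i _ => ?_
          have := (hW K).ne'
          field_simp
        rw [mul_add, mul_one, mul_left_comm, h2, Finset.mul_sum, ← Finset.sum_add_distrib]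
        exact Finset.sum_congr rfl fun i _ => by rw [hw]; ring
      have h3 := mul_nonneg hη.le hP0
      have h4 := Real.log_le_sub_one_of_pos (show 0 < 1 + η * P by linarith)
      rw [h1, Real.log_mul (hW K).ne' (by linarith), Finset.sum_range_succ]
      linarith
  have h1 : Real.log (w K k) ≤ Real.log (∑ l, w K l) :=
    Real.log_le_log (hpos K k) (Finset.single_le_sum (f := fun l => w K l)
      (fun l _ => (hpos K l).le) (Finset.mem_univ k))
  have h2 := hlow K
  have h3 := hup K
  have h4 : Real.log n ≤ n := Real.log_le_self (Nat.cast_nonneg n)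
  set A := ∑ t ∈ Finset.range K, ∑ i, w t i / (∑ l, w t l) * g t i
  set X := ∑ t ∈ Finset.range K, g t k
  have h5 : η * X ≤ η * (n / η + η * K * G ^ 2 + A) := by
    have h6 : η * (n / η + η * K * G ^ 2 + A) = n + K * (η ^ 2 * G ^ 2) + η * A := by
      field_simp
    rw [h6]
    linarith
  exact le_of_mul_le_mul_left h5 hη

/-- Since R ≥ 1/q, (q - 1)² ≤ (e²/2) q. If q = 1 + s with s > e, then e² < s² and e²s ≤ s² make the
right side smaller than s². -/
theorem le_one_add_of_add_inv_le {q R e : ℝ} (he : 0 < e) (he1 : e ≤ 1) (hq : 0 < q)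
    (hqR : 1 ≤ q * R) (h : q + R - 2 ≤ e ^ 2 / 2) : q ≤ 1 + e := by
  by_contra hcon
  rw [not_le] at hcon
  have h1 : (q - 1) ^ 2 ≤ e ^ 2 / 2 * q := by
    have := mul_le_mul_of_nonneg_right h hq.le
    nlinarith
  obtain ⟨s, rfl⟩ : ∃ s, q = 1 + s := ⟨q - 1, by ring⟩
  have hs : e < s := by linarith
  have h2 : e ^ 2 < s ^ 2 := by gcongr
  have h3 : e ^ 2 * s ≤ s ^ 2 := by
    have := he.trans hs
    have : e * e * s ≤ 1 * s * s := by gcongr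
    linarith
  nlinarith

namespace InfluenceFisherMarket

variable {n m : ℕ} {M : InfluenceFisherMarket n m}

/-- Test optimality on the multiple of z that exhausts the budget. If z is free, arbitrarily large
multiples are affordable, so its utility vanishes. -/
theorem IsCE.budget_mul_own_le (hM : M.Regular) {x : Alloc n m} {p : Fin m → ℝ} (h : M.IsCE x p)
    (i : Fin n) {z : Fin m → ℝ} (hz : 0 ≤ z) :
    M.budget i * M.own i z ≤ M.own i (x i) * cost p z := by
  have hb := hM.budget_pos i
  have hx := h.feasible.1
  have hopt : ∀ c : ℝ, 0 ≤ c → c * cost p z ≤ M.budget i → c * M.own i z ≤ M.own i (x i) := by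
    intro c hc hcost
    have h1 := h.optimal i (c • z) (fun j => mul_nonneg hc (hz j)) (by
      refine le_trans (le_of_eq ?_) hcost
      simp only [cost, Finset.mul_sum, Pi.smul_apply, smul_eq_mul]
      exact Finset.sum_congr rfl fun j _ => by ring)
    rwa [hM.util_eq i (smul_nonneg hc hz) hx, hM.util_eq i (hx i) hx,
      (hM.isCCH i).smul c hc z hz] at h1
  have hc0 : 0 ≤ cost p z := Finset.sum_nonneg fun j _ => mul_nonneg (h.price_nonneg j) (hz j)
  have hz0 := (hM.isCCH i).nonneg z hz
  rcases hc0.eq_or_lt with hc | hc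
  · rw [← hc, mul_zero]
    by_contra hcon
    have hpos : 0 < M.own i z := pos_of_mul_pos_right (not_le.1 hcon) hb.le
    have h0 := (hM.isCCH i).nonneg (x i) (hx i)
    have h1 := hopt ((M.own i (x i) + 1) / M.own i z) (by positivity) (by rw [← hc]; linarith)
    rw [div_mul_cancel₀ _ hpos.ne'] at h1
    linarith
  · have h1 := hopt (M.budget i / cost p z) (by positivity)
      (by rw [div_mul_cancel₀ _ hc.ne'])
    rwa [div_mul_eq_mul_div, div_le_iff₀ hc] at h1

theorem IsCE.own_pos (hM : M.Regular) {x : Alloc n m} {p : Fin m → ℝ} (h : M.IsCE x p)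
    (i : Fin n) : 0 < M.own i (x i) := by
  have h1 := h.budget_mul_own_le hM i (z := 1) zero_le_one
  have h2 := mul_pos (hM.budget_pos i) ((hM.isCCH i).pos_of_pos (z := 1) fun _ => one_pos)
  have h3 := (hM.isCCH i).nonneg (x i) (h.feasible.1 i)
  by_contra hcon
  rw [le_antisymm (not_lt.1 hcon) h3, zero_mul] at h1
  linarith

theorem sum_cost (x : Alloc n m) (p : Fin m → ℝ) :
    ∑ i, cost p (x i) = ∑ j, p j * ∑ i, x i j := by
  simp only [cost, Finset.mul_sum]
  exact Finset.sum_comm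

theorem IsCE.sum_price_le {x : Alloc n m} {p : Fin m → ℝ} (h : M.IsCE x p) :
    ∑ j, p j ≤ ∑ i, M.budget i := by
  have h1 := h.walras
  simp only [mul_sub, mul_one, Finset.sum_sub_distrib] at h1
  rw [← sum_cost] at h1
  have h2 : ∑ i, cost p (x i) ≤ ∑ i, M.budget i := Finset.sum_le_sum fun i _ => h.affordable i
  linarith

/-- An allocation whose utilities are, on harmonic average, close to those of an equilibrium is an
approximate equilibrium allocation. -/
theorem IsCE.isApproxCEAlloc_of_ratio (hM : M.Regular) {x : Alloc n m} {p : Fin m → ℝ}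
    (h : M.IsCE x p) {y : Alloc n m} (hy : y ∈ M.feasiblePos) {δ e ε : ℝ} (he : 0 < e)
    (he1 : e ≤ 1) (hδε : δ ≤ ε)
    (hratio : ∑ i, M.budget i * (M.own i (x i) / M.own i (y i) - 1) ≤ δ)
    (hδ : ∀ i, δ ≤ M.budget i * (e ^ 2 / 2)) (hε : ∀ i, 3 * e * M.own i 1 ≤ ε) :
    M.IsApproxCEAlloc ε y := by
  obtain ⟨hyf, hyp⟩ := hM.mem_feasiblePos.1 hy
  have hb := hM.budget_pos
  -- R is the utility ratio and q the fraction of the budget spent on y at the equilibrium prices.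
  -- Optimality gives qR ≥ 1, so q + R ≥ 2.
  set R : Fin n → ℝ := fun i => M.own i (x i) / M.own i (y i) with hR
  set q : Fin n → ℝ := fun i => cost p (y i) / M.budget i with hq
  have hR0 : ∀ i, 0 < R i := fun i => div_pos (h.own_pos hM i) (hyp i)
  have hqR : ∀ i, 1 ≤ q i * R i := by
    intro i
    have h1 := h.budget_mul_own_le hM i (hyf.1 i)
    simp only [hq, hR]
    rw [div_mul_div_comm, one_le_div (mul_pos (hb i) (hyp i))]
    linarith
  have hq0 : ∀ i, 0 < q i := fun i => pos_of_mul_pos_left (one_pos.trans_le (hqR i)) (hR0 i).le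
  have hsum2 : ∀ i, 2 ≤ q i + R i := fun i => by
    nlinarith [hqR i, sq_nonneg (q i - R i), hq0 i, hR0 i]
  have hbq : ∀ i, M.budget i * q i = cost p (y i) := fun i => by
    simp only [hq]
    rw [mul_div_cancel₀ _ (hb i).ne']
  have hcost : ∑ i, cost p (y i) ≤ ∑ j, p j := by
    rw [sum_cost]
    exact Finset.sum_le_sum fun j _ => mul_le_of_le_one_right (h.price_nonneg j) (hyf.2 j)
  have hB := h.sum_price_le
  -- The costs of y sum to at most ∑ p ≤ ∑ b, so the budget-weighted sum of these nonnegative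
  -- excesses is at most δ, and each is small by itself.
  have hterm : ∀ i, q i + R i - 2 ≤ e ^ 2 / 2 := by
    intro i
    have h1 : M.budget i * (q i + R i - 2) ≤ ∑ k, M.budget k * (q k + R k - 2) :=
      Finset.single_le_sum (f := fun k => M.budget k * (q k + R k - 2))
        (fun k _ => mul_nonneg (hb k).le (by linarith [hsum2 k])) (Finset.mem_univ i)
    have h2 : ∑ k, M.budget k * (q k + R k - 2) =
        ∑ k, M.budget k * (R k - 1) + ∑ k, cost p (y k) - ∑ k, M.budget k := by
      rw [← Finset.sum_add_distrib, ← Finset.sum_sub_distrib]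
      exact Finset.sum_congr rfl fun k _ => by rw [← hbq k]; ring
    have h3 := hδ i
    refine le_of_mul_le_mul_left ?_ (hb i)
    linarith
  have hqe : ∀ i, q i ≤ 1 + e := fun i =>
    le_one_add_of_add_inv_le he he1 (hq0 i) (hqR i) (hterm i)
  have hRe : ∀ i, R i ≤ 1 + e := fun i =>
    le_one_add_of_add_inv_le he he1 (hR0 i) (by rw [mul_comm]; exact hqR i)
      (by linarith [hterm i])
  have hQ0 : 0 < 1 + e := by linarith
  have hscale : ∀ z, cost (fun j => p j / (1 + e)) z = cost p z / (1 + e) := by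
    intro z
    simp only [cost, Finset.sum_div]
    exact Finset.sum_congr rfl fun j _ => by ring
  refine ⟨fun j => p j / (1 + e), fun j => div_nonneg (h.price_nonneg j) hQ0.le, hyf,
    fun i => ?_, fun i z hz hcz => ?_, ?_⟩
  · rw [hscale, div_le_iff₀ hQ0, ← hbq i]
    exact mul_le_mul_of_nonneg_left (hqe i) (hb i).le
  · rw [hscale, div_le_iff₀ hQ0] at hcz
    rw [hM.util_eq i hz hyf.1, hM.util_eq i (hyf.1 i) hyf.1]
    have h1 := h.budget_mul_own_le hM i (z := z) hz
    have h2 : M.budget i * M.own i z ≤ M.budget i * (M.own i (x i) * (1 + e)) := by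
      have := mul_le_mul_of_nonneg_left hcz (h.own_pos hM i).le
      linarith
    have h3 := le_of_mul_le_mul_left h2 (hb i)
    have h4 : M.own i (x i) = R i * M.own i (y i) := (div_mul_cancel₀ _ (hyp i).ne').symm
    -- One factor 1 + e comes from R, the other from the scaled prices; (1 + e)² ≤ 1 + 3e as e ≤ 1.
    have h5 : R i * M.own i (y i) * (1 + e) ≤ (1 + e) * M.own i (y i) * (1 + e) := by
      have := hRe i
      have := hyp i
      gcongr
    have h6 : M.own i (y i) ≤ M.own i 1 :=
      (hM.isCCH i).mono (hyf.1 i) (le_one_of_mem_feasible hyf i)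
    have h7 : 3 * e * M.own i (y i) ≤ 3 * e * M.own i 1 := by gcongr
    have h8 : e ^ 2 * M.own i (y i) ≤ e * M.own i (y i) := by
      have := hyp i
      have : e ^ 2 ≤ e := by nlinarith
      gcongr
    have h9 := hε i
    rw [h4] at h3
    nlinarith
  · have h1 : ∑ j, p j / (1 + e) * (∑ i, y i j - 1) =
        -((∑ j, p j - ∑ i, cost p (y i)) / (1 + e)) := by
      rw [sum_cost, ← Finset.sum_sub_distrib, Finset.sum_div, ← Finset.sum_neg_distrib]
      exact Finset.sum_congr rfl fun j _ => by ring
    have h2 : 0 ≤ ∑ j, p j - ∑ i, cost p (y i) := sub_nonneg.2 hcost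
    have h3 : ∑ j, p j - ∑ i, cost p (y i) ≤ ∑ i, M.budget i * (R i - 1) := by
      have h4 : ∑ i, M.budget i - ∑ i, cost p (y i) ≤ ∑ i, M.budget i * (R i - 1) := by
        rw [← Finset.sum_sub_distrib]
        refine Finset.sum_le_sum fun i _ => ?_
        rw [← hbq i]
        have := mul_le_mul_of_nonneg_left (hsum2 i) (hb i).le
        linarith
      linarith
    rw [h1, abs_neg, abs_of_nonneg (div_nonneg h2 hQ0.le), div_le_iff₀ hQ0]
    have h4 : ∑ j, p j - ∑ i, cost p (y i) ≤ ε := by linarith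
    have h5 := mul_nonneg (h2.trans h4) he.le
    linarith

/-- The arithmetic mean of bundles compares with the harmonic mean of their utilities. -/
theorem card_div_own_le_sum (hM : M.Regular) (i : Fin n) {x : ℕ → Fin m → ℝ} {K : ℕ} (hK : 0 < K)
    (hx : ∀ t, 0 ≤ x t) (hp : ∀ t, 0 < M.own i (x t)) :
    K / M.own i ((K : ℝ)⁻¹ • ∑ t ∈ Finset.range K, x t) ≤
      ∑ t ∈ Finset.range K, 1 / M.own i (x t) := by
  have hv := hM.isCCH i
  have hK' : (0 : ℝ) < K := by exact_mod_cast hK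
  have hsup : ∀ K : ℕ, ∑ t ∈ Finset.range K, M.own i (x t) ≤
      M.own i (∑ t ∈ Finset.range K, x t) := by
    intro K
    induction K with
    | zero => simp [hv.map_zero]
    | succ K ih =>
      rw [Finset.sum_range_succ, Finset.sum_range_succ]
      have := hv.add_le _ (Finset.sum_nonneg fun t (_ : t ∈ Finset.range K) => hx t) _ (hx K)
      linarith
  have h1 := hsup K
  set a := M.own i ((K : ℝ)⁻¹ • ∑ t ∈ Finset.range K, x t) with ha
  have h2 : a = (K : ℝ)⁻¹ * M.own i (∑ t ∈ Finset.range K, x t) :=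
    hv.smul _ (by positivity) _ (Finset.sum_nonneg fun t _ => hx t)
  have h3 : ∑ t ∈ Finset.range K, M.own i (x t) ≤ K * a := by
    rw [h2, ← mul_assoc, mul_inv_cancel₀ hK'.ne', one_mul]
    exact h1
  have h4 : 0 < ∑ t ∈ Finset.range K, M.own i (x t) :=
    Finset.sum_pos (fun t _ => hp t) ⟨0, Finset.mem_range.2 hK⟩
  have ha0 : 0 < a := pos_of_mul_pos_right (h4.trans_le h3) hK'.le
  -- Tangent line of 1/u at u = a. By superadditivity the mean of the utilities is at most a, so
  -- summing suffices.
  have h5 : ∀ t ∈ Finset.range K, 2 / a - M.own i (x t) / a ^ 2 ≤ 1 / M.own i (x t) := by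
    intro t _
    have hpt := hp t
    have h6 : 1 / M.own i (x t) - (2 / a - M.own i (x t) / a ^ 2) =
        (a - M.own i (x t)) ^ 2 / (a ^ 2 * M.own i (x t)) := by
      field_simp
      ring
    have h7 : 0 ≤ (a - M.own i (x t)) ^ 2 / (a ^ 2 * M.own i (x t)) := by positivity
    linarith
  refine le_trans ?_ (Finset.sum_le_sum h5)
  rw [Finset.sum_sub_distrib, Finset.sum_const, Finset.card_range, nsmul_eq_mul, ← Finset.sum_div]
  have h8 : (∑ t ∈ Finset.range K, M.own i (x t)) / a ^ 2 ≤ K / a := by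
    rw [div_le_div_iff₀ (by positivity) ha0]
    nlinarith
  have h9 : (K : ℝ) * (2 / a) = 2 * (K / a) := by ring
  linarith

/-- The mean of the iterates of one multiplicative weights learner per good, playing buyers against
their marginal payoffs and mixed with the uniform allocation, is an approximate equilibrium. -/
theorem isApproxCEAlloc_of_multiplicative_weights (hM : M.Regular) (hn : 0 < n) {S ε τ η : ℝ}
    {K : ℕ} (hS : 1 ≤ S) (hnS : n ≤ S) (hmS : m ≤ S) (hBS : ∑ i, M.budget i ≤ S)
    (hbS : ∀ i, 1 / M.budget i ≤ S) (hUS : ∀ i, M.own i 1 ≤ S) (hε : 1 / S ≤ ε)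
    (hτ : τ = 1 / (108 * S ^ 7)) (hη : η = τ ^ 2 / (54 * S ^ 8)) (hK : 54 * S ^ 7 / η ≤ K)
    {w x : ℕ → Alloc n m} (hw0 : ∀ i j, w 0 i j = 1)
    (hx : ∀ t i j, x t i j = (1 - S * τ) * w t i j / (∑ k, w t k j) + τ)
    (hw : ∀ t i j, (∀ k j, 0 < x t k j) →
      w (t + 1) i j = w t i j * (1 + η * (M.budget i * logGrad (M.own i) (x t i) j))) :
    M.IsApproxCEAlloc ε ((K : ℝ)⁻¹ • ∑ t ∈ Finset.range K, x t) := by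
  have hS0 : 0 < S := by linarith
  have hτ0 : 0 < τ := by rw [hτ]; positivity
  have hη0 : 0 < η := by rw [hη]; positivity
  have hK' : (0 : ℝ) < K := lt_of_lt_of_le (by positivity) hK
  have hK0 : 0 < K := by exact_mod_cast hK'
  have hb := hM.budget_pos
  have hSτ : S * τ ≤ 1 / 2 := by
    rw [hτ, mul_one_div, div_le_div_iff₀ (by positivity) two_pos]
    have : S ^ 1 ≤ S ^ 7 := pow_le_pow_right₀ hS (by norm_num)
    linarith
  have hxw : ∀ t, (∀ i j, 0 < w t i j) → ∀ i j, τ ≤ x t i j := by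
    intro t hwt i j
    rw [hx]
    have h1 : 0 ≤ (1 - S * τ) * w t i j / ∑ k, w t k j :=
      div_nonneg (mul_nonneg (by linarith) (hwt i j).le)
        (Finset.sum_nonneg fun k _ => (hwt k j).le)
    linarith
  have hgrad : ∀ t, (∀ i j, τ ≤ x t i j) → ∀ i,
      0 ≤ x t i ∧ 0 < M.own i (x t i) := fun t h i =>
    ⟨fun j => hτ0.le.trans (h i j), (hM.isCCH i).pos_of_pos fun j => hτ0.trans_le (h i j)⟩
  -- The update rule is given only at positive allocations, so positivity must be proved along with
  -- it, step by step.
  have hwpos : ∀ t i j, 0 < w t i j := by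
    intro t
    induction t with
    | zero => intro i j; rw [hw0]; exact one_pos
    | succ t ih =>
      intro i j
      have h1 := hxw t ih
      obtain ⟨h2, h3⟩ := hgrad t h1 i
      rw [hw t i j fun k l => hτ0.trans_le (h1 k l)]
      have h4 := (hM.isCCH i).logGrad_nonneg h2 h3 j
      have := hb i
      have := ih i j
      positivity
  have hxτ := fun t => hxw t (hwpos t)
  have hxg := fun t => hgrad t (hxτ t)
  have hWpos : ∀ t j, 0 < ∑ k, w t k j := fun t j =>
    Finset.sum_pos (fun k _ => hwpos t k j) ⟨⟨0, hn⟩, Finset.mem_univ _⟩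
  have hxf : ∀ t, x t ∈ feasible n m := by
    refine fun t => ⟨fun i j => (hxg t i).1 j, fun j => ?_⟩
    simp only [hx, Finset.sum_add_distrib, ← Finset.sum_div, ← Finset.mul_sum, Finset.sum_const,
      Finset.card_univ, Fintype.card_fin, nsmul_eq_mul]
    rw [mul_div_cancel_right₀ _ (hWpos t j).ne']
    have := mul_le_mul_of_nonneg_right hnS hτ0.le
    linarith
  set g : ℕ → Fin n → Fin m → ℝ := fun t i j => M.budget i * logGrad (M.own i) (x t i) j with hg
  have hg0 : ∀ t i j, 0 ≤ g t i j := fun t i j =>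
    mul_nonneg (hb i).le ((hM.isCCH i).logGrad_nonneg (hxg t i).1 (hxg t i).2 j)
  have hbi : ∀ i, M.budget i ≤ S := fun i =>
    (Finset.single_le_sum (f := fun i => M.budget i) (fun i _ => (hb i).le)
      (Finset.mem_univ i)).trans hBS
  -- By Euler's identity, marginal payoff times amount held is at most b_i ≤ S, and every amount is
  -- at least τ. No derivative bound enters.
  have hgG : ∀ t i j, g t i j ≤ S / τ := by
    intro t i j
    have h1 := (hM.isCCH i).logGrad_mul_le_one (hxg t i).1 (hxg t i).2 j
    rw [le_div_iff₀ hτ0]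
    calc g t i j * τ ≤ g t i j * x t i j := mul_le_mul_of_nonneg_left (hxτ t i j) (hg0 t i j)
      _ = M.budget i * (logGrad (M.own i) (x t i) j * x t i j) := by simp only [hg]; ring
      _ ≤ M.budget i * 1 := mul_le_mul_of_nonneg_left h1 (hb i).le
      _ ≤ S := by rw [mul_one]; exact hbi i
  set B := ∑ i, M.budget i with hB
  have hB0 : 0 ≤ B := Finset.sum_nonneg fun i _ => (hb i).le
  have hsumx : ∀ t, ∑ j, ∑ i, g t i j * x t i j = B := by
    intro t
    rw [Finset.sum_comm]
    refine Finset.sum_congr rfl fun i _ => ?_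
    have := (hM.isCCH i).sum_logGrad_self (hxg t i).1 (hxg t i).2
    simp only [hg, mul_assoc, ← Finset.mul_sum]
    rw [this, mul_one]
  have h1Sτ : 0 < 1 - S * τ := by linarith
  -- The normalized weights are at most x/(1 - Sτ), and the gains at x total exactly B by Euler's
  -- identity.
  have hplay : ∀ t, ∑ j, ∑ i, w t i j / (∑ l, w t l j) * g t i j ≤ B / (1 - S * τ) := by
    intro t
    rw [le_div_iff₀ h1Sτ, ← hsumx t, Finset.sum_mul]
    refine Finset.sum_le_sum fun j _ => ?_
    rw [Finset.sum_mul]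
    refine Finset.sum_le_sum fun i _ => ?_
    have h2 : (1 - S * τ) * w t i j / (∑ l, w t l j) ≤ x t i j := by rw [hx]; linarith
    have h3 := mul_le_mul_of_nonneg_left h2 (hg0 t i j)
    calc _ = g t i j * ((1 - S * τ) * w t i j / (∑ l, w t l j)) := by ring
      _ ≤ _ := h3
  obtain ⟨x₀, hx₀⟩ := exists_mem_feasiblePos hM hn
  obtain ⟨η₀, hη₀, hcv⟩ := extragradient_convergence hM hn hx₀
  obtain ⟨-, ⟨xs, ⟨p, hCE⟩, -⟩, -⟩ := hcv η₀ hη₀ le_rfl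
  have hxs := hCE.feasible
  set A := n / η + η * K * (S / τ) ^ 2 with hA
  have hA0 : 0 ≤ A := by positivity
  -- The learner for good j competes with each single buyer, hence with the mixture given by the
  -- shares of good j in xs. Those sum to at most 1, and the bound is nonnegative.
  have hregret : ∑ t ∈ Finset.range K, ∑ i, ∑ j, g t i j * xs i j ≤
      m * A + K * (B / (1 - S * τ)) := by
    calc ∑ t ∈ Finset.range K, ∑ i, ∑ j, g t i j * xs i j
        = ∑ j, ∑ i, xs i j * ∑ t ∈ Finset.range K, g t i j := by
          simp only [Finset.mul_sum]
          rw [Finset.sum_comm, Finset.sum_comm (s := Finset.univ (α := Fin m))]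
          refine Finset.sum_congr rfl fun i _ => ?_
          rw [Finset.sum_comm]
          exact Finset.sum_congr rfl fun j _ => Finset.sum_congr rfl fun t _ => mul_comm _ _
      _ ≤ ∑ j, (A + ∑ t ∈ Finset.range K, ∑ i, w t i j / (∑ l, w t l j) * g t i j) := by
          refine Finset.sum_le_sum fun j _ => ?_
          set V := A + ∑ t ∈ Finset.range K, ∑ i, w t i j / (∑ l, w t l j) * g t i j with hV
          have hV0 : 0 ≤ V := add_nonneg hA0 (Finset.sum_nonneg fun t _ =>
            Finset.sum_nonneg fun i _ => mul_nonneg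
              (div_nonneg (hwpos t i j).le (hWpos t j).le) (hg0 t i j))
          calc ∑ i, xs i j * ∑ t ∈ Finset.range K, g t i j ≤ ∑ i, xs i j * V := by
                refine Finset.sum_le_sum fun i _ => mul_le_mul_of_nonneg_left ?_ (hxs.1 i j)
                exact multiplicative_weights_regret (w := fun t i => w t i j)
                  (g := fun t i => g t i j) hη0 (fun t i => hg0 t i j) (fun t i => hgG t i j)
                  (fun i => hw0 i j)
                  (fun t i => hw t i j fun k l => hτ0.trans_le (hxτ t k l)) i K
            _ = (∑ i, xs i j) * V := by rw [Finset.sum_mul]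
            _ ≤ 1 * V := mul_le_mul_of_nonneg_right (hxs.2 j) hV0
            _ = V := one_mul V
      _ = m * A + ∑ t ∈ Finset.range K, ∑ j, ∑ i, w t i j / (∑ l, w t l j) * g t i j := by
          rw [Finset.sum_add_distrib, Finset.sum_comm (s := Finset.univ (α := Fin m))]
          simp
      _ ≤ m * A + ∑ t ∈ Finset.range K, B / (1 - S * τ) := by
          gcongr with t _
          exact hplay t
      _ = _ := by simp
  set y := (K : ℝ)⁻¹ • ∑ t ∈ Finset.range K, x t with hy
  have hyi : ∀ i, y i = (K : ℝ)⁻¹ • ∑ t ∈ Finset.range K, x t i := fun i => by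
    rw [hy, Pi.smul_apply, Finset.sum_apply]
  have hyij : ∀ i j, y i j = (K : ℝ)⁻¹ * ∑ t ∈ Finset.range K, x t i j := fun i j => by
    rw [hyi, Pi.smul_apply, Finset.sum_apply, smul_eq_mul]
  have hypos : ∀ i j, 0 < y i j := fun i j => by
    rw [hyij]
    exact mul_pos (inv_pos.2 hK') (Finset.sum_pos (fun t _ => hτ0.trans_le (hxτ t i j))
      ⟨0, Finset.mem_range.2 hK0⟩)
  have hyfp : y ∈ M.feasiblePos := by
    refine hM.mem_feasiblePos.2 ⟨⟨fun i j => (hypos i j).le, fun j => ?_⟩,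
      fun i => (hM.isCCH i).pos_of_pos (hypos i)⟩
    simp only [hyij, ← Finset.mul_sum]
    rw [Finset.sum_comm]
    have : ∑ t ∈ Finset.range K, ∑ i, x t i j ≤ ∑ t ∈ Finset.range K, (1 : ℝ) :=
      Finset.sum_le_sum fun t _ => (hxf t).2 j
    simp only [Finset.sum_const, Finset.card_range, nsmul_eq_mul, mul_one] at this
    rw [inv_mul_le_iff₀ hK']
    linarith
  have hδ1 : (K : ℝ) * ∑ i, M.budget i * (M.own i (xs i) / M.own i (y i)) ≤
      m * A + K * (B / (1 - S * τ)) := by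
    refine le_trans ?_ hregret
    rw [Finset.sum_comm, Finset.mul_sum]
    refine Finset.sum_le_sum fun i _ => ?_
    have h1 := card_div_own_le_sum hM i hK0 (fun t => (hxg t i).1) fun t => (hxg t i).2
    rw [← hyi] at h1
    have h2 : ∀ t ∈ Finset.range K, M.budget i * M.own i (xs i) * (1 / M.own i (x t i)) ≤
        ∑ j, g t i j * xs i j := by
      intro t _
      have h3 := (hM.isCCH i).div_le_sum_logGrad (hxg t i).1 (hxg t i).2 (hxs.1 i)
      have h4 := mul_le_mul_of_nonneg_left h3 (hb i).le
      rw [Finset.mul_sum] at h4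
      calc _ = M.budget i * (M.own i (xs i) / M.own i (x t i)) := by ring
        _ ≤ _ := h4
        _ = _ := Finset.sum_congr rfl fun j _ => by simp only [hg]; ring
    have h5 := Finset.sum_le_sum h2
    rw [← Finset.mul_sum] at h5
    have h6 := mul_le_mul_of_nonneg_left h1
      (mul_nonneg (hb i).le ((hM.isCCH i).nonneg _ (hxs.1 i)))
    calc _ = M.budget i * M.own i (xs i) * (K / M.own i (y i)) := by ring
      _ ≤ _ := h6.trans h5
  -- Three errors of at most 1/(54 S^5) each: the initial regret fixes K, the quadratic regret fixes
  -- η, and the mixing, at most 2S²τ, fixes τ.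
  have hδ : ∑ i, M.budget i * (M.own i (xs i) / M.own i (y i) - 1) ≤ 1 / (18 * S ^ 5) := by
    have h1 : ∑ i, M.budget i * (M.own i (xs i) / M.own i (y i) - 1) =
        ∑ i, M.budget i * (M.own i (xs i) / M.own i (y i)) - B := by
      rw [hB, ← Finset.sum_sub_distrib]
      exact Finset.sum_congr rfl fun i _ => by ring
    have h2 : ∑ i, M.budget i * (M.own i (xs i) / M.own i (y i)) ≤
        (m * A + K * (B / (1 - S * τ))) / K := by
      rw [le_div_iff₀ hK']
      linarith
    have h3 : (m * A + K * (B / (1 - S * τ))) / K - B =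
        m * n / (η * K) + m * η * (S / τ) ^ 2 + B * (S * τ / (1 - S * τ)) := by
      rw [hA]
      field_simp
      ring
    have h4 : m * n / (η * K) ≤ 1 / (54 * S ^ 5) := by
      rw [div_le_iff₀ hη0] at hK
      rw [div_le_div_iff₀ (by positivity) (by positivity)]
      have h5 : (m : ℝ) * n ≤ S * S := by gcongr
      calc (m : ℝ) * n * (54 * S ^ 5) ≤ S * S * (54 * S ^ 5) := by gcongr
        _ = 54 * S ^ 7 := by ring
        _ ≤ 1 * (η * K) := by linarith
    have h5 : m * η * (S / τ) ^ 2 ≤ 1 / (54 * S ^ 5) := by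
      calc (m : ℝ) * η * (S / τ) ^ 2 ≤ S * η * (S / τ) ^ 2 := by gcongr
        _ = 1 / (54 * S ^ 5) := by rw [hη]; field_simp
    have h6 : B * (S * τ / (1 - S * τ)) ≤ 1 / (54 * S ^ 5) := by
      have h7 : S * τ / (1 - S * τ) ≤ 2 * (S * τ) := by
        rw [div_le_iff₀ h1Sτ]
        have : 0 < S * τ := by positivity
        nlinarith
      calc B * (S * τ / (1 - S * τ)) ≤ S * (2 * (S * τ)) :=
            mul_le_mul hBS h7 (by positivity) hS0.le
        _ = 1 / (54 * S ^ 5) := by rw [hτ]; field_simp; norm_num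
    have h7 : 1 / (18 * S ^ 5) = 1 / (54 * S ^ 5) + 1 / (54 * S ^ 5) + 1 / (54 * S ^ 5) := by
      field_simp
      norm_num
    linarith
  -- With this e, 3eS = 1/S ≤ ε, while b_i e²/2 ≥ 1/(18 S^5) because b_i ≥ 1/S.
  refine hCE.isApproxCEAlloc_of_ratio hM hyfp (e := 1 / (3 * S ^ 2)) (by positivity) ?_ ?_ hδ
    (fun i => ?_) fun i => ?_
  · rw [div_le_one (by positivity)]
    nlinarith
  · refine le_trans ?_ hε
    refine one_div_le_one_div_of_le hS0 ?_
    have : S ^ 1 ≤ S ^ 5 := pow_le_pow_right₀ hS (by norm_num)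
    linarith
  · have h1 := hbS i
    rw [div_le_iff₀ (hb i)] at h1
    have h2 : (1 / (3 * S ^ 2)) ^ 2 / 2 = 1 / (18 * S ^ 4) := by field_simp; norm_num
    rw [h2, div_le_iff₀ (by positivity)]
    calc (1 : ℝ) ≤ S * M.budget i := h1
      _ = M.budget i * (1 / (18 * S ^ 4)) * (18 * S ^ 5) := by field_simp
  · refine le_trans ?_ hε
    calc 3 * (1 / (3 * S ^ 2)) * M.own i 1 ≤ 3 * (1 / (3 * S ^ 2)) * S := by
          have := hUS i
          gcongr
      _ = 1 / S := by field_simp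

end InfluenceFisherMarket

/-! ### A program logic with step bounds. -/

/-- With oracle `O`, the program `P` started in `s` halts within `T` steps in a state satisfying
`Q`. -/
def Runs (O : FirstOrderOracle) (P : Prog) (s : Store) (T : ℕ) (Q : Store → Prop) : Prop :=
  ∃ s' t, Exec O P s s' t ∧ t ≤ T ∧ Q s'

/-- Run `P` for each value of register `v` below the content of register `w`. -/
def Prog.forTo (v w : ℕ) (P : Prog) : Prog :=
  .seq (.natZero v) (.loop (.natLt v w) (.seq P (.natSucc v)))

namespace Runs

variable {O : FirstOrderOracle} {P P' : Prog} {s : Store} {T T' : ℕ} {Q Q' : Store → Prop}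

theorem mono (h : Runs O P s T Q) (hT : T ≤ T') (hQ : ∀ s, Q s → Q' s) : Runs O P s T' Q' := by
  obtain ⟨s', t, h1, h2, h3⟩ := h
  exact ⟨s', t, h1, h2.trans hT, hQ _ h3⟩

theorem seq (h : Runs O P s T Q) (h' : ∀ s', Q s' → Runs O P' s' T' Q') :
    Runs O (.seq P P') s (T + T') Q' := by
  obtain ⟨s', t, h1, h2, h3⟩ := h
  obtain ⟨s'', t', h4, h5, h6⟩ := h' s' h3
  exact ⟨s'', t + t', .seq h1 h4, by omega, h6⟩

theorem assign {a v w : ℕ} {e : RExp} (hT : e.size + 1 ≤ T)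
    (h : Q (s.setReal a v w (e.eval s))) : Runs O (.assign a v w e) s T Q :=
  ⟨_, _, .assign s a v w e, hT, h⟩

theorem askValue {a v w i x : ℕ} (h : Q (s.setReal a v w (O.value (s.nat i) (s.real x)))) :
    Runs O (.askValue a v w i x) s 1 Q :=
  ⟨_, _, .askValue s a v w i x, le_rfl, h⟩

theorem askPartial {a v w i j x : ℕ}
    (h : Q (s.setReal a v w (O.partialDeriv (s.nat i) (s.nat j) (s.real x)))) :
    Runs O (.askPartial a v w i j x) s 1 Q :=
  ⟨_, _, .askPartial s a v w i j x, le_rfl, h⟩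

/-- Indexing the invariant by the number of completed rounds gives the exact number of rounds; the
induction is on the number remaining. -/
theorem loop {b : Test} (I : ℕ → Store → Prop) (K : ℕ)
    (hstep : ∀ k < K, ∀ s, I k s → b.holds s ∧ Runs O P s T (I (k + 1)))
    (hend : ∀ s, I K s → ¬ b.holds s) (h : I 0 s) :
    Runs O (.loop b P) s (K * (T + b.size) + b.size) (I K) := by
  have key : ∀ l ≤ K, ∀ s, I (K - l) s →
      Runs O (.loop b P) s (l * (T + b.size) + b.size) (I K) := by
    intro l
    induction l with
    | zero => exact fun _ s hs => ⟨s, b.size, Exec.loop_stop (hend s hs), by omega, hs⟩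
    | succ l ih =>
      intro hl s hs
      obtain ⟨hb, s', t, h1, h2, h3⟩ := hstep (K - (l + 1)) (by omega) s hs
      rw [show K - (l + 1) + 1 = K - l by omega] at h3
      obtain ⟨s'', t', h4, h5, h6⟩ := ih (by omega) s' h3
      refine ⟨s'', b.size + t + t', .loop_step hb h1 h4, ?_, h6⟩
      rw [Nat.succ_mul]
      omega
  exact key K le_rfl s (by rwa [Nat.sub_self])

theorem forTo {v w : ℕ} (I : ℕ → Store → Prop) (K : ℕ) (h0 : I 0 (s.setNat v 0))
    (hreg : ∀ k s, I k s → s.nat v = k ∧ s.nat w = K)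
    (hstep : ∀ k < K, ∀ s, I k s →
      Runs O P s T fun s' => s'.nat v = k ∧ I (k + 1) (s'.setNat v (k + 1))) :
    Runs O (.forTo v w P) s (K * (T + 2) + 2) (I K) := by
  have h1 : Runs O (.natZero v) s 1 (I 0) := ⟨_, _, .natZero s v, le_rfl, h0⟩
  refine (h1.seq fun s' hs' => loop (b := .natLt v w) (P := .seq P (.natSucc v)) (T := T + 1)
    I K (fun k hk s hs => ?_) (fun s hs => ?_) hs').mono (by simp [Test.size]; ring_nf; omega)
    fun _ h => h
  · refine ⟨?_, (hstep k hk s hs).seq fun s' hs' => ⟨_, _, .natSucc s' v, le_rfl, ?_⟩⟩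
    · obtain ⟨h1, h2⟩ := hreg k s hs
      simpa [Test.holds, h1, h2] using hk
    · rw [hs'.1]
      exact hs'.2
  · obtain ⟨h1, h2⟩ := hreg K s hs
    simp [Test.holds, h1, h2]

end Runs

/-- An invariant that ignores the counter register survives its increments, so loop bodies need only
preserve the counter. -/
theorem Runs.forTo_of_stable {O : FirstOrderOracle} {P : Prog} {s : Store} {T v w : ℕ}
    (I : ℕ → Store → Prop) (K : ℕ)
    (hst : ∀ k s r, I k s → I k (s.setNat v r)) (hw : ∀ k s, I k s → s.nat w = K)
    (hstep : ∀ k < K, ∀ s, I k s → s.nat v = k →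
      Runs O P s T fun s' => s'.nat v = k ∧ I (k + 1) s') (h0 : I 0 s) :
    Runs O (.forTo v w P) s (K * (T + 2) + 2) (I K) := by
  refine (Runs.forTo (fun k s => I k s ∧ s.nat v = k) K ⟨hst _ _ _ h0, by simp [Store.setNat]⟩
    (fun k s h => ⟨h.2, hw k s h.1⟩) (fun k hk s h => ?_)).mono le_rfl fun s h => h.1
  exact (hstep k hk s h.1 h.2).mono le_rfl fun s' h' =>
    ⟨h'.1, hst _ _ _ h'.2, by simp [Store.setNat]⟩

namespace RExp

/-- Powers by repeated multiplication. -/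
def npow (e : RExp) : ℕ → RExp
  | 0 => const 1
  | k + 1 => mul (npow e k) e

theorem eval_npow (s : Store) (e : RExp) (k : ℕ) : (npow e k).eval s = e.eval s ^ k := by
  induction k with
  | zero => simp [npow, eval]
  | succ k ih => simp [npow, eval, ih, pow_succ]

/-- The entry of the array `a` at row and column `0`. -/
def scalar (a : ℕ) : RExp := cell a 4 4

end RExp

/-! ### The equilibrium program and its memory. -/

namespace EquilibriumProgram

/-- Overwrite one entry of an array. -/
def upd (A : ℕ → ℕ → ℝ) (i j : ℕ) (r : ℝ) : ℕ → ℕ → ℝ :=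
  fun i' j' => if i' = i ∧ j' = j then r else A i' j'

/-- Overwrite the upper left `n × m` block of an array. -/
def fill (n m : ℕ) (new old : ℕ → ℕ → ℝ) : ℕ → ℕ → ℝ :=
  fun i j => if i < n ∧ j < m then new i j else old i j

/-- Overwrite the first `k` rows of width `m` of an array, and the first `l` entries of the next. -/
def fillRows (m k l : ℕ) (new old : ℕ → ℕ → ℝ) : ℕ → ℕ → ℝ :=
  fun i j => if j < m ∧ (i < k ∨ i = k ∧ j < l) then new i j else old i j

/-- Overwrite the first `l` columns of height `n` of an array, and the first `k` entries of the
next. -/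
def fillCols (n k l : ℕ) (new old : ℕ → ℕ → ℝ) : ℕ → ℕ → ℝ :=
  fun i j => if i < n ∧ (j < l ∨ j = l ∧ i < k) then new i j else old i j

section fill

variable {n m k l : ℕ} {new old : ℕ → ℕ → ℝ}

theorem fillRows_zero : fillRows m 0 0 new old = old := by
  ext i j; simp [fillRows]

theorem fillCols_zero : fillCols n 0 0 new old = old := by
  ext i j; simp [fillCols]

theorem fillRows_self : fillRows m k l new old k l = old k l := by
  simp [fillRows]

theorem upd_fillRows (hl : l < m) :
    upd (fillRows m k l new old) k l (new k l) = fillRows m k (l + 1) new old := by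
  ext i j
  simp only [upd, fillRows]
  grind

theorem upd_fillCols (hk : k < n) :
    upd (fillCols n k l new old) k l (new k l) = fillCols n (k + 1) l new old := by
  ext i j
  simp only [upd, fillCols]
  grind

theorem fillRows_row : fillRows m k m new old = fillRows m (k + 1) 0 new old := by
  ext i j
  simp only [fillRows]
  grind

theorem fillCols_col : fillCols n n l new old = fillCols n 0 (l + 1) new old := by
  ext i j
  simp only [fillCols]
  grind

theorem fillRows_eq_fill : fillRows m n 0 new old = fill n m new old := by
  ext i j
  simp only [fillRows, fill]
  grind

theorem fillCols_eq_fill : fillCols n 0 m new old = fill n m new old := by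
  ext i j
  simp only [fillCols, fill]
  grind

end fill

open RExp Prog in
/-- Set the weights and the allocation to one. -/
def initProg : Prog :=
  forTo 2 0 (forTo 3 1 (seq (assign 3 2 3 (const 1)) (assign 4 2 3 (const 1))))

open RExp Prog in
/-- Compute the problem size. -/
def sizeProg : Prog :=
  seq (assign 5 4 4 (div (const 1) (scalar 1)))
    (seq (forTo 2 0 (seq (askValue 11 4 4 2 3)
        (assign 5 4 4 (add (scalar 5) (add (const 1)
          (add (add (cell 0 2 4) (div (const 1) (cell 0 2 4))) (scalar 11)))))))
      (forTo 3 1 (assign 5 4 4 (add (scalar 5) (const 1)))))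

open RExp Prog in
/-- Compute the mixing weight, the step size and the number of iterations. -/
def paramProg : Prog :=
  seq (assign 7 4 4 (div (const 1) (mul (const 108) (npow (scalar 5) 7))))
    (seq (assign 8 4 4 (div (npow (scalar 7) 2) (mul (const 54) (npow (scalar 5) 8))))
      (assign 9 4 4 (div (mul (const 54) (npow (scalar 5) 7)) (scalar 8))))

open RExp Prog in
/-- Normalize the weights of each good and mix with the uniform allocation. -/
def allocProg : Prog :=
  forTo 3 1 (seq (assign 10 4 4 (const 0))
    (seq (forTo 2 0 (assign 10 4 4 (add (scalar 10) (cell 4 2 3))))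
      (forTo 2 0 (assign 3 2 3
        (add (div (mul (sub (const 1) (mul (scalar 5) (scalar 7))) (cell 4 2 3)) (scalar 10))
          (scalar 7))))))

open RExp Prog in
/-- Update the weights and the mean of the allocations. -/
def updateProg : Prog :=
  forTo 2 0 (seq (askValue 11 4 4 2 3)
    (forTo 3 1 (seq (askPartial 12 4 4 2 3 3)
      (seq (assign 4 2 3 (mul (cell 4 2 3) (add (const 1) (mul (scalar 8)
          (div (mul (cell 0 2 4) (scalar 12)) (scalar 11))))))
        (assign 2 2 3 (add (cell 2 2 3) (div (sub (cell 3 2 3) (cell 2 2 3)) (scalar 6))))))))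

open RExp Prog in
/-- One multiplicative weights learner per good, with the buyers as experts and their marginal
payoffs as gains; the output is the mean of the allocations. -/
def mainProg : Prog :=
  seq initProg (seq sizeProg (seq paramProg
    (loop (.realLt (scalar 6) (scalar 9))
      (seq allocProg (seq (assign 6 4 4 (add (scalar 6) (const 1))) updateProg)))))

/-- The contents of the registers and arrays used by the program, but for the scratch space. -/
structure Mem (n m : ℕ) (b : ℕ → ℝ) (ε : ℝ) (o x w : ℕ → ℕ → ℝ) (S c τ η N : ℝ) (s : Store) :
    Prop where
  rows : s.nat 0 = n
  cols : s.nat 1 = m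
  zero : s.nat 4 = 0
  budget : ∀ i, s.real 0 i 0 = b i
  accuracy : s.real 1 0 0 = ε
  out : s.real 2 = o
  alloc : s.real 3 = x
  weight : s.real 4 = w
  size : s.real 5 0 0 = S
  count : s.real 6 0 0 = c
  mixing : s.real 7 0 0 = τ
  step : s.real 8 0 0 = η
  iters : s.real 9 0 0 = N

namespace Mem

variable {n m : ℕ} {b : ℕ → ℝ} {ε : ℝ} {o x w : ℕ → ℕ → ℝ} {S c τ η N : ℝ} {s : Store}
  (h : Mem n m b ε o x w S c τ η N s)

include h

/-- Registers 2 and 3 are the loop counters for buyers and goods, left free by `Mem` so that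
invariants are stable in the sense of `Runs.forTo_of_stable`. -/
theorem setNat {v : ℕ} (hv : v = 2 ∨ v = 3) (r : ℕ) :
    Mem n m b ε o x w S c τ η N (s.setNat v r) := by
  obtain ⟨h1, h2, h3, h4⟩ := h
  rcases hv with rfl | rfl <;>
  exact ⟨by simpa [Store.setNat], by simpa [Store.setNat], by simpa [Store.setNat],
    ‹_›, ‹_›, ‹_›, ‹_›, ‹_›, ‹_›, ‹_›, ‹_›, ‹_›, ‹_›⟩

theorem setScratch {a : ℕ} (ha : 10 ≤ a) (r : ℝ) :
    Mem n m b ε o x w S c τ η N (s.setReal a 4 4 r) := by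
  have hne : ∀ a' < 10, (s.setReal a 4 4 r).real a' = s.real a' := by
    intro a' ha'
    ext i j
    simp only [Store.setReal]
    rw [if_neg (by omega)]
  obtain ⟨h1, h2, h3, h4, h5, h6, h7, h8, h9, h10, h11, h12, h13⟩ := h
  constructor <;> first | assumption | simpa [hne]

theorem setSize (r : ℝ) : Mem n m b ε o x w r c τ η N (s.setReal 5 4 4 r) := by
  obtain ⟨h1, h2, h3, h4, h5, h6, h7, h8, h9, h10, h11, h12, h13⟩ := h
  constructor <;> first | assumption | simp [Store.setReal, h3]

theorem setCount (r : ℝ) : Mem n m b ε o x w S r τ η N (s.setReal 6 4 4 r) := by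
  obtain ⟨h1, h2, h3, h4, h5, h6, h7, h8, h9, h10, h11, h12, h13⟩ := h
  constructor <;> first | assumption | simp [Store.setReal, h3]

theorem setMixing (r : ℝ) : Mem n m b ε o x w S c r η N (s.setReal 7 4 4 r) := by
  obtain ⟨h1, h2, h3, h4, h5, h6, h7, h8, h9, h10, h11, h12, h13⟩ := h
  constructor <;> first | assumption | simp [Store.setReal, h3]

theorem setStep (r : ℝ) : Mem n m b ε o x w S c τ r N (s.setReal 8 4 4 r) := by
  obtain ⟨h1, h2, h3, h4, h5, h6, h7, h8, h9, h10, h11, h12, h13⟩ := h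
  constructor <;> first | assumption | simp [Store.setReal, h3]

theorem setIters (r : ℝ) : Mem n m b ε o x w S c τ η r (s.setReal 9 4 4 r) := by
  obtain ⟨h1, h2, h3, h4, h5, h6, h7, h8, h9, h10, h11, h12, h13⟩ := h
  constructor <;> first | assumption | simp [Store.setReal, h3]

theorem setOut {i j : ℕ} (hi : s.nat 2 = i) (hj : s.nat 3 = j) (r : ℝ) :
    Mem n m b ε (upd o i j r) x w S c τ η N (s.setReal 2 2 3 r) := by
  obtain ⟨h1, h2, h3, h4, h5, h6, h7, h8, h9, h10, h11, h12, h13⟩ := h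
  subst h6 hi hj
  constructor <;> first | assumption | rfl | simpa [Store.setReal] | (ext; simp [Store.setReal, upd])

theorem setAlloc {i j : ℕ} (hi : s.nat 2 = i) (hj : s.nat 3 = j) (r : ℝ) :
    Mem n m b ε o (upd x i j r) w S c τ η N (s.setReal 3 2 3 r) := by
  obtain ⟨h1, h2, h3, h4, h5, h6, h7, h8, h9, h10, h11, h12, h13⟩ := h
  subst h7 hi hj
  constructor <;> first | assumption | rfl | simpa [Store.setReal] | (ext; simp [Store.setReal, upd])

theorem setWeight {i j : ℕ} (hi : s.nat 2 = i) (hj : s.nat 3 = j) (r : ℝ) :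
    Mem n m b ε o x (upd w i j r) S c τ η N (s.setReal 4 2 3 r) := by
  obtain ⟨h1, h2, h3, h4, h5, h6, h7, h8, h9, h10, h11, h12, h13⟩ := h
  subst h8 hi hj
  constructor <;> first | assumption | rfl | simpa [Store.setReal] | (ext; simp [Store.setReal, upd])

theorem setReal_scalar (a : ℕ) (r : ℝ) : (s.setReal a 4 4 r).real a 0 0 = r := by
  simp [Store.setReal, h.zero]

end Mem

section Runs

variable {O : FirstOrderOracle} {n m : ℕ} {b : ℕ → ℝ} {ε : ℝ} {o x w : ℕ → ℕ → ℝ}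
  {S c τ η N : ℝ} {s : Store}

theorem runs_initProg (h : Mem n m b ε o x w S c τ η N s) :
    Runs O initProg s (n * (m * 6 + 4) + 2)
      (Mem n m b ε o (fill n m (fun _ _ => 1) x) (fill n m (fun _ _ => 1) w) S c τ η N) := by
  have main := Runs.forTo_of_stable (O := O) (s := s) (v := 2) (w := 0) (T := m * (4 + 2) + 2)
    (P := .forTo 3 1 (.seq (.assign 3 2 3 (.const 1)) (.assign 4 2 3 (.const 1))))
    (fun k => Mem n m b ε o (fillRows m k 0 (fun _ _ => 1) x)
      (fillRows m k 0 (fun _ _ => 1) w) S c τ η N) n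
    (fun k s r hs => hs.setNat (.inl rfl) r) (fun k s hs => hs.rows) (fun k hk s hs hk' => ?_)
    (by simpa only [fillRows_zero] using h)
  · simp only [fillRows_eq_fill] at main
    exact main.mono (by ring_nf; omega) fun _ h => h
  · refine (Runs.forTo_of_stable (T := 4) (fun l s => s.nat 2 = k ∧
      Mem n m b ε o (fillRows m k l (fun _ _ => 1) x)
        (fillRows m k l (fun _ _ => 1) w) S c τ η N s) m
      (fun l s r hs => ⟨by simpa [Store.setNat] using hs.1, hs.2.setNat (.inr rfl) r⟩)
      (fun l s hs => hs.2.cols) (fun l hl s hs hl' => ?_) ⟨hk', hs⟩).mono le_rfl fun s hs => ?_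
    · refine Runs.seq (T := 2) (T' := 2) (Runs.assign (Q := fun s' => s'.nat 2 = k ∧ s'.nat 3 = l ∧
        Mem n m b ε o (fillRows m k (l + 1) (fun _ _ => 1) x)
          (fillRows m k l (fun _ _ => 1) w) S c τ η N s') (by simp [RExp.size]) ⟨hs.1, hl', ?_⟩)
        fun s' hs' => Runs.assign (by simp [RExp.size]) ⟨hs'.2.1, hs'.1, ?_⟩
      · rw [← upd_fillRows hl]
        simpa [RExp.eval] using hs.2.setAlloc hs.1 hl' 1
      · rw [← upd_fillRows (old := w) hl]
        simpa [RExp.eval] using hs'.2.2.setWeight hs'.1 hs'.2.1 1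
    · rw [← fillRows_row, ← fillRows_row]
      exact hs

/-- Run after the initialization, when array 3 holds ones, so the oracle values are the u_i(1, 1) of
the problem size. The numbers n and m are obtained as reals by adding 1 in each round. -/
theorem runs_sizeProg (h : Mem n m b ε o x w S c τ η N s) :
    Runs O sizeProg s (n * 15 + m * 6 + 8)
      (Mem n m b ε o x w (1 / ε + ∑ i ∈ Finset.range n, (1 + (b i + 1 / b i + O.value i x)) + m)
        c τ η N) := by
  refine Runs.mono (T := 4 + ((n * (13 + 2) + 2) + (m * (4 + 2) + 2)))
    (Runs.seq (Q := Mem n m b ε o x w (1 / ε) c τ η N) (Runs.assign (by simp [RExp.size, RExp.scalar]) ?_)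
    fun s hs => Runs.seq
      (Q := Mem n m b ε o x w
        (1 / ε + ∑ i ∈ Finset.range n, (1 + (b i + 1 / b i + O.value i x))) c τ η N)
      (Runs.forTo_of_stable (fun k => Mem n m b ε o x w
        (1 / ε + ∑ i ∈ Finset.range k, (1 + (b i + 1 / b i + O.value i x))) c τ η N) n
        (fun k s r hs => hs.setNat (.inl rfl) r) (fun k s hs => hs.rows)
        (fun k hk s hs hk' => Runs.seq (T := 1) (T' := 12) (Q := fun s' => s'.nat 2 = k ∧
          s'.real 11 0 0 = O.value k x ∧ Mem n m b ε o x w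
        (1 / ε + ∑ i ∈ Finset.range k, (1 + (b i + 1 / b i + O.value i x))) c τ η N s')
          (Runs.askValue ⟨hk', ?_, hs.setScratch (by norm_num) _⟩)
          fun s' hs' => Runs.assign (by simp [RExp.size, RExp.scalar]) ⟨hs'.1, ?_⟩)
        (by simpa using hs)) fun s hs => Runs.forTo_of_stable (fun l => Mem n m b ε o x w
        (1 / ε + ∑ i ∈ Finset.range n, (1 + (b i + 1 / b i + O.value i x)) + l) c τ η N) m
        (fun k s r hs => hs.setNat (.inr rfl) r) (fun k s hs => hs.cols)
        (fun l hl s hs hl' => Runs.assign (by simp [RExp.size, RExp.scalar]) ⟨hl', ?_⟩)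
        (by simpa using hs))
    (by ring_nf; omega) fun _ h => h
  · have := h.setSize (1 / ε)
    simpa [RExp.eval, RExp.scalar, h.zero, h.accuracy] using this
  · rw [hs.setReal_scalar, hk', hs.alloc]
  · have hm := hs'.2.2
    convert hm.setSize _ using 1
    simp [RExp.eval, RExp.scalar, hm.zero, hm.size, hm.budget, hs'.1, hs'.2.1,
      Finset.sum_range_succ, add_assoc]
  · convert hs.setSize _ using 1
    simp [RExp.eval, RExp.scalar, hs.zero, hs.size, add_assoc]

theorem runs_paramProg (h : Mem n m b ε o x w S c τ η N s) {τ' η' N' : ℝ}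
    (hτ : τ' = 1 / (108 * S ^ 7)) (hη : η' = τ' ^ 2 / (54 * S ^ 8)) (hN : N' = 54 * S ^ 7 / η') :
    Runs O paramProg s 70 (Mem n m b ε o x w S c τ' η' N') := by
  refine Runs.mono (T := 20 + (28 + 22)) (Runs.seq (Q := Mem n m b ε o x w S c τ' η N)
    (Runs.assign (by simp [RExp.size, RExp.scalar, RExp.npow]) ?_) fun s hs =>
    Runs.seq (Q := Mem n m b ε o x w S c τ' η' N)
      (Runs.assign (by simp [RExp.size, RExp.scalar, RExp.npow]) ?_) fun s hs =>
    Runs.assign (by simp [RExp.size, RExp.scalar, RExp.npow]) ?_) (by norm_num) fun _ h => h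
  · convert h.setMixing _ using 1
    simp [RExp.eval, RExp.scalar, RExp.eval_npow, h.zero, h.size, hτ]
  · convert hs.setStep _ using 1
    simp [RExp.eval, RExp.scalar, RExp.eval_npow, hs.zero, hs.size, hs.mixing, hη]
  · convert hs.setIters _ using 1
    simp [RExp.eval, RExp.scalar, RExp.eval_npow, hs.zero, hs.size, hs.step, hN]

/-- The allocation computed from weights. -/
noncomputable def nextAlloc (n m : ℕ) (S τ : ℝ) (x w : ℕ → ℕ → ℝ) : ℕ → ℕ → ℝ :=
  fill n m (fun i j => (1 - S * τ) * w i j / (∑ k ∈ Finset.range n, w k j) + τ) x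

/-- The weights after an update at the allocation `x`. -/
noncomputable def nextWeight (O : FirstOrderOracle) (n m : ℕ) (b : ℕ → ℝ) (η : ℝ)
    (x w : ℕ → ℕ → ℝ) : ℕ → ℕ → ℝ :=
  fill n m (fun i j => w i j * (1 + η * (b i * O.partialDeriv i j x / O.value i x))) w

/-- The mean of `c` allocations, the last of which is `x`, from the mean `o` of the others. -/
noncomputable def nextOut (n m : ℕ) (c : ℝ) (x o : ℕ → ℕ → ℝ) : ℕ → ℕ → ℝ :=
  fill n m (fun i j => o i j + (x i j - o i j) / c) o

theorem runs_allocProg (h : Mem n m b ε o x w S c τ η N s) :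
    Runs O allocProg s (m * (n * 20 + 8) + 2)
      (Mem n m b ε o (nextAlloc n m S τ x w) w S c τ η N) := by
  have main := Runs.forTo_of_stable (O := O) (s := s) (v := 3) (w := 1)
    (T := 2 + ((n * (4 + 2) + 2) + (n * (12 + 2) + 2)))
    (P := .seq (.assign 10 4 4 (.const 0))
      (.seq (.forTo 2 0 (.assign 10 4 4 (.add (.scalar 10) (.cell 4 2 3))))
        (.forTo 2 0 (.assign 3 2 3
          (.add (.div (.mul (.sub (.const 1) (.mul (.scalar 5) (.scalar 7))) (.cell 4 2 3))
            (.scalar 10)) (.scalar 7))))))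
    (fun l => Mem n m b ε o (fillCols n 0 l
      (fun i j => (1 - S * τ) * w i j / (∑ k ∈ Finset.range n, w k j) + τ) x) w S c τ η N) m
    (fun k s r hs => hs.setNat (.inr rfl) r) (fun k s hs => hs.cols)
    (fun l hl s hs hl' => ?_) (by simpa only [fillCols_zero] using h)
  · rw [fillCols_eq_fill] at main
    exact main.mono (by ring_nf; omega) fun _ h => h
  · set new : ℕ → ℕ → ℝ :=
      fun i j => (1 - S * τ) * w i j / (∑ k ∈ Finset.range n, w k j) + τ with hnew
    refine Runs.seq (Q := fun s' => s'.nat 3 = l ∧ s'.real 10 0 0 = 0 ∧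
        Mem n m b ε o (fillCols n 0 l new x) w S c τ η N s')
      (Runs.assign (by simp [RExp.size]) ⟨hl', ?_, hs.setScratch le_rfl _⟩) fun s hs =>
      Runs.seq (Q := fun s' => s'.nat 3 = l ∧ s'.real 10 0 0 = ∑ k ∈ Finset.range n, w k l ∧
        Mem n m b ε o (fillCols n 0 l new x) w S c τ η N s')
      (Runs.forTo_of_stable (fun k s' => s'.nat 3 = l ∧
          s'.real 10 0 0 = ∑ k ∈ Finset.range k, w k l ∧
          Mem n m b ε o (fillCols n 0 l new x) w S c τ η N s') n
        (fun k s r hs => ⟨by simpa [Store.setNat] using hs.1, hs.2.1,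
          hs.2.2.setNat (.inl rfl) r⟩)
        (fun k s hs => hs.2.2.rows) (fun k hk s hs hk' => Runs.assign
          (by simp [RExp.size, RExp.scalar])
          ⟨hk', hs.1, ?_, hs.2.2.setScratch le_rfl _⟩) (by simpa using hs)) fun s hs =>
      (Runs.forTo_of_stable (fun k s' => s'.nat 3 = l ∧
          s'.real 10 0 0 = ∑ k ∈ Finset.range n, w k l ∧
          Mem n m b ε o (fillCols n k l new x) w S c τ η N s') n
        (fun k s r hs => ⟨by simpa [Store.setNat] using hs.1, hs.2.1,
          hs.2.2.setNat (.inl rfl) r⟩)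
        (fun k s hs => hs.2.2.rows) (fun k hk s hs hk' => Runs.assign
          (by simp [RExp.size, RExp.scalar]) ⟨hk', hs.1, ?_, ?_⟩) hs).mono le_rfl
        fun s hs => ⟨hs.1, ?_⟩
    · rw [hs.setReal_scalar]
      simp [RExp.eval]
    · rw [hs.2.2.setReal_scalar]
      simp [RExp.eval, RExp.scalar, hs.2.2.zero, hs.2.1, hs.2.2.weight, hk', hs.1,
        Finset.sum_range_succ]
    · rw [← hs.2.1]
      simp [Store.setReal]
    · rw [← upd_fillCols hk]
      convert hs.2.2.setAlloc hk' hs.1 _ using 2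
      simp [RExp.eval, RExp.scalar, hs.2.2.zero, hs.2.1, hs.2.2.weight, hk', hs.1, hs.2.2.size,
        hs.2.2.mixing, hnew]
    · rw [← fillCols_col]
      exact hs.2.2

theorem runs_updateProg (h : Mem n m b ε o x w S c τ η N s) :
    Runs O updateProg s (n * (m * 30 + 5) + 2)
      (Mem n m b ε (nextOut n m c x o) x (nextWeight O n m b η x w) S c τ η N) := by
  set wn : ℕ → ℕ → ℝ :=
    fun i j => w i j * (1 + η * (b i * O.partialDeriv i j x / O.value i x)) with hwn
  set on : ℕ → ℕ → ℝ := fun i j => o i j + (x i j - o i j) / c with hon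
  have main := Runs.forTo_of_stable (O := O) (s := s) (v := 2) (w := 0)
    (T := 1 + (m * ((1 + (12 + 8)) + 2) + 2))
    (P := .seq (.askValue 11 4 4 2 3)
      (.forTo 3 1 (.seq (.askPartial 12 4 4 2 3 3)
        (.seq (.assign 4 2 3 (.mul (.cell 4 2 3) (.add (.const 1) (.mul (.scalar 8)
            (.div (.mul (.cell 0 2 4) (.scalar 12)) (.scalar 11))))))
          (.assign 2 2 3 (.add (.cell 2 2 3)
            (.div (.sub (.cell 3 2 3) (.cell 2 2 3)) (.scalar 6))))))))
    (fun k => Mem n m b ε (fillRows m k 0 on o) x (fillRows m k 0 wn w) S c τ η N) n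
    (fun k s r hs => hs.setNat (.inl rfl) r) (fun k s hs => hs.rows)
    (fun k hk s hs hk' => ?_) (by simpa only [fillRows_zero] using h)
  · rw [fillRows_eq_fill, fillRows_eq_fill] at main
    exact main.mono (by ring_nf; nlinarith) fun _ h => h
  · refine Runs.seq (Q := fun s' => s'.nat 2 = k ∧ s'.real 11 0 0 = O.value k x ∧
        Mem n m b ε (fillRows m k 0 on o) x (fillRows m k 0 wn w) S c τ η N s')
      (Runs.askValue ⟨hk', ?_, hs.setScratch (by norm_num) _⟩) fun s hs =>
      (Runs.forTo_of_stable (fun l s' => s'.nat 2 = k ∧ s'.real 11 0 0 = O.value k x ∧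
          Mem n m b ε (fillRows m k l on o) x (fillRows m k l wn w) S c τ η N s') m
        (fun l s r hs => ⟨by simpa [Store.setNat] using hs.1, hs.2.1,
          hs.2.2.setNat (.inr rfl) r⟩)
        (fun l s hs => hs.2.2.cols) (fun l hl s hs hl' => Runs.seq (T := 1) (T' := 12 + 8)
          (Q := fun s' => s'.nat 2 = k ∧ s'.nat 3 = l ∧ s'.real 11 0 0 = O.value k x ∧
            s'.real 12 0 0 = O.partialDeriv k l x ∧
            Mem n m b ε (fillRows m k l on o) x (fillRows m k l wn w) S c τ η N s')
          (Runs.askPartial ⟨hs.1, hl', ?_, ?_, hs.2.2.setScratch (by norm_num) _⟩) fun s hs =>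
          Runs.seq (T := 12) (T' := 8)
          (Q := fun s' => s'.nat 2 = k ∧ s'.nat 3 = l ∧ s'.real 11 0 0 = O.value k x ∧
            Mem n m b ε (fillRows m k l on o) x (fillRows m k (l + 1) wn w) S c τ η N s')
          (Runs.assign (by simp [RExp.size, RExp.scalar]) ⟨hs.1, hs.2.1, ?_, ?_⟩) fun s hs =>
          Runs.assign (by simp [RExp.size, RExp.scalar]) ⟨hs.2.1, hs.1, ?_, ?_⟩) hs).mono le_rfl
        fun s hs => ⟨hs.1, ?_⟩
    · rw [hs.setReal_scalar, hk', hs.alloc]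
    · rw [← hs.2.1]
      simp [Store.setReal]
    · rw [hs.2.2.setReal_scalar, hs.1, hl', hs.2.2.alloc]
    · rw [← hs.2.2.1]
      simp [Store.setReal]
    · obtain ⟨h2, h3, h11, h12, hm⟩ := hs
      rw [← upd_fillRows (old := w) hl]
      convert hm.setWeight h2 h3 _ using 2
      simp [RExp.eval, RExp.scalar, hm.zero, hm.weight, hm.step, hm.budget, h2, h3, h11, h12,
        fillRows_self, hwn]
    · rw [← hs.2.2.1]
      simp [Store.setReal]
    · obtain ⟨h2, h3, h11, hm⟩ := hs
      rw [← upd_fillRows (old := o) hl]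
      convert hm.setOut h2 h3 _ using 2
      simp [RExp.eval, RExp.scalar, hm.zero, hm.out, hm.alloc, hm.count, h2, h3,
        fillRows_self, hon]
    · rw [← fillRows_row, ← fillRows_row]
      exact hs.2.2

/-- Mean allocation, allocation and weights after a number of iterations. -/
noncomputable def iterates (O : FirstOrderOracle) (n m : ℕ) (b : ℕ → ℝ) (S τ η : ℝ)
    (o x w : ℕ → ℕ → ℝ) : ℕ → (ℕ → ℕ → ℝ) × (ℕ → ℕ → ℝ) × (ℕ → ℕ → ℝ)
  | 0 => (o, x, w)
  | t + 1 =>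
    let q := iterates O n m b S τ η o x w t
    let x' := nextAlloc n m S τ q.2.1 q.2.2
    (nextOut n m (t + 1) x' q.1, x', nextWeight O n m b η x' q.2.2)

theorem runs_mainProg (h : Mem n m b ε o x w 0 0 0 0 0 s) {S' τ' η' : ℝ} {K : ℕ}
    (hS : S' = 1 / ε + ∑ i ∈ Finset.range n,
      (1 + (b i + 1 / b i + O.value i (fill n m (fun _ _ => 1) x))) + m)
    (hτ : τ' = 1 / (108 * S' ^ 7)) (hη : η' = τ' ^ 2 / (54 * S' ^ 8))
    (hK : K = ⌈54 * S' ^ 7 / η'⌉₊) :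
    Runs O mainProg s (200 * ((n + 1) * (m + 1) * (K + 1))) fun s' =>
      s'.real 2 = (iterates O n m b S' τ' η' o (fill n m (fun _ _ => 1) x)
        (fill n m (fun _ _ => 1) w) K).1 := by
  set q := iterates O n m b S' τ' η' o (fill n m (fun _ _ => 1) x) (fill n m (fun _ _ => 1) w)
    with hq
  refine Runs.mono
    (T := (n * (m * 6 + 4) + 2) + ((n * 15 + m * 6 + 8) + (70 +
      (K * (((m * (n * 20 + 8) + 2) + (4 + (n * (m * 30 + 5) + 2))) + 3) + 3))))
    ((runs_initProg h).seq fun s h => (runs_sizeProg h).seq fun s h =>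
      (runs_paramProg (hS ▸ h) hτ hη rfl).seq fun s h =>
      Runs.loop (b := .realLt (.scalar 6) (.scalar 9)) (fun k => Mem n m b ε (q k).1 (q k).2.1
        (q k).2.2 S' k τ' η' (54 * S' ^ 7 / η')) K
        (fun k hk s hs => ⟨?_, (runs_allocProg hs).seq fun s hs => Runs.seq
          (Q := Mem n m b ε (q k).1 (nextAlloc n m S' τ' (q k).2.1 (q k).2.2) (q k).2.2 S'
            (k + 1) τ' η' (54 * S' ^ 7 / η'))
          -- The count is raised before the mean is updated, so the divisor is k + 1, never 0.
          (Runs.assign (by simp [RExp.size, RExp.scalar]) ?_) fun s hs =>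
          (runs_updateProg hs).mono le_rfl fun s hs => by
            simpa [hq, iterates] using hs⟩)
        (fun s hs => ?_) (by simpa [hq, iterates] using h)) ?_ fun s hs => hs.out
  -- For a natural number k, k < ⌈N⌉ iff k < N, so the real comparison stops the loop after exactly
  -- K rounds.
  · rw [hK, Nat.lt_ceil] at hk
    simpa [Test.holds, RExp.eval, RExp.scalar, hs.zero, hs.count, hs.iters] using hk
  · convert hs.setCount _ using 1
    simp [RExp.eval, RExp.scalar, hs.zero, hs.count]
  · simp only [Test.holds, RExp.eval, RExp.scalar, hs.zero, hs.count, hs.iters, not_lt]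
    rw [hK]
    exact Nat.le_ceil _
  · have h1 : n * m ≤ n * m * K + n * m := by omega
    ring_nf
    nlinarith [Nat.zero_le (n * m * K), Nat.zero_le (n * K), Nat.zero_le (m * K)]

end Runs

end EquilibriumProgram

/-! ### Correctness and polynomial running time. -/

namespace InfluenceFisherMarket

variable {n m : ℕ} {M : InfluenceFisherMarket n m}

open EquilibriumProgram

theorem mem_input (ε : ℝ) : Mem n m (fun i => if h : i < n then M.budget ⟨i, h⟩ else 0) ε
    (fun _ _ => 0) (fun _ _ => 0) (fun _ _ => 0) 0 0 0 0 0 (M.input ε) := by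
  constructor <;> simp [input]

theorem oracle_value (hM : M.Regular) (i : Fin n) {A : ℕ → ℕ → ℝ}
    (hA : ∀ k l, 0 ≤ readAlloc n m A k l) :
    M.oracle.value i A = M.own i (readAlloc n m A i) := by
  simp only [oracle, i.isLt, dif_pos]
  exact hM.util_eq i (hA i) hA

theorem oracle_partialDeriv (hM : M.Regular) (i : Fin n) (j : Fin m) {A : ℕ → ℕ → ℝ}
    (hA : ∀ k l, 0 ≤ readAlloc n m A k l) :
    M.oracle.partialDeriv i j A =
      fderivWithin ℝ (M.own i) (Set.Ici 0) (readAlloc n m A i) (Pi.single j 1) := by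
  simp only [oracle, i.isLt, j.isLt, and_self, dif_pos]
  congr 1
  exact fderivWithin_congr (fun z hz => hM.util_eq i hz hA) (hM.util_eq i (hA i) hA)

theorem size_eq_problemSize (hM : M.Regular) (ε : ℝ) :
    1 / ε + ∑ i ∈ Finset.range n, (1 + ((if h : i < n then M.budget ⟨i, h⟩ else 0) +
      1 / (if h : i < n then M.budget ⟨i, h⟩ else 0) +
      M.oracle.value i (fill n m (fun _ _ => 1) fun _ _ => 0))) + m = M.problemSize ε := by
  have hone : readAlloc n m (fill n m (fun _ _ => 1) fun _ _ => 0) = 1 := by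
    ext i j
    simp [readAlloc, fill]
  rw [Finset.sum_range, problemSize, Finset.sum_add_distrib]
  have h : ∀ i : Fin n, M.oracle.value i (fill n m (fun _ _ => 1) fun _ _ => 0) =
      M.util i 1 1 := by
    intro i
    rw [oracle_value hM i (by simp [hone]), hone,
      hM.util_eq i (z := 1) zero_le_one (x := 1) (by simp)]
    rfl
  simp only [h, Fin.is_lt, dif_pos, Fin.eta]
  simp
  ring

/-- The recursion o + (x - o)/c is a running mean: c times the output gains x in round c. The
initial all-ones allocation is not averaged, whence the index t + 1. -/
theorem readAlloc_iterates_mean (O : FirstOrderOracle) (b : ℕ → ℝ) (S τ η : ℝ)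
    (x w : ℕ → ℕ → ℝ) {K : ℕ} (hK : 0 < K) :
    readAlloc n m (iterates O n m b S τ η (fun _ _ => 0) x w K).1 =
      (K : ℝ)⁻¹ • ∑ t ∈ Finset.range K,
        readAlloc n m (iterates O n m b S τ η (fun _ _ => 0) x w (t + 1)).2.1 := by
  set q := iterates O n m b S τ η (fun _ _ => 0) x w with hq
  have key : ∀ (K : ℕ) (i : Fin n) (j : Fin m), K * readAlloc n m (q K).1 i j =
      ∑ t ∈ Finset.range K, readAlloc n m (q (t + 1)).2.1 i j := by
    intro K i j
    induction K with
    | zero => simp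
    | succ K ih =>
      rw [Finset.sum_range_succ, ← ih]
      have h1 : readAlloc n m (q (K + 1)).1 i j = readAlloc n m (q K).1 i j +
          (readAlloc n m (q (K + 1)).2.1 i j - readAlloc n m (q K).1 i j) / (K + 1) := by
        conv_lhs => simp only [hq, iterates, readAlloc, nextOut, fill]
        simp only [i.isLt, j.isLt, and_self, if_true, readAlloc]
        rfl
      rw [h1]
      push_cast
      field_simp
      ring
  have hK' : (K : ℝ) ≠ 0 := by exact_mod_cast hK.ne'
  ext i j
  rw [Pi.smul_apply, Pi.smul_apply, Finset.sum_apply, Finset.sum_apply, ← key, smul_eq_mul,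
    inv_mul_cancel_left₀ hK']

/-- The program computes approximate equilibrium allocations in polynomially many steps. -/
theorem exists_exec_mainProg (hM : M.Regular) (hn : 0 < n) (hm : 0 < m) {ε : ℝ} (hε : 0 < ε) :
    ∃ (s : Store) (t : ℕ), Exec M.oracle mainProg (M.input ε) s t ∧
      (t : ℝ) ≤ (6802445200 : ℕ) * M.problemSize ε ^ 31 ∧ M.IsApproxCEAlloc ε (output n m s) := by
  set S := M.problemSize ε with hS
  set τ := 1 / (108 * S ^ 7) with hτ
  set η := τ ^ 2 / (54 * S ^ 8) with hη
  set K := ⌈54 * S ^ 7 / η⌉₊ with hK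
  have hb := hM.budget_pos
  have hutil : ∀ i, M.util i 1 1 = M.own i 1 := fun i =>
    hM.util_eq i (z := 1) zero_le_one (x := 1) (by simp)
  have hown : ∀ i, 0 ≤ M.own i 1 := fun i => (hM.isCCH i).nonneg 1 zero_le_one
  have hterm : ∀ i, 0 ≤ M.budget i + 1 / M.budget i + M.util i 1 1 := fun i => by
    have := hb i
    have := hown i
    rw [hutil]
    positivity
  have hsum0 : 0 ≤ ∑ i, (M.budget i + 1 / M.budget i + M.util i 1 1) :=
    Finset.sum_nonneg fun i _ => hterm i
  have hSdef : S = n + m + 1 / ε + ∑ i, (M.budget i + 1 / M.budget i + M.util i 1 1) := rfl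
  have hn1 : (1 : ℝ) ≤ n := by exact_mod_cast hn
  have hm1 : (1 : ℝ) ≤ m := by exact_mod_cast hm
  have hε1 : 0 < 1 / ε := by positivity
  have hS1 : 1 ≤ S := by linarith
  have hS0 : 0 < S := by linarith
  have hτ0 : 0 < τ := by positivity
  have hη0 : 0 < η := by positivity
  have hi : ∀ i, M.budget i + 1 / M.budget i + M.util i 1 1 ≤ S := fun i => by
    have := Finset.single_le_sum
      (f := fun i => M.budget i + 1 / M.budget i + M.util i 1 1) (fun i _ => hterm i)
      (Finset.mem_univ i)
    linarith
  have hKpos : 0 < K := Nat.ceil_pos.2 (by positivity)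
  obtain ⟨s, t, hex, ht, hout⟩ := runs_mainProg (O := M.oracle) (mem_input (M := M) ε)
    (size_eq_problemSize hM ε).symm hτ hη hK
  refine ⟨s, t, hex, ?_, ?_⟩
  · have h1 : (t : ℝ) ≤ 200 * ((n + 1) * (m + 1) * (K + 1)) := by exact_mod_cast ht
    -- 54 S^7/η = 54 S^7 · 54 S^8 · (108 S^7)², with coefficient 54² · 108² = 34012224; rounding up
    -- and adding 1 cost at most 2.
    have h2 : (K : ℝ) + 1 ≤ 34012226 * S ^ 29 := by
      have h3 := Nat.ceil_lt_add_one (show 0 ≤ 54 * S ^ 7 / η by positivity)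
      have h4 : 54 * S ^ 7 / η = 34012224 * S ^ 29 := by
        rw [hη, hτ]
        field_simp
        norm_num
      have h5 : 1 ≤ S ^ 29 := one_le_pow₀ hS1
      rw [h4] at h3
      rw [hK, h4]
      linarith
    have h3 : (n : ℝ) + 1 ≤ S := by linarith
    have h4 : (m : ℝ) + 1 ≤ S := by linarith
    calc (t : ℝ) ≤ 200 * ((n + 1) * (m + 1) * (K + 1)) := h1
      _ ≤ 200 * (S * S * (34012226 * S ^ 29)) := by gcongr
      _ = (6802445200 : ℕ) * S ^ 31 := by push_cast; ring
  · rw [output, hout, readAlloc_iterates_mean _ _ _ _ _ _ _ hKpos]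
    set q := iterates M.oracle n m (fun i => if h : i < n then M.budget ⟨i, h⟩ else 0) S τ η
      (fun _ _ => 0) (fill n m (fun _ _ => 1) fun _ _ => 0)
      (fill n m (fun _ _ => 1) fun _ _ => 0) with hq
    refine isApproxCEAlloc_of_multiplicative_weights hM hn hS1 (by linarith) (by linarith) ?_
      (fun i => ?_) (fun i => ?_) ?_ hτ hη (Nat.le_ceil _)
      -- Each round computes the allocation from the weights before updating them, so weights of
      -- index t go with the allocation of index t + 1.
      (w := fun t => readAlloc n m (q t).2.2) (fun i j => ?_) (fun t i j => ?_)
      fun t i j hpos => ?_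
    · have h1 : ∑ i, M.budget i ≤ ∑ i, (M.budget i + 1 / M.budget i + M.util i 1 1) :=
        Finset.sum_le_sum fun i _ => by
          have := hown i
          have : 0 < 1 / M.budget i := one_div_pos.2 (hb i)
          rw [hutil]
          linarith
      linarith
    · have := hi i
      have := hb i
      have := hown i
      rw [hutil] at *
      linarith
    · have := hi i
      have := hb i
      have : 0 < 1 / M.budget i := one_div_pos.2 (hb i)
      rw [hutil] at *
      linarith
    · rw [div_le_iff₀ hS0]
      have : ε * (1 / ε) = 1 := by field_simp
      have : ε * (1 / ε) ≤ ε * S := by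
        gcongr
        linarith
      linarith
    · simp [hq, iterates, readAlloc, fill]
    · simp only [hq, iterates, readAlloc, nextAlloc, fill, i.isLt, j.isLt, and_self, if_true]
      rw [Finset.sum_range]
    · have h0 : ∀ k l, 0 ≤ readAlloc n m (q (t + 1)).2.1 k l := fun k l => (hpos k l).le
      have h1 : readAlloc n m (q (t + 1)).2.2 i j = readAlloc n m (q t).2.2 i j *
          (1 + η * (M.budget i * M.oracle.partialDeriv i j (q (t + 1)).2.1 /
            M.oracle.value i (q (t + 1)).2.1)) := by
        conv_lhs => simp only [hq, iterates, readAlloc, nextWeight, fill]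
        simp only [i.isLt, j.isLt, and_self, if_true, dif_pos, Fin.eta]
        rfl
      rw [h1, oracle_partialDeriv hM i j h0, oracle_value hM i h0, mul_div_assoc]
      rfl

end InfluenceFisherMarket

theorem mainTheorem8 :
    (∀ (n m : ℕ), 0 < n → 0 < m → ∀ M : InfluenceFisherMarket n m, M.Regular →
      (∀ x ∈ M.feasiblePos, ∀ y ∈ M.feasiblePos, 0 ≤ InfluenceFisherMarket.dot (M.viOp x - M.viOp y) (x - y)) ∧
      (∃ x, x ∈ M.feasiblePos) ∧
      ∀ x₀ ∈ M.feasiblePos, ∃ η₀ : ℝ, 0 < η₀ ∧ ∀ η : ℝ, 0 < η → η ≤ η₀ →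
        (∀ T : ℕ, M.egIter η x₀ T ∈ M.feasiblePos ∧
          M.egHalf η (M.egIter η x₀ T) ∈ M.feasiblePos) ∧
        (∃ x, M.IsCEAlloc x ∧ Tendsto (fun T => M.egIter η x₀ T) atTop (𝓝 x)) ∧
        ∃ C : ℝ, ∀ T : ℕ, 1 ≤ T →
          (∀ y ∈ InfluenceFisherMarket.feasible n m,
            InfluenceFisherMarket.dot (M.viOp (M.egIter η x₀ T))
              (M.egIter η x₀ T - y) ≤ C / T) ∧
          M.IsApproxCEAlloc (C / T) (M.egIter η x₀ T)) ∧
    (∃ (P : Prog) (c k : ℕ), ∀ (n m : ℕ), 0 < n → 0 < m →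
      ∀ M : InfluenceFisherMarket n m, M.Regular → ∀ ε : ℝ, 0 < ε →
        ∃ (s : Store) (t : ℕ), Exec M.oracle P (M.input ε) s t ∧
          (t : ℝ) ≤ c * M.problemSize ε ^ k ∧
          M.IsApproxCEAlloc ε (InfluenceFisherMarket.output n m s)) := by
  refine ⟨fun n m hn _ M hM => ⟨fun x hx y hy => InfluenceFisherMarket.viOp_monotone hM hx hy,
    InfluenceFisherMarket.exists_mem_feasiblePos hM hn, fun x₀ hx₀ =>
    InfluenceFisherMarket.extragradient_convergence hM hn hx₀⟩, ?_⟩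
  exact ⟨EquilibriumProgram.mainProg, 6802445200, 31, fun n m hn hm M hM ε hε =>
    InfluenceFisherMarket.exists_exec_mainProg hM hn hm hε⟩
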